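/- **Definitions.** A *labeled circle graph* on $n$ points is a simple graph on the vertices $1,\dots,n$, placed counterclockwise on a circle, with edges drawn as chords; deleting the labels gives an *unlabeled circle graph*, two of these being isomorphic when they differ by a rotation of the circle. A *circle tree* is a circle graph that is a tree. Its *genus* is $1+\frac12\bigl(N-1-z(\alpha)-z(\alpha^{-1}\sigma)\bigr)$, where each vertex of degree $d$ is split into $d$ consecutive points of the circle, one for each edge end, so that edges with a common endpoint do not cross, $N$ is the number of the resulting points, $\sigma$ is the cyclic permutation of these points in counterclockwise order, $\alpha$ is the matching that exchanges the two ends of every edge, and $z$ counts cycles. Two edges *cross* if they meet in a point that is not an endpoint; an edge is *crossed* if some edge crosses it, and *uncrossed* otherwise; two edges are *parallel* if they are crossed by the same edges. Write $\widehat{XY}$ for the closed arc from $X$ counterclockwise to $Y$. For a crossed edge $AB$ of $G$ consider all edges parallel to $AB$ that can be joined to $AB$ by a path of edges (containing both) each of which is uncrossed or parallel to $AB$. Let $CD$ and $EF$ be the outermost ones among them ($CD=EF$ allowed), named so that $D,E,F,C$ follow each other counterclockwise in the weak sense and each of these edges joins $\widehat{DE}$ to $\widehat{FC}$. The *e-graph*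 of $G$ containing $AB$ consists of the edges with both endpoints on $\widehat{DE}\cup\widehat{FC}$ that are uncrossed or parallel to $AB$; $\widehat{DE}$ and $\widehat{FC}$ are its arcs, and its points are the endpoints of its edges. The *e-reduction* of a circle tree $T$: (1) in every e-graph delete all crossed edges except one, chosen arbitrarily; (2) delete all uncrossed edges; (3) whenever two different e-graphs of $T$ are connected by a path of uncrossed edges of $T$ from a point $u$ of the first to a point $v$ of the second, with no other point in these two e-graphs and no point in any other e-graph, add the edge that joins the endpoint of the remaining edge of the first e-graph lying on the same arc of that e-graph as $u$ with the endpoint of the remaining edge of the second e-graph lying on the same arc of that e-graph as $v$. Points left without an edge are discarded. The unlabeled circle graph after step (2) is the *pre-reduced form* of $T$, the one after step (3) is its *reduced form*. Let $a,b,c,\dots$ be points in counterclockwise order on a circle, and define unlabeled circle graphs by their edges: $T_2^1$ (4 points): $ac,bd$; $T_2^2$ (6 points): $ad,bf,ce$; $T_2^3$ (8 points): $ad,he,bg,cf$; $T_2^4$ (6 points): $ad,be,cf$; $T_2^5$ (8 points): $ad,he,bf,cg$; $T_2^6$ (10 points): $af,bh,cg,dj,ei$; $T_2^7$ (12 points):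 $af,lg,bi,ch,dk,ej$. Let $T_3^i[j]$ be obtained from $T_2^i$ by adding the $j$-th of the following sets of edges: $i=1$: $\{ab\}$; $i=2$: $\{fa,de\},\{fa,cd\},\{ab,de\}$; $i=3$: $\{ab,cd,ef\}$; $i=4$: $\{ab,bc\},\{ab,cd\}$; $i=5$: $\{ef,ab,fg\},\{ef,ab,gh\},\{ef,cd,bc\},\{ef,cd,fg\},\{ef,cd,gh\},\{gh,cd,bc\}$; $i=6$: $\{ab,cd,ef,fg\},\{cd,ef,fg,hi\},\{ab,cd,ef,ja\},\{ab,cd,fg,hi\},\{ab,ef,fg,ja\},\{cd,ef,hi,ja\}$. **Theorem 2.** The set of pre-reduced forms of genus one unlabeled circle trees is $\{T_2^1,\dots,T_2^6\}$; these six are pairwise non-isomorphic, and $T_2^7$ is not a pre-reduced form of a genus one circle tree. The set of reduced forms of genus one unlabeled circle trees consists of the nineteen pairwise non-isomorphic trees $T_3^1[1]$; $T_3^2[1],T_3^2[2],T_3^2[3]$; $T_3^3[1]$; $T_3^4[1],T_3^4[2]$; $T_3^5[1],\dots,T_3^5[6]$; $T_3^6[1],\dots,T_3^6[6]$. For each $i\le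 6$ the reduced forms of the genus one trees with pre-reduced form $T_2^i$ are exactly the $T_3^i[j]$. Every genus one circle tree reduces to exactly one of the nineteen forms (whatever edges are kept in step (1)). -/

import Mathlib

namespace CircleTree

open SimpleGraph

/-!
A labeled circle graph (l-c-graph) on `n` points is a `SimpleGraph (Fin n)`: the vertices
`0, 1, …, n - 1` lie in this order, counterclockwise, on a circle, and the edges are straight
chords. Edges are elements of `Sym2 (Fin n)`.
-/

section Labeled

variable {n : ℕ}

/-- Two chords cross: they have a common point that is not an endpoint, that is, their four
endpoints are distinct and alternate around the circle. -/
def Cross (e f : Sym2 (Fin n)) : Prop :=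
  ∃ p q r t : Fin n, p < q ∧ q < r ∧ r < t ∧
    ((e = s(p, r) ∧ f = s(q, t)) ∨ (e = s(q, t) ∧ f = s(p, r)))

/-- `e` is an edge of `G` that is crossed by some edge of `G`. -/
def Crossed (G : SimpleGraph (Fin n)) (e : Sym2 (Fin n)) : Prop :=
  e ∈ G.edgeSet ∧ ∃ f ∈ G.edgeSet, Cross e f

/-- `e` is an edge of `G` that is crossed by no edge of `G`. -/
def Uncrossed (G : SimpleGraph (Fin n)) (e : Sym2 (Fin n)) : Prop :=
  e ∈ G.edgeSet ∧ ∀ f ∈ G.edgeSet, ¬ Cross e f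

/-- The edges `e` and `f` of `G` are parallel: they cross the same edges of `G`. -/
def Parallel (G : SimpleGraph (Fin n)) (e f : Sym2 (Fin n)) : Prop :=
  e ∈ G.edgeSet ∧ f ∈ G.edgeSet ∧ ∀ g ∈ G.edgeSet, (Cross e g ↔ Cross f g)

/-! ### Genus

The matching of a l-c-tree lives on the edge ends: every vertex of degree `d` is split into `d`
consecutive points on the circle, one for each edge end, in such a way that edges with a common
endpoint do not cross. The dart `(v, w)` stands for the end at `v` of the edge `vw`.
-/

/-- Position of an edge end, counted counterclockwise from vertex `0`. Among the ends at one
vertex `v`, an end whose edge leads farther around (counterclockwise from `v`) comes first. -/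
def dartPos (G : SimpleGraph (Fin n)) (d : G.Dart) : ℕ :=
  (d.fst : ℕ) * n + (n - 1 - ((d.snd - d.fst : Fin n) : ℕ))

theorem dartPos_injective (G : SimpleGraph (Fin n)) : Function.Injective (dartPos G) := by
  intro d d' h
  have key : ∀ a b r s : ℕ, r < n → s < n → a * n + r = b * n + s → a = b ∧ r = s := by
    intro a b r s hr hs h
    have h1 : a = b := by
      rcases lt_trichotomy a b with hab | hab | hab
      · nlinarith
      · exact hab
      · nlinarith
    subst h1
    exact ⟨rfl, by omega⟩
  have hn : 0 < n := lt_of_le_of_lt (Nat.zero_le _) d.fst.isLt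
  have l1 := (d.snd - d.fst).isLt
  have l2 := (d'.snd - d'.fst).isLt
  obtain ⟨h1, h2⟩ := key _ _ _ _ (by omega) (by omega) h
  have e1 : d.fst = d'.fst := Fin.ext h1
  have e2 : d.snd - d.fst = d'.snd - d'.fst := Fin.ext (by omega)
  have : NeZero n := ⟨hn.ne'⟩
  rw [e1] at e2
  exact Dart.ext _ _ (Prod.ext e1 (sub_left_injective e2))

/-- The edge ends, ordered by their position. -/
noncomputable abbrev dartOrder (G : SimpleGraph (Fin n)) : LinearOrder G.Dart :=
  LinearOrder.lift' (dartPos G) (dartPos_injective G)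

open Classical in
/-- The cyclic permutation `σ = (1 2 … N)` of the `N` edge ends in counterclockwise order. -/
noncomputable def sigma (G : SimpleGraph (Fin n)) : Equiv.Perm G.Dart :=
  letI := dartOrder G
  (Fintype.orderIsoFinOfCardEq G.Dart rfl).toEquiv.permCongr (finRotate (Fintype.card G.Dart))

/-- The matching `α`: the two ends of every edge are exchanged. -/
def alpha (G : SimpleGraph (Fin n)) : Equiv.Perm G.Dart :=
  ⟨Dart.symm, Dart.symm, Dart.symm_symm, Dart.symm_symm⟩

/-- The number of cycles of a permutation, fixed points included. -/
noncomputable def cycleCount {X : Type*} (f : Equiv.Perm X) : ℕ :=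
  Nat.card (Quotient (Equiv.Perm.SameCycle.setoid f))

/-- The genus `1 + (N - 1 - z(α) - z(α⁻¹ σ)) / 2`, where `N` is the number of points that the
permutations `α` and `σ` act on. -/
noncomputable def genus (G : SimpleGraph (Fin n)) : ℚ :=
  1 + ((Nat.card G.Dart : ℚ) - 1 - cycleCount (alpha G)
    - cycleCount ((alpha G)⁻¹ * sigma G)) / 2

/-! ### E-graphs -/

/-- `x` lies on the closed arc from `a` counterclockwise to `b` (only `a` if `a = b`). -/
def OnArc (a b x : Fin n) : Prop := x - a ≤ b - a

/-- Going counterclockwise from `a` one meets `b`, `c`, `d` in this (weak) order. -/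
def InOrder (a b c d : Fin n) : Prop := b - a ≤ c - a ∧ c - a ≤ d - a

/-- There is a path of edges `e = b₁, b₂, …, b_m = f` of `G`, consecutive ones sharing the
successive points of the path, each of them uncrossed or parallel to `e`. -/
def Linked (G : SimpleGraph (Fin n)) (e f : Sym2 (Fin n)) : Prop :=
  ∃ (u v : Fin n) (p : G.Walk u v), p.edges.head? = some e ∧ p.edges.getLast? = some f ∧
    ∀ b ∈ p.edges, Uncrossed G b ∨ Parallel G e b

/-- The edges `a₁, …, a_l` parallel to `e` that are linked to `e`. -/
def linkedParallels (G : SimpleGraph (Fin n)) (e : Sym2 (Fin n)) : Set (Sym2 (Fin n)) :=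
  {f | Parallel G e f ∧ Linked G e f}

/-- `CD` and `EF` are the outermost edges of the set `S` of parallel edges: they belong to `S`,
the points `D, E, F, C` follow each other counterclockwise, and every edge in `S` joins the arc
from `D` to `E` and the arc from `F` to `C`. -/
def Outermost (S : Set (Sym2 (Fin n))) (C D E F : Fin n) : Prop :=
  s(C, D) ∈ S ∧ s(E, F) ∈ S ∧ InOrder D E F C ∧
    ∀ f ∈ S, ∃ x y, f = s(x, y) ∧ OnArc D E x ∧ OnArc F C y

/-- The (edge set of the) e-graph of `G` containing the crossed edge `e`. -/
def eGraph (G : SimpleGraph (Fin n)) (e : Sym2 (Fin n)) : Set (Sym2 (Fin n)) :=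
  {f | (Uncrossed G f ∨ Parallel G e f) ∧
    ∃ C D E F, Outermost (linkedParallels G e) C D E F ∧ ∀ x ∈ f, OnArc D E x ∨ OnArc F C x}

/-- The points of the e-graph containing `e`. -/
def eGraphPoints (G : SimpleGraph (Fin n)) (e : Sym2 (Fin n)) : Set (Fin n) :=
  {x | ∃ f ∈ eGraph G e, x ∈ f}

/-- `x` and `y` lie on the same one of the two arcs of the e-graph containing `e`. (The two
outermost edges may be exchanged, so the arc from `D` to `E` stands for either arc.) -/
def OnSameArc (G : SimpleGraph (Fin n)) (e : Sym2 (Fin n)) (x y : Fin n) : Prop :=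
  ∃ C D E F, Outermost (linkedParallels G e) C D E F ∧ OnArc D E x ∧ OnArc D E y

/-! ### E-reduction -/

/-- `R` consists of crossed edges and contains exactly one edge of each e-graph of `T`. -/
def IsSelection (T : SimpleGraph (Fin n)) (R : Set (Sym2 (Fin n))) : Prop :=
  (∀ r ∈ R, Crossed T r) ∧ ∀ e, Crossed T e → ∃! r, r ∈ R ∧ r ∈ eGraph T e

/-- First step: in every e-graph all crossed edges but the selected one are deleted. -/
def stepOne (T : SimpleGraph (Fin n)) (R : Set (Sym2 (Fin n))) : SimpleGraph (Fin n) :=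
  T.deleteEdges {e | Crossed T e ∧ e ∉ R}

/-- Second step: all uncrossed edges are deleted. -/
def stepTwo (T : SimpleGraph (Fin n)) (R : Set (Sym2 (Fin n))) : SimpleGraph (Fin n) :=
  (stepOne T R).deleteEdges {e | Uncrossed (stepOne T R) e}

/-- The e-graphs of `T` that contain the crossed edges `e₁` and `e₂` are different and are
connected by a path of uncrossed edges from the point `u` of the first to the point `v` of the
second; the path has no other point in these two e-graphs and no point in any other e-graph. -/
def ConnectedBy (T : SimpleGraph (Fin n)) (e₁ e₂ : Sym2 (Fin n)) (u v : Fin n) : Prop :=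
  eGraph T e₁ ≠ eGraph T e₂ ∧ u ∈ eGraphPoints T e₁ ∧ v ∈ eGraphPoints T e₂ ∧
    ∃ p : T.Walk u v, (∀ b ∈ p.edges, Uncrossed T b) ∧ ∀ x ∈ p.support,
      (x ∈ eGraphPoints T e₁ → x = u) ∧ (x ∈ eGraphPoints T e₂ → x = v) ∧
      ∀ g, Crossed T g → eGraph T g ≠ eGraph T e₁ → eGraph T g ≠ eGraph T e₂ →
        x ∉ eGraphPoints T g

/-- Third step: for all selected edges `r₁`, `r₂` whose e-graphs are connected by a path of
uncrossed edges from `u` to `v`, the edge `ab` is added, where `a` is the endpoint of `r₁` on the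
same arc of the first e-graph as `u`, and `b` the endpoint of `r₂` on the same arc of the second
e-graph as `v`. -/
def stepThree (T : SimpleGraph (Fin n)) (R : Set (Sym2 (Fin n))) : SimpleGraph (Fin n) :=
  stepTwo T R ⊔ SimpleGraph.fromEdgeSet
    {e | ∃ r₁ ∈ R, ∃ r₂ ∈ R, ∃ u v, ConnectedBy T r₁ r₂ u v ∧
      ∃ a ∈ r₁, ∃ b ∈ r₂, OnSameArc T r₁ a u ∧ OnSameArc T r₂ b v ∧ e = s(a, b)}

end Labeled

/-! ### Unlabeled circle graphs -/

/-- A labeled circle graph on any number of points. -/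
abbrev LCGraph : Type := Σ n : ℕ, SimpleGraph (Fin n)

/-- Two labeled circle graphs become isomorphic after deletion of the labels: they differ by a
rotation of the circle. -/
def SameUnlabeled (G H : LCGraph) : Prop :=
  ∃ φ : G.2 ≃g H.2, ∃ k : ℕ, ∀ x, (φ x : ℕ) = ((x : ℕ) + k) % H.1

theorem SameUnlabeled.card_eq {G H : LCGraph} (h : SameUnlabeled G H) : G.1 = H.1 := by
  obtain ⟨φ, -⟩ := h
  simpa using Fintype.card_congr φ.toEquiv

instance ucSetoid : Setoid LCGraph where
  r := SameUnlabeled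
  iseqv :=
    { refl := fun G => ⟨Iso.refl, 0, fun x => by
        simpa using (Nat.mod_eq_of_lt x.isLt).symm⟩
      symm := by
        intro G H h
        have hc := h.card_eq
        obtain ⟨n, G⟩ := G
        obtain ⟨m, H⟩ := H
        dsimp only at hc
        subst hc
        obtain ⟨φ, k, hk⟩ := h
        refine ⟨φ.symm, n - k % n, fun y => ?_⟩
        have h1 := hk (φ.symm y)
        simp only [RelIso.apply_symm_apply] at h1
        have hx := (φ.symm y).isLt
        have hkn := Nat.mod_lt k (lt_of_le_of_lt (Nat.zero_le _) hx)
        dsimp only at h1 hx hkn ⊢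
        rw [h1, Nat.mod_add_mod, add_assoc]
        have h2 : k + (n - k % n) = n * (k / n + 1) := by
          have := Nat.div_add_mod k n
          rw [mul_add, mul_one]
          omega
        rw [h2, Nat.add_mul_mod_self_left]
        exact (Nat.mod_eq_of_lt hx).symm
      trans := by
        rintro G H K ⟨φ, k, hk⟩ ⟨ψ, l, hl⟩
        have hc : H.1 = K.1 := SameUnlabeled.card_eq ⟨ψ, l, hl⟩
        refine ⟨φ.trans ψ, k + l, fun x => ?_⟩
        have : ((φ.trans ψ) x : ℕ) = (ψ (φ x) : ℕ) := rfl
        rw [this, hl, hk, hc, Nat.mod_add_mod, add_assoc] }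

/-- Unlabeled circle graphs (u-c-graphs), up to isomorphism. -/
def UCGraph : Type := Quotient ucSetoid

/-- The u-c-graph obtained from a l-c-graph by deletion of the labels. -/
def unlabel {n : ℕ} (G : SimpleGraph (Fin n)) : UCGraph := Quotient.mk ucSetoid ⟨n, G⟩

open Classical in
/-- The u-c-graph that consists of the edges of `G` and their endpoints: points without an edge
are dropped, the others keep their cyclic order. -/
noncomputable def trimmed {n : ℕ} (G : SimpleGraph (Fin n)) : UCGraph :=
  unlabel (G.comap (G.support.toFinset.orderEmbOfFin rfl))

/-- A genus one unlabeled circle tree. -/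
def UCGraph.IsGenusOneTree (C : UCGraph) : Prop :=
  ∃ (n : ℕ) (T : SimpleGraph (Fin n)), C = unlabel T ∧ T.IsTree ∧ genus T = 1

/-- An e-reduction of `C` has the pre-reduced form `U` and the reduced form `V`. -/
def UCGraph.EReduction (C U V : UCGraph) : Prop :=
  ∃ (n : ℕ) (T : SimpleGraph (Fin n)) (R : Set (Sym2 (Fin n))), C = unlabel T ∧
    IsSelection T R ∧ U = trimmed (stepTwo T R) ∧ V = trimmed (stepThree T R)

/-- `C` reduces to `V`: the u-c-graph `V` is the reduced form of `C`. -/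
def UCGraph.ReducesTo (C V : UCGraph) : Prop := ∃ U, C.EReduction U V

/-- The set of pre-reduced forms of genus one u-c-trees. -/
def preReducedForms : Set UCGraph := {U | ∃ C : UCGraph, C.IsGenusOneTree ∧ ∃ V, C.EReduction U V}

/-- The set of reduced forms of genus one u-c-trees. -/
def reducedForms : Set UCGraph := {V | ∃ C : UCGraph, C.IsGenusOneTree ∧ C.ReducesTo V}

/-- The set of reduced forms of those genus one u-c-trees whose pre-reduced form is `U`. -/
def reducedFormsOver (U : UCGraph) : Set UCGraph :=
  {V | ∃ C : UCGraph, C.IsGenusOneTree ∧ C.EReduction U V}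

/-! ### The forms

The points of a form, `a, b, c, …` in counterclockwise order, are the numbers `0, 1, 2, …`.
-/

/-- The u-c-graph on `n` points with the given set of edges. -/
def form (n : ℕ) (S : Set (Sym2 (Fin n))) : UCGraph := unlabel (SimpleGraph.fromEdgeSet S)

/-- Edges `ac, bd`. -/
def edges1 : Set (Sym2 (Fin 4)) := {s(0, 2), s(1, 3)}
/-- Edges `ad, bf, ce`. -/
def edges2 : Set (Sym2 (Fin 6)) := {s(0, 3), s(1, 5), s(2, 4)}
/-- Edges `ad, he, bg, cf`. -/
def edges3 : Set (Sym2 (Fin 8)) := {s(0, 3), s(7, 4), s(1, 6), s(2, 5)}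
/-- Edges `ad, be, cf`. -/
def edges4 : Set (Sym2 (Fin 6)) := {s(0, 3), s(1, 4), s(2, 5)}
/-- Edges `ad, he, bf, cg`. -/
def edges5 : Set (Sym2 (Fin 8)) := {s(0, 3), s(7, 4), s(1, 5), s(2, 6)}
/-- Edges `af, bh, cg, dj, ei`. -/
def edges6 : Set (Sym2 (Fin 10)) := {s(0, 5), s(1, 7), s(2, 6), s(3, 9), s(4, 8)}
/-- Edges `af, lg, bi, ch, dk, ej`. -/
def edges7 : Set (Sym2 (Fin 12)) := {s(0, 5), s(11, 6), s(1, 8), s(2, 7), s(3, 10), s(4, 9)}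

/-- The seven candidates for pre-reduced forms: `preForm1`, …, `preForm7`. -/
def preForm1 : UCGraph := form 4 edges1
def preForm2 : UCGraph := form 6 edges2
def preForm3 : UCGraph := form 8 edges3
def preForm4 : UCGraph := form 6 edges4
def preForm5 : UCGraph := form 8 edges5
def preForm6 : UCGraph := form 10 edges6
def preForm7 : UCGraph := form 12 edges7

/-- The reduced form over `preForm1`: add `ab`. -/
def redForm1_1 : UCGraph := form 4 (edges1 ∪ {s(0, 1)})

/-- The reduced forms over `preForm2`: add `fa, de`; `fa, cd`; `ab, de`. -/
def redForm2_1 : UCGraph := form 6 (edges2 ∪ {s(5, 0), s(3, 4)})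
def redForm2_2 : UCGraph := form 6 (edges2 ∪ {s(5, 0), s(2, 3)})
def redForm2_3 : UCGraph := form 6 (edges2 ∪ {s(0, 1), s(3, 4)})

/-- The reduced form over `preForm3`: add `ab, cd, ef`. -/
def redForm3_1 : UCGraph := form 8 (edges3 ∪ {s(0, 1), s(2, 3), s(4, 5)})

/-- The reduced forms over `preForm4`: add `ab, bc`; `ab, cd`. -/
def redForm4_1 : UCGraph := form 6 (edges4 ∪ {s(0, 1), s(1, 2)})
def redForm4_2 : UCGraph := form 6 (edges4 ∪ {s(0, 1), s(2, 3)})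

/-- The reduced forms over `preForm5`: add `ef, ab, fg`; `ef, ab, gh`; `ef, cd, bc`;
`ef, cd, fg`; `ef, cd, gh`; `gh, cd, bc`. -/
def redForm5_1 : UCGraph := form 8 (edges5 ∪ {s(4, 5), s(0, 1), s(5, 6)})
def redForm5_2 : UCGraph := form 8 (edges5 ∪ {s(4, 5), s(0, 1), s(6, 7)})
def redForm5_3 : UCGraph := form 8 (edges5 ∪ {s(4, 5), s(2, 3), s(1, 2)})
def redForm5_4 : UCGraph := form 8 (edges5 ∪ {s(4, 5), s(2, 3), s(5, 6)})
def redForm5_5 : UCGraph := form 8 (edges5 ∪ {s(4, 5), s(2, 3), s(6, 7)})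
def redForm5_6 : UCGraph := form 8 (edges5 ∪ {s(6, 7), s(2, 3), s(1, 2)})

/-- The reduced forms over `preForm6`: add `ab, cd, ef, fg`; `cd, ef, fg, hi`; `ab, cd, ef, ja`;
`ab, cd, fg, hi`; `ab, ef, fg, ja`; `cd, ef, hi, ja`. -/
def redForm6_1 : UCGraph := form 10 (edges6 ∪ {s(0, 1), s(2, 3), s(4, 5), s(5, 6)})
def redForm6_2 : UCGraph := form 10 (edges6 ∪ {s(2, 3), s(4, 5), s(5, 6), s(7, 8)})
def redForm6_3 : UCGraph := form 10 (edges6 ∪ {s(0, 1), s(2, 3), s(4, 5), s(9, 0)})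
def redForm6_4 : UCGraph := form 10 (edges6 ∪ {s(0, 1), s(2, 3), s(5, 6), s(7, 8)})
def redForm6_5 : UCGraph := form 10 (edges6 ∪ {s(0, 1), s(4, 5), s(5, 6), s(9, 0)})
def redForm6_6 : UCGraph := form 10 (edges6 ∪ {s(2, 3), s(4, 5), s(7, 8), s(9, 0)})

/-- The nineteen reduced forms. -/
def nineteenForms : Set UCGraph :=
  {redForm1_1, redForm2_1, redForm2_2, redForm2_3, redForm3_1, redForm4_1, redForm4_2,
    redForm5_1, redForm5_2, redForm5_3, redForm5_4, redForm5_5, redForm5_6,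
    redForm6_1, redForm6_2, redForm6_3, redForm6_4, redForm6_5, redForm6_6}

end CircleTree

/-! Genus. Let A be the matrix over the field with two elements that records which edges cross. A
function on the edge ends that is constant on the cycles of `α⁻¹ σ` is determined up to a constant
by its jumps along the circle. The jumps agree at the two ends of every edge, and the functions on
edges arising in this way form exactly the kernel of A. Hence `α⁻¹ σ` has dim ker A + 1 cycles, and
the genus is half the rank of A (`cycleCount_eq`, `genus_eq`). A symmetric matrix over this field
with zero diagonal has rank two exactly when its entries come from the symplectic form on a plane
with three nonzero vectors. So genus one means that the crossed edges fall into m = 2 or m = 3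
classes and that two of them cross exactly when their classes differ (`genus_eq_one_iff`).

Geometry. After a rotation the endpoints of the classes fill 2m blocks around the circle, and
opposite blocks are joined by nested chords (`exists_frame`). By connectedness, a point of a block
between two chords of its class is joined to one of them by uncrossed edges and edges of the class
(`Frame.reachable_of_between`). Hence a class contains at most two e-graphs, that of its outer and
that of its inner chord; the class is merged if they coincide. Chords act as fences for uncrossed
edges, so a connecting path of step (3) links neighbouring blocks and can be deformed into the gap
between them (`Frame.exists_gap_of_avoidGraph_reachable`). Both forms therefore depend only on the
set μ of merged classes and the set ν of joined gaps (`Frame.trimmed_eq`).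

Combinatorics. Index the e-graphs modulo 2m by the block in which a bounding chord starts. The gap t
then joins the e-graphs t + m and t + 1, and a merged class identifies t with t + m. Since the graph
is a tree, the joined gaps form a spanning tree on the e-graphs: connectedness gives
`Frame.iff_of_connected`, and acyclicity gives `Frame.exists_separation`. For m = 2 the gaps form a
4-cycle. With two, one or no merged classes its spanning trees up to rotation number 1, 3, 1. For m
= 3 the gaps form two triangles, of even and of odd indices, so at least one class must be merged;
this excludes the seventh candidate. With three, two or one merged classes there are 2, 6, 6
spanning trees up to rotation. The total is nineteen. The code obtains this enumeration by
evaluating all pairs μ, ν, and it realizes every form by a model tree whose edges are those of the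
form itself (`eReduction_codeGraph`). -/

namespace CircleTree

open SimpleGraph

/-! ### Crossing chords, rotations of the circle and trimming -/

section Basics

variable {n : ℕ}

theorem cross_mk_iff (a b c d : Fin n) : Cross s(a, b) s(c, d) ↔
    (a < c ∧ c < b ∧ b < d) ∨ (a < d ∧ d < b ∧ b < c) ∨ (b < c ∧ c < a ∧ a < d) ∨
    (b < d ∧ d < a ∧ a < c) ∨ (c < a ∧ a < d ∧ d < b) ∨ (d < a ∧ a < c ∧ c < b) ∨
    (c < b ∧ b < d ∧ d < a) ∨ (d < b ∧ b < c ∧ c < a) := by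
  constructor
  · rintro ⟨p, q, r, t, h1, h2, h3, h⟩
    simp only [Sym2.eq_iff] at h
    rcases h with ⟨⟨rfl, rfl⟩ | ⟨rfl, rfl⟩, ⟨rfl, rfl⟩ | ⟨rfl, rfl⟩⟩ |
      ⟨⟨rfl, rfl⟩ | ⟨rfl, rfl⟩, ⟨rfl, rfl⟩ | ⟨rfl, rfl⟩⟩ <;> simp [h1, h2, h3]
  · rintro (h | h | h | h | h | h | h | h)
    · exact ⟨a, c, b, d, h.1, h.2.1, h.2.2, Or.inl ⟨rfl, rfl⟩⟩
    · exact ⟨a, d, b, c, h.1, h.2.1, h.2.2, Or.inl ⟨rfl, Sym2.eq_swap⟩⟩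
    · exact ⟨b, c, a, d, h.1, h.2.1, h.2.2, Or.inl ⟨Sym2.eq_swap, rfl⟩⟩
    · exact ⟨b, d, a, c, h.1, h.2.1, h.2.2, Or.inl ⟨Sym2.eq_swap, Sym2.eq_swap⟩⟩
    · exact ⟨c, a, d, b, h.1, h.2.1, h.2.2, Or.inr ⟨rfl, rfl⟩⟩
    · exact ⟨d, a, c, b, h.1, h.2.1, h.2.2, Or.inr ⟨rfl, Sym2.eq_swap⟩⟩
    · exact ⟨c, b, d, a, h.1, h.2.1, h.2.2, Or.inr ⟨Sym2.eq_swap, rfl⟩⟩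
    · exact ⟨d, b, c, a, h.1, h.2.1, h.2.2, Or.inr ⟨Sym2.eq_swap, Sym2.eq_swap⟩⟩

theorem cross_comm (e f : Sym2 (Fin n)) : Cross e f ↔ Cross f e := by
  constructor <;> rintro ⟨p, q, r, t, h1, h2, h3, h⟩ <;>
    exact ⟨p, q, r, t, h1, h2, h3, h.symm.imp And.symm And.symm⟩

theorem cross_irrefl (e : Sym2 (Fin n)) : ¬ Cross e e := by
  induction e with
  | _ a b =>
    rw [cross_mk_iff]
    simp only [Fin.lt_def]
    omega

theorem cross_iff_of_lt {a b c d : Fin n} (hab : a < b) : Cross s(a, b) s(c, d) ↔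
    (a < c ∧ c < b ∧ (d < a ∨ b < d)) ∨ (a < d ∧ d < b ∧ (c < a ∨ b < c)) := by
  rw [cross_mk_iff]
  simp only [Fin.lt_def] at *
  omega

theorem cross_iff_of_lt_lt {a b c d : Fin n} (hab : a < b) (hcd : c < d) :
    Cross s(a, b) s(c, d) ↔ (a < c ∧ c < b ∧ b < d) ∨ (c < a ∧ a < d ∧ d < b) := by
  rw [cross_mk_iff]
  simp only [Fin.lt_def] at *
  omega

/-- An edge not crossing a chord has both ends on one side of it. -/
theorem not_cross_iff_of_lt {a b c d : Fin n} (hab : a < b) : ¬ Cross s(a, b) s(c, d) ↔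
    ((c : ℕ) ≤ a ∨ (b : ℕ) ≤ c ∨ ((a : ℕ) ≤ d ∧ (d : ℕ) ≤ b)) ∧
      ((d : ℕ) ≤ a ∨ (b : ℕ) ≤ d ∨ ((a : ℕ) ≤ c ∧ (c : ℕ) ≤ b)) := by
  rw [cross_iff_of_lt hab]
  simp only [Fin.lt_def] at *
  omega

/-- A rotation of the circle by `k` steps. -/
def IsRotation (k : ℕ) (ρ : Fin n ≃ Fin n) : Prop := ∀ x, (ρ x : ℕ) = ((x : ℕ) + k) % n

theorem exists_isRotation (k : ℕ) (hn : 0 < n) : ∃ ρ : Fin n ≃ Fin n, IsRotation k ρ := by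
  refine ⟨Equiv.ofBijective (fun x => ⟨((x : ℕ) + k) % n, Nat.mod_lt _ hn⟩) ?_, fun x => rfl⟩
  rw [← Finite.injective_iff_bijective]
  intro x y h
  simp only [Fin.mk.injEq] at h
  have := Nat.ModEq.add_right_cancel' k h
  exact Fin.ext (by simpa [Nat.ModEq, Nat.mod_eq_of_lt] using this)

theorem IsRotation.mod {k : ℕ} {ρ : Fin n ≃ Fin n} (h : IsRotation k ρ) :
    IsRotation (k % n) ρ := fun x => by rw [h x, Nat.add_mod_mod]

theorem IsRotation.val_eq {k : ℕ} {ρ : Fin n ≃ Fin n} (h : IsRotation k ρ) (hk : k < n)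
    (x : Fin n) : (x : ℕ) + k < n ∧ (ρ x : ℕ) = x + k ∨ n ≤ (x : ℕ) + k ∧ (ρ x : ℕ) + n = x + k := by
  have hx := x.isLt
  rcases lt_or_ge ((x : ℕ) + k) n with h1 | h1
  · exact Or.inl ⟨h1, by rw [h x, Nat.mod_eq_of_lt h1]⟩
  · refine Or.inr ⟨h1, ?_⟩
    have : ((x : ℕ) + k) % n = x + k - n := by
      rw [Nat.mod_eq_sub_mod h1, Nat.mod_eq_of_lt (by omega)]
    rw [h x, this]
    omega

theorem IsRotation.symm {k : ℕ} {ρ : Fin n ≃ Fin n} (h : IsRotation k ρ) :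
    IsRotation (n - k % n) ρ.symm := by
  intro y
  obtain ⟨x, rfl⟩ := ρ.surjective y
  have hx := x.isLt
  have hk : k % n < n := Nat.mod_lt _ (by omega)
  rw [Equiv.symm_apply_apply]
  rcases h.mod.val_eq hk x with h1 | h1
  · rw [h1.2, show (x : ℕ) + k % n + (n - k % n) = x + n by omega, Nat.add_mod_right,
      Nat.mod_eq_of_lt hx]
  · rw [show (ρ x : ℕ) + (n - k % n) = x by omega, Nat.mod_eq_of_lt hx]

theorem IsRotation.cross_map {k : ℕ} {ρ : Fin n ≃ Fin n} (h : IsRotation k ρ)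
    {e f : Sym2 (Fin n)} (hef : Cross e f) : Cross (e.map ρ) (f.map ρ) := by
  obtain ⟨p, q, r, t, h1, h2, h3, hef⟩ := hef
  have key : Cross s(ρ p, ρ r) s(ρ q, ρ t) := by
    have hk : k % n < n := Nat.mod_lt _ (lt_of_le_of_lt (Nat.zero_le _) p.isLt)
    have hp := h.mod.val_eq hk p
    have hq := h.mod.val_eq hk q
    have hr := h.mod.val_eq hk r
    have ht := h.mod.val_eq hk t
    have lp := p.isLt
    have lt := t.isLt
    rw [Fin.lt_def] at h1 h2 h3
    generalize k % n = k' at *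
    have A : ∀ p q r t : Fin n, (p : ℕ) < q → (q : ℕ) < r → (r : ℕ) < t →
        Cross s(p, r) s(q, t) :=
      fun p q r t h1 h2 h3 => ⟨p, q, r, t, h1, h2, h3, Or.inl ⟨rfl, rfl⟩⟩
    -- The points that pass the end of the labelling form a final segment of `p < q < r < t`. Their
    -- number, from none to four, determines the new linear order, and the two pairs alternate in
    -- each case.
    rcases ht with ht | ht
    · exact A _ _ _ _ (by omega) (by omega) (by omega)
    rcases hr with hr | hr
    · rw [Sym2.eq_swap (a := ρ q), cross_comm]
      exact A _ _ _ _ (by omega) (by omega) (by omega)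
    rcases hq with hq | hq
    · rw [Sym2.eq_swap (a := ρ q), Sym2.eq_swap (a := ρ p)]
      exact A _ _ _ _ (by omega) (by omega) (by omega)
    rcases hp with hp | hp
    · rw [Sym2.eq_swap (a := ρ p), cross_comm]
      exact A _ _ _ _ (by omega) (by omega) (by omega)
    · exact A _ _ _ _ (by omega) (by omega) (by omega)
  rcases hef with ⟨rfl, rfl⟩ | ⟨rfl, rfl⟩
  · exact key
  · exact (cross_comm _ _).1 key

theorem IsRotation.cross_map_iff {k : ℕ} {ρ : Fin n ≃ Fin n} (h : IsRotation k ρ)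
    (e f : Sym2 (Fin n)) : Cross (e.map ρ) (f.map ρ) ↔ Cross e f := by
  refine ⟨fun hef => ?_, h.cross_map⟩
  have := h.symm.cross_map hef
  simpa [Sym2.map_map] using this

theorem IsRotation.sub {k : ℕ} {ρ : Fin n ≃ Fin n} (h : IsRotation k ρ) (a b : Fin n) :
    ρ a - ρ b = a - b := by
  have hn : NeZero n := ⟨(lt_of_le_of_lt (Nat.zero_le _) a.isLt).ne'⟩
  have key : ∀ x, ρ x = x + Fin.ofNat n k := fun x => by
    apply Fin.ext
    rw [h x, Fin.val_add]
    simp [Fin.ofNat]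
  rw [key, key, add_sub_add_right_eq_sub]

/-- The points of `G` with an edge, in increasing order, determine the trimmed graph. -/
theorem trimmed_eq_unlabel {j : ℕ} (G : SimpleGraph (Fin n)) (H : SimpleGraph (Fin j))
    (f : Fin j → Fin n) (hf : StrictMono f) (hr : Set.range f = G.support)
    (ha : ∀ x y, H.Adj x y ↔ G.Adj (f x) (f y)) : trimmed G = unlabel H := by
  classical
  have hc : G.support.toFinset.card = j := by
    have : G.support.toFinset = Finset.univ.map ⟨f, hf.injective⟩ := by
      ext x
      simp [← hr]
    rw [this, Finset.card_map, Finset.card_univ, Fintype.card_fin]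
  subst hc
  have := Finset.orderEmbOfFin_unique (s := G.support.toFinset) rfl (f := f)
    (fun x => by simp [← hr]) hf
  unfold trimmed
  congr 1
  ext x y
  rw [ha, this, comap_adj]

theorem exists_strictMono_support (G : SimpleGraph (Fin n)) :
    ∃ (j : ℕ) (f : Fin j → Fin n), StrictMono f ∧ Set.range f = G.support := by
  classical
  exact ⟨_, G.support.toFinset.orderEmbOfFin rfl, OrderEmbedding.strictMono _, by simp⟩

theorem unlabel_eq_iff {m : ℕ} {G : SimpleGraph (Fin n)} {H : SimpleGraph (Fin m)} :
    unlabel G = unlabel H ↔ SameUnlabeled ⟨n, G⟩ ⟨m, H⟩ :=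
  ⟨fun h => Quotient.exact h, fun h => Quotient.sound h⟩

theorem unlabel_eq_iff_exists_isRotation {G H : SimpleGraph (Fin n)} :
    unlabel G = unlabel H ↔
      ∃ (k : ℕ) (ρ : Fin n ≃ Fin n), IsRotation k ρ ∧ ∀ x y, H.Adj (ρ x) (ρ y) ↔ G.Adj x y := by
  rw [unlabel_eq_iff]
  constructor
  · rintro ⟨φ, k, h⟩
    exact ⟨k, φ.toEquiv, h, fun x y => φ.map_rel_iff⟩
  · rintro ⟨k, ρ, h, ha⟩
    exact ⟨⟨ρ, fun {x y} => ha x y⟩, k, h⟩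

/-- Trimming is compatible with rotations. -/
theorem trimmed_eq_of_isRotation {k : ℕ} {ρ : Fin n ≃ Fin n} (h : IsRotation k ρ)
    (G G' : SimpleGraph (Fin n)) (ha : ∀ x y, G'.Adj (ρ x) (ρ y) ↔ G.Adj x y) :
    trimmed G' = trimmed G := by
  classical
  obtain ⟨j, f, hf, hr⟩ := exists_strictMono_support G
  have hT := trimmed_eq_unlabel G (G.comap f) f hf hr (fun _ _ => Iff.rfl)
  rcases Nat.eq_zero_or_pos j with rfl | hj
  · have hG : G = ⊥ := by
      ext x y
      simp only [bot_adj, iff_false]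
      intro hxy
      have : x ∈ G.support := ⟨y, hxy⟩
      rw [← hr] at this
      obtain ⟨i, -⟩ := this
      exact i.elim0
    have hG' : G' = ⊥ := by
      ext x y
      have := ha (ρ.symm x) (ρ.symm y)
      simpa [hG] using this
    rw [hG, hG']
  have hn : 0 < n := lt_of_le_of_lt (Nat.zero_le _) (f ⟨0, hj⟩).isLt
  have hk : k % n < n := Nat.mod_lt _ hn
  have hv := h.mod.val_eq hk
  generalize k % n = k' at *
  -- the number of points that do not pass the end of the labelling
  obtain ⟨c, hc, hc1⟩ : ∃ c ≤ j, ∀ i : Fin j, (i : ℕ) < c ↔ (f i : ℕ) + k' < n := by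
    by_cases hex : ∃ i : Fin j, n ≤ (f i : ℕ) + k'
    · obtain ⟨i, hi, hmin⟩ := wellFounded_lt.has_min {i : Fin j | n ≤ (f i : ℕ) + k'} hex
      replace hi : n ≤ (f i : ℕ) + k' := hi
      refine ⟨i, i.isLt.le, fun i' => ⟨fun h1 => ?_, fun h1 => ?_⟩⟩
      · by_contra h2
        exact hmin i' (show n ≤ (f i' : ℕ) + k' by omega) h1
      · by_contra h2
        have h3 : f i ≤ f i' := hf.monotone (Fin.le_def.2 (not_lt.1 h2))
        rw [Fin.le_def] at h3
        omega
    · push Not at hex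
      exact ⟨j, le_rfl, fun i => ⟨fun _ => hex i, fun _ => i.isLt⟩⟩
  -- After the rotation the points with index at least `c` come first. The increasing enumeration of
  -- the new support therefore starts with the point of index `c`, so it differs from the old one by
  -- a rotation by `c`. The case `c = j`, where no point passes the end, is the identity.
  obtain ⟨τ, hτ⟩ := exists_isRotation (n := j) c hj
  have hval : ∀ i : Fin j, (i : ℕ) + c < j ∧ (τ i : ℕ) = i + c ∨
      j ≤ (i : ℕ) + c ∧ (τ i : ℕ) + j = i + c := by
    intro i
    rcases lt_or_eq_of_le hc with h1 | h1
    · exact hτ.val_eq h1 i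
    · right
      refine ⟨by omega, ?_⟩
      rw [hτ i, h1, Nat.add_mod_right, Nat.mod_eq_of_lt i.isLt]
  rw [hT, trimmed_eq_unlabel G' ((G.comap f).comap τ) (fun i => ρ (f (τ i)))]
  · rw [unlabel_eq_iff_exists_isRotation]
    exact ⟨c, τ, hτ, fun x y => Iff.rfl⟩
  · intro x y hxy
    have hx := hval x
    have hy := hval y
    have h1 := hv (f (τ x))
    have h2 := hv (f (τ y))
    have h3 := hc1 (τ x)
    have h4 := hc1 (τ y)
    have h5 : (τ x : ℕ) < τ y → (f (τ x) : ℕ) < f (τ y) := fun h => hf h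
    have h6 := (f (τ x)).isLt
    have h7 := (f (τ y)).isLt
    have h8 := x.isLt
    have h9 := y.isLt
    rw [Fin.lt_def] at hxy ⊢
    dsimp only
    omega
  · ext y
    obtain ⟨x, rfl⟩ := ρ.surjective y
    have : ρ x ∈ G'.support ↔ x ∈ G.support := by
      simp only [mem_support]
      constructor
      · rintro ⟨w, hw⟩
        obtain ⟨w, rfl⟩ := ρ.surjective w
        exact ⟨w, (ha _ _).1 hw⟩
      · rintro ⟨w, hw⟩
        exact ⟨ρ w, (ha _ _).2 hw⟩
    rw [this, ← hr]
    simp only [Set.mem_range, EmbeddingLike.apply_eq_iff_eq]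
    constructor
    · rintro ⟨i, rfl⟩
      exact ⟨_, rfl⟩
    · rintro ⟨i, rfl⟩
      exact ⟨τ.symm i, by simp⟩
  · intro x y
    simp [ha]

end Basics

end CircleTree

namespace CircleTree

open SimpleGraph

/-! ### The genus as half the rank of the crossing matrix -/

section Genus

variable {n : ℕ} {G : SimpleGraph (Fin n)}

theorem fin_val_sub_of_le {a b : Fin n} (h : b ≤ a) : ((a - b : Fin n) : ℕ) = a - b :=
  Fin.sub_val_of_le h

theorem fin_val_sub_of_lt {a b : Fin n} (h : a < b) : ((a - b : Fin n) : ℕ) + b = n + a := by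
  have h1 := a.isLt
  have h2 := b.isLt
  rw [Fin.lt_def] at h
  rw [Fin.val_sub, Nat.mod_eq_of_lt (by omega)]
  omega

theorem fin_val_sub_cases (a b : Fin n) :
    (b : ℕ) ≤ a ∧ ((a - b : Fin n) : ℕ) + b = a ∨
      (a : ℕ) < b ∧ ((a - b : Fin n) : ℕ) + b = n + a := by
  rcases le_or_gt b a with h | h
  · have := fin_val_sub_of_le h
    rw [Fin.le_def] at h
    omega
  · exact Or.inr ⟨h, fin_val_sub_of_lt h⟩

/-- The position has two digits in base `n`, so the order is lexicographic: by vertex, then by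
decreasing counterclockwise distance of the other endpoint. -/
theorem dartPos_lt_iff (d x : G.Dart) : dartPos G d < dartPos G x ↔
    (d.fst : ℕ) < x.fst ∨ ((d.fst : ℕ) = x.fst ∧
      ((x.snd - x.fst : Fin n) : ℕ) < ((d.snd - d.fst : Fin n) : ℕ)) := by
  have h1 := (d.snd - d.fst).isLt
  have h2 := (x.snd - x.fst).isLt
  unfold dartPos
  generalize ((d.snd - d.fst : Fin n) : ℕ) = p at *
  generalize ((x.snd - x.fst : Fin n) : ℕ) = q at *
  generalize (d.fst : ℕ) = a at *
  generalize (x.fst : ℕ) = b at *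
  rcases lt_trichotomy a b with h | h | h
  · have : (a + 1) * n ≤ b * n := Nat.mul_le_mul_right n h
    rw [Nat.add_mul] at this
    constructor <;> intro <;> omega
  · subst h
    constructor <;> intro <;> omega
  · have : (b + 1) * n ≤ a * n := Nat.mul_le_mul_right n h
    rw [Nat.add_mul] at this
    constructor <;> intro <;> omega

theorem dartPos_lt_symm_iff (d : G.Dart) : dartPos G d < dartPos G d.symm ↔ d.fst < d.snd := by
  have h : d.fst ≠ d.snd := d.adj.ne
  rw [dartPos_lt_iff, Fin.lt_def]
  have h' : (d.fst : ℕ) ≠ d.snd := fun h1 => h (Fin.ext h1)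
  simp only [Dart.symm_toProd, Prod.fst_swap, Prod.snd_swap]
  omega

/-- The end `x` lies strictly between the end `d` and the other end of the same edge. -/
def Between (d x : G.Dart) : Prop := dartPos G d < dartPos G x ∧ dartPos G x < dartPos G d.symm

theorem not_between_self (d : G.Dart) : ¬ Between d d := fun h => lt_irrefl _ h.1

theorem not_between_symm (d : G.Dart) : ¬ Between d d.symm := fun h => lt_irrefl _ h.2

/-- Two edges cross exactly when the ends of one separate the ends of the other. -/
theorem cross_edge_iff {d x : G.Dart} (hd : d.fst < d.snd) (hne : d.edge ≠ x.edge) :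
    Cross d.edge x.edge ↔ ¬ (Between d x ↔ Between d x.symm) := by
  unfold Between
  simp only [dartPos_lt_iff, Dart.symm_toProd, Prod.fst_swap, Prod.snd_swap]
  have hx : x.fst ≠ x.snd := x.adj.ne
  obtain ⟨⟨a, b⟩, hab⟩ := d
  obtain ⟨⟨c, e⟩, hce⟩ := x
  simp only [Dart.edge_mk] at *
  change Cross s(a, b) s(c, e) ↔ _
  replace hne : ¬ (a = c ∧ b = e ∨ a = e ∧ b = c) := by
    simpa [Dart.edge] using hne
  rw [cross_iff_of_lt hd]
  simp only [Fin.ext_iff, Fin.lt_def] at *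
  have h1 := fin_val_sub_cases b a
  have h2 := fin_val_sub_cases a b
  have h3 := fin_val_sub_cases c e
  have h4 := fin_val_sub_cases e c
  have la := a.isLt
  have lb := b.isLt
  have lc := c.isLt
  have le := e.isLt
  generalize ((b - a : Fin n) : ℕ) = p at *
  generalize ((a - b : Fin n) : ℕ) = q at *
  generalize ((c - e : Fin n) : ℕ) = r at *
  generalize ((e - c : Fin n) : ℕ) = t at *
  -- Coinciding endpoints matter here: for edges with a common vertex, the order of the ends at that
  -- vertex ensures that the ends do not alternate.
  rcases lt_trichotomy (a : ℕ) c with g1 | g1 | g1 <;>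
  rcases lt_trichotomy (c : ℕ) b with g2 | g2 | g2 <;>
  rcases lt_trichotomy (a : ℕ) e with g3 | g3 | g3 <;>
  rcases lt_trichotomy (e : ℕ) b with g4 | g4 | g4 <;> omega

open Classical in
theorem exists_enumeration (G : SimpleGraph (Fin n)) :
    ∃ (k : ℕ) (o : Fin k ≃ G.Dart), (∀ i j, dartPos G (o i) ≤ dartPos G (o j) ↔ i ≤ j) ∧
      ∀ i, sigma G (o i) = o (finRotate k i) := by
  let _ := dartOrder G
  refine ⟨_, (Fintype.orderIsoFinOfCardEq G.Dart rfl).toEquiv, fun i j => ?_, fun i => ?_⟩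
  · exact (Fintype.orderIsoFinOfCardEq G.Dart rfl).map_rel_iff
  · unfold sigma
    rw [Equiv.permCongr_apply, Equiv.symm_apply_apply]

/-- `σ⁻¹ d` is the predecessor of the end `d` in the cyclic order. -/
theorem sigma_inv_spec (d : G.Dart) :
    (∀ x, dartPos G d ≤ dartPos G x ∧ dartPos G x ≤ dartPos G ((sigma G)⁻¹ d)) ∨
      ∀ x, dartPos G x < dartPos G d ↔ dartPos G x ≤ dartPos G ((sigma G)⁻¹ d) := by
  obtain ⟨k, o, ho, hs⟩ := exists_enumeration G
  have ho' : ∀ i j, dartPos G (o i) < dartPos G (o j) ↔ i < j := fun i j => by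
    rw [← not_le, ho, not_le]
  obtain ⟨j, rfl⟩ := o.surjective d
  obtain ⟨i, rfl⟩ := (finRotate k).surjective j
  have hi : (sigma G)⁻¹ (o (finRotate k i)) = o i := by
    rw [Equiv.Perm.inv_eq_iff_eq, hs]
  rw [hi]
  cases k with
  | zero => exact i.elim0
  | succ k =>
    -- Only the step from the last end to the first one wraps around the circle.
    rcases eq_or_ne i (Fin.last k) with h | h
    · left
      intro x
      obtain ⟨l, rfl⟩ := o.surjective x
      rw [ho, ho, h, finRotate_last]
      exact ⟨Fin.zero_le _, Fin.le_last _⟩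
    · right
      intro x
      obtain ⟨l, rfl⟩ := o.surjective x
      rw [ho, ho', Fin.lt_def, Fin.le_def, coe_finRotate_of_ne_last h]
      omega

/-- As `σ` is a single cycle, an invariant function is constant; going back with `σ⁻¹` decreases the
position until the other end is reached. -/
theorem eq_of_forall_sigma_inv {β : Type*} {ψ : G.Dart → β}
    (h : ∀ d, ψ ((sigma G)⁻¹ d) = ψ d) (d x : G.Dart) : ψ d = ψ x := by
  have key : ∀ k : ℕ, ∀ d x : G.Dart, dartPos G d = k → dartPos G x ≤ dartPos G d →
      ψ d = ψ x := by
    intro k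
    induction k using Nat.strong_induction_on with
    | _ k ih =>
      intro d x hd hx
      rcases eq_or_lt_of_le hx with h1 | h1
      · rw [dartPos_injective G h1]
      · rcases sigma_inv_spec d with h2 | h2
        · exact absurd (h2 x).1 (not_le.2 h1)
        · rw [← h d]
          have h3 := (h2 ((sigma G)⁻¹ d)).2 le_rfl
          exact ih _ (hd ▸ h3) _ x rfl ((h2 x).1 h1)
  rcases le_total (dartPos G x) (dartPos G d) with h1 | h1
  · exact key _ d x rfl h1
  · exact (key _ x d rfl h1).symm

open Classical in
/-- The sum of `g` over all ends up to `d`. -/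
noncomputable def partialSum (g : G.Dart → ZMod 2) (d : G.Dart) : ZMod 2 :=
  ∑ x, if dartPos G x ≤ dartPos G d then g x else 0

open Classical in
-- Modulo two, the sums at an end and at its predecessor differ by one term. At the first end the
-- predecessor carries the full sum, which is why that sum must vanish.
theorem partialSum_add_sigma_inv {g : G.Dart → ZMod 2} (hg : ∑ x, g x = 0) (d : G.Dart) :
    partialSum g d + partialSum g ((sigma G)⁻¹ d) = g d := by
  unfold partialSum
  rw [← Finset.sum_add_distrib]
  rcases sigma_inv_spec d with h | h
  · have h1 : ∀ x, (if dartPos G x ≤ dartPos G d then g x else 0) +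
        (if dartPos G x ≤ dartPos G ((sigma G)⁻¹ d) then g x else 0) =
        (if x = d then g x else 0) + g x := by
      intro x
      rw [if_pos (h x).2]
      congr 1
      refine if_congr ⟨fun h1 => ?_, fun h1 => h1 ▸ le_rfl⟩ rfl rfl
      exact dartPos_injective G (le_antisymm h1 (h x).1)
    rw [Finset.sum_congr rfl fun x _ => h1 x, Finset.sum_add_distrib, hg]
    simp
  · have h1 : ∀ x, (if dartPos G x ≤ dartPos G d then g x else 0) +
        (if dartPos G x ≤ dartPos G ((sigma G)⁻¹ d) then g x else 0) =
        (if x = d then g x else 0) := by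
      intro x
      rcases lt_trichotomy (dartPos G x) (dartPos G d) with h2 | h2 | h2
      · rw [if_pos h2.le, if_pos ((h x).1 h2), if_neg, CharTwo.add_self_eq_zero]
        rintro rfl
        exact lt_irrefl _ h2
      · rw [if_pos h2.le, if_neg, if_pos (dartPos_injective G h2), add_zero]
        rw [← h x]
        exact h2.not_lt
      · rw [if_neg (not_le.2 h2), if_neg, if_neg, add_zero]
        · rintro rfl
          exact lt_irrefl _ h2
        · rw [← h x]
          exact h2.not_gt
    rw [Finset.sum_congr rfl fun x _ => h1 x]
    simp

open Classical in
/-- A function on the ends is a sum over pairs of ends. -/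
theorem sum_dart_eq (F : G.Dart → ZMod 2) (out : G.edgeSet → G.Dart)
    (hout : ∀ e, (out e).edge = e) : ∑ d, F d = ∑ e, (F (out e) + F (out e).symm) := by
  rw [← Finset.sum_fiberwise (g := fun d : G.Dart => (⟨d.edge, d.edge_mem⟩ : G.edgeSet))]
  refine Finset.sum_congr rfl fun e _ => ?_
  have : (Finset.univ.filter fun d : G.Dart => (⟨d.edge, d.edge_mem⟩ : G.edgeSet) = e) =
      {out e, (out e).symm} := by
    rw [← Dart.edge_fiber]
    ext d
    simp [hout, Subtype.ext_iff]
  rw [this, Finset.sum_pair (Dart.symm_ne _).symm]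

theorem exists_out (G : SimpleGraph (Fin n)) :
    ∃ out : G.edgeSet → G.Dart, (∀ e, (out e).edge = e) ∧ ∀ e, (out e).fst < (out e).snd := by
  have : ∀ e : G.edgeSet, ∃ d : G.Dart, d.edge = e ∧ d.fst < d.snd := by
    rintro ⟨e, he⟩
    induction e with
    | _ a b =>
      have hab : G.Adj a b := he
      rcases lt_or_gt_of_ne hab.ne with h | h
      · exact ⟨⟨(a, b), hab⟩, rfl, h⟩
      · exact ⟨⟨(b, a), hab.symm⟩, Sym2.eq_swap, h⟩
  choose out h using this
  exact ⟨out, fun e => (h e).1, fun e => (h e).2⟩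

open Classical in
/-- The crossing matrix of the edges over the field with two elements. -/
noncomputable def crossMatrix (G : SimpleGraph (Fin n)) : Matrix G.edgeSet G.edgeSet (ZMod 2) :=
  Matrix.of fun e f => if Cross (e : Sym2 (Fin n)) f then 1 else 0

open Classical in
theorem crossMatrix_comm (e f : G.edgeSet) : crossMatrix G e f = crossMatrix G f e := by
  unfold crossMatrix
  simp only [Matrix.of_apply]
  exact if_congr (cross_comm _ _) rfl rfl

theorem crossMatrix_eq_one_iff (e f : G.edgeSet) :
    crossMatrix G e f = 1 ↔ Cross (e : Sym2 (Fin n)) f := by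
  unfold crossMatrix
  simp only [Matrix.of_apply]
  split_ifs with h <;> simp [h]

open Classical in
/-- The linear map of the crossing matrix. -/
noncomputable def crossMap (G : SimpleGraph (Fin n)) :
    (G.edgeSet → ZMod 2) →ₗ[ZMod 2] (G.edgeSet → ZMod 2) := (crossMatrix G).mulVecLin

open Classical in
theorem crossMap_apply (c : G.edgeSet → ZMod 2) (e : G.edgeSet) :
    crossMap G c e = ∑ f, crossMatrix G e f * c f := rfl

open Classical in
/-- The sum over the ends strictly between the ends of `e` counts the edges that cross `e`. -/
theorem sum_between (c : G.edgeSet → ZMod 2) (d : G.Dart) (hd : d.fst < d.snd) :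
    (∑ x : G.Dart, if Between d x then c ⟨x.edge, x.edge_mem⟩ else 0) =
      crossMap G c ⟨d.edge, d.edge_mem⟩ := by
  obtain ⟨out, hout, -⟩ := exists_out G
  -- Grouped by edges, an edge counts once if exactly one of its ends lies in between, that is, if
  -- it crosses; otherwise it counts zero times or twice and disappears modulo two.
  rw [sum_dart_eq _ out hout, crossMap_apply]
  refine Finset.sum_congr rfl fun e _ => ?_
  have h1 : (⟨(out e).edge, (out e).edge_mem⟩ : G.edgeSet) = e := Subtype.ext (hout e)
  have h2 : (⟨(out e).symm.edge, (out e).symm.edge_mem⟩ : G.edgeSet) = e :=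
    Subtype.ext ((Dart.edge_symm _).trans (hout e))
  rw [h1, h2]
  have hc : crossMatrix G ⟨d.edge, d.edge_mem⟩ e = if Cross d.edge (out e).edge then 1 else 0 := by
    rw [hout]
    rfl
  rw [hc]
  by_cases h : d.edge = (out e).edge
  · rw [h, if_neg (cross_irrefl _), zero_mul]
    rcases (dart_edge_eq_iff d (out e)).1 h with h3 | h3
    · rw [← h3, if_neg (not_between_self d), if_neg (not_between_symm d), add_zero]
    · have h4 : (out e).symm = d := h3.symm
      have h5 : out e = d.symm := by rw [h3, Dart.symm_symm]
      rw [h4, h5, if_neg (not_between_self d), if_neg (not_between_symm d), add_zero]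
  · have := cross_edge_iff hd h
    by_cases h3 : Between d (out e) <;> by_cases h4 : Between d (out e).symm <;>
      simp [this, h3, h4, CharTwo.add_self_eq_zero]

/-- The functions on the ends that are constant on the cycles of `α⁻¹ σ`. -/
def invariants (G : SimpleGraph (Fin n)) : Submodule (ZMod 2) (G.Dart → ZMod 2) where
  carrier := {φ | ∀ d, φ (d.symm) = φ ((sigma G)⁻¹ d)}
  add_mem' ha hb d := by rw [Pi.add_apply, Pi.add_apply, ha d, hb d]
  zero_mem' _ := rfl
  smul_mem' r _ ha d := by rw [Pi.smul_apply, Pi.smul_apply, ha d]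

theorem mem_invariants_iff {φ : G.Dart → ZMod 2} :
    φ ∈ invariants G ↔ ∀ d, φ (((alpha G)⁻¹ * sigma G) d) = φ d := by
  have h : ∀ d : G.Dart, (alpha G)⁻¹ d = d.symm := fun d => rfl
  constructor
  · intro hφ d
    rw [Equiv.Perm.mul_apply, h, hφ]
    congr 1
    rw [Equiv.Perm.inv_eq_iff_eq]
  · intro hφ d
    rw [← hφ ((sigma G)⁻¹ d), Equiv.Perm.mul_apply, h]
    congr 2
    exact ((Equiv.Perm.inv_eq_iff_eq).1 rfl)

/-- The invariant functions are the functions on the set of cycles. -/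
theorem finrank_invariants (G : SimpleGraph (Fin n)) :
    Module.finrank (ZMod 2) (invariants G) = cycleCount ((alpha G)⁻¹ * sigma G) := by
  classical
  let f := (alpha G)⁻¹ * sigma G
  let Q := Quotient (Equiv.Perm.SameCycle.setoid f)
  have : Finite Q := Quotient.finite _
  have : Fintype Q := Fintype.ofFinite Q
  have hinv : ∀ φ ∈ invariants G, ∀ x y, Equiv.Perm.SameCycle f x y → φ x = φ y := by
    intro φ hφ x y hxy
    rw [mem_invariants_iff] at hφ
    have h1 : ∀ (k : ℕ) x, φ ((f ^ k) x) = φ x := by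
      intro k
      induction k with
      | zero => exact fun x => rfl
      | succ k ih =>
        intro x
        rw [pow_succ, Equiv.Perm.mul_apply, ih, hφ]
    obtain ⟨k, hk⟩ := hxy.exists_nat_pow_eq
    rw [← hk, h1]
  let L : (Q → ZMod 2) →ₗ[ZMod 2] invariants G :=
    { toFun := fun ψ => ⟨fun d => ψ (Quotient.mk _ d), by
        rw [mem_invariants_iff]
        intro d
        congr 1
        exact Quotient.sound ((Equiv.Perm.sameCycle_apply_left (f := f)).2 (Equiv.Perm.SameCycle.refl f d))⟩
      map_add' := fun _ _ => rfl
      map_smul' := fun _ _ => rfl }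
  have hL : Function.Bijective L := by
    constructor
    · intro ψ ψ' h
      ext q
      induction q using Quotient.inductionOn with
      | _ d => exact congrFun (congrArg Subtype.val h) d
    · rintro ⟨φ, hφ⟩
      exact ⟨Quotient.lift φ (hinv φ hφ), rfl⟩
  rw [← (LinearEquiv.ofBijective L hL).finrank_eq, Module.finrank_fintype_fun_eq_card,
    ← Nat.card_eq_fintype_card]
  rfl

open Classical in
theorem partialSum_add_of_le {g : G.Dart → ZMod 2} {d x : G.Dart} (h : dartPos G d ≤ dartPos G x) :
    partialSum g x + partialSum g d =
      ∑ y, if dartPos G d < dartPos G y ∧ dartPos G y ≤ dartPos G x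
        then g y else 0 := by
  unfold partialSum
  rw [← Finset.sum_add_distrib]
  refine Finset.sum_congr rfl fun y _ => ?_
  by_cases h1 : dartPos G y ≤ dartPos G d
  · rw [if_pos (h1.trans h), if_pos h1, if_neg (by omega), CharTwo.add_self_eq_zero]
  · by_cases h2 : dartPos G y ≤ dartPos G x
    · rw [if_pos h2, if_neg h1, if_pos (by omega), add_zero]
    · rw [if_neg h2, if_neg h1, if_neg (by omega), add_zero]

open Classical in
-- Between the two sums lie the ends strictly inside the edge, which contribute the crossing map,
-- and the second end of the edge itself, which contributes the remaining term.
theorem partialSum_add_symm (c : G.edgeSet → ZMod 2) (d : G.Dart) (hd : d.fst < d.snd) :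
    partialSum (fun y => c ⟨y.edge, y.edge_mem⟩) d.symm +
      partialSum (fun y => c ⟨y.edge, y.edge_mem⟩) d =
      crossMap G c ⟨d.edge, d.edge_mem⟩ + c ⟨d.edge, d.edge_mem⟩ := by
  have h0 := (dartPos_lt_symm_iff d).2 hd
  rw [partialSum_add_of_le h0.le, ← sum_between c d hd]
  have h1 : c ⟨d.edge, d.edge_mem⟩ =
      ∑ y : G.Dart, if y = d.symm then c ⟨y.edge, y.edge_mem⟩ else 0 := by
    rw [Finset.sum_ite_eq' Finset.univ d.symm, if_pos (Finset.mem_univ _)]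
    congr 1
    exact Subtype.ext (Dart.edge_symm _).symm
  rw [h1, ← Finset.sum_add_distrib]
  refine Finset.sum_congr rfl fun y _ => ?_
  by_cases h2 : y = d.symm
  · subst h2
    rw [if_pos ⟨h0, le_rfl⟩, if_neg (not_between_symm d), if_pos rfl, zero_add]
  · rw [if_neg h2, add_zero]
    refine if_congr ⟨fun h => ⟨h.1, lt_of_le_of_ne h.2 fun h3 => h2 (dartPos_injective G h3)⟩,
      fun h => ⟨h.1, h.2.le⟩⟩ rfl rfl

/-- The jumps of a function on the ends. -/
noncomputable def jump (φ : G.Dart → ZMod 2) (d : G.Dart) : ZMod 2 := φ d + φ ((sigma G)⁻¹ d)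

open Classical in
theorem sum_jump (φ : G.Dart → ZMod 2) : ∑ d, jump φ d = 0 := by
  unfold jump
  rw [Finset.sum_add_distrib, Equiv.sum_comp ((sigma G)⁻¹) φ, CharTwo.add_self_eq_zero]

/-- Invariance at `d` and at `d.symm` exchanges the two summands of the jump. Jumps of invariant
functions are thus functions on edges. -/
theorem jump_symm {φ : G.Dart → ZMod 2} (hφ : φ ∈ invariants G) (d : G.Dart) :
    jump φ d.symm = jump φ d := by
  have h1 := hφ d
  have h2 := hφ d.symm
  rw [Dart.symm_symm] at h2
  unfold jump
  rw [h1, ← h2, add_comm]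

/-- A function is recovered from its jumps up to a constant: adding the partial sums of the jumps
makes it invariant under `σ`. -/
theorem add_eq_partialSum_add (φ : G.Dart → ZMod 2) (d x : G.Dart) :
    φ d + φ x = partialSum (jump φ) d + partialSum (jump φ) x := by
  have h1 : ∀ d, φ ((sigma G)⁻¹ d) + partialSum (jump φ) ((sigma G)⁻¹ d) =
      φ d + partialSum (jump φ) d := by
    intro d
    have h2 := partialSum_add_sigma_inv (sum_jump φ) d
    rw [jump] at h2
    linear_combination h2 + φ ((sigma G)⁻¹ d) * (CharTwo.two_eq_zero (R := ZMod 2)) -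
      partialSum (jump φ) d * (CharTwo.two_eq_zero (R := ZMod 2))
  have h3 := eq_of_forall_sigma_inv (ψ := fun d => φ d + partialSum (jump φ) d) h1 d x
  linear_combination h3 - partialSum (jump φ) d * (CharTwo.two_eq_zero (R := ZMod 2)) +
      φ x * (CharTwo.two_eq_zero (R := ZMod 2))

/-- The count is the dimension of the space of invariant functions. Taking jumps maps this space to
the functions on edges. The kernel consists of the constants, since `σ` is one cycle, and has
dimension one because there are ends at all; the image is the kernel of the crossing map. -/
theorem cycleCount_eq (G : SimpleGraph (Fin n)) [Nonempty G.Dart] :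
    cycleCount ((alpha G)⁻¹ * sigma G) =
      Module.finrank (ZMod 2) (LinearMap.ker (crossMap G)) + 1 := by
  classical
  obtain ⟨out, hout, hlt⟩ := exists_out G
  have houte : ∀ e : G.edgeSet, (⟨(out e).edge, (out e).edge_mem⟩ : G.edgeSet) = e :=
    fun e => Subtype.ext (hout e)
  let D : invariants G →ₗ[ZMod 2] (G.edgeSet → ZMod 2) :=
    { toFun := fun φ e => jump φ.1 (out e)
      map_add' := fun φ ψ => by
        ext e
        simp only [jump, Submodule.coe_add, Pi.add_apply]
        ring
      map_smul' := fun r φ => by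
        ext e
        simp only [jump, Submodule.coe_smul, Pi.smul_apply, smul_eq_mul, RingHom.id_apply]
        ring }
  have hjump : ∀ φ : invariants G, jump φ.1 = fun y => D φ ⟨y.edge, y.edge_mem⟩ := by
    intro φ
    ext y
    change _ = jump φ.1 (out ⟨y.edge, y.edge_mem⟩)
    rcases (dart_edge_eq_iff _ _).1 (hout ⟨y.edge, y.edge_mem⟩) with h | h
    · rw [h]
    · rw [h, jump_symm φ.2]
  have hker : Module.finrank (ZMod 2) (LinearMap.ker D) = 1 := by
    rw [finrank_eq_one_iff']
    have h1 : (fun _ => 1 : G.Dart → ZMod 2) ∈ invariants G := fun d => rfl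
    refine ⟨⟨⟨fun _ => 1, h1⟩, ?_⟩, ?_, ?_⟩
    · rw [LinearMap.mem_ker]
      ext e
      exact CharTwo.add_self_eq_zero _
    · intro h
      have := congrFun (congrArg (fun x => x.1.1) h) (Classical.arbitrary G.Dart)
      exact one_ne_zero this
    · rintro ⟨φ, hφ⟩
      have h2 : ∀ d, φ.1 ((sigma G)⁻¹ d) = φ.1 d := by
        intro d
        have h3 : jump φ.1 d = 0 := by
          rw [hjump, LinearMap.mem_ker.1 hφ]
          rfl
        exact (CharTwo.add_eq_zero.1 h3).symm
      refine ⟨φ.1 (Classical.arbitrary G.Dart), ?_⟩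
      refine Subtype.ext (Subtype.ext (funext fun d => ?_))
      change φ.1 _ * 1 = φ.1 d
      rw [mul_one]
      exact eq_of_forall_sigma_inv h2 _ _
  have hrange : LinearMap.range D = LinearMap.ker (crossMap G) := by
    ext c
    rw [LinearMap.mem_range, LinearMap.mem_ker]
    constructor
    · rintro ⟨φ, rfl⟩
      ext e
      have h1 := partialSum_add_symm (D φ) (out e) (hlt e)
      rw [← hjump, ← add_eq_partialSum_add, houte, φ.2 (out e)] at h1
      have h2 : D φ e = φ.1 (out e) + φ.1 ((sigma G)⁻¹ (out e)) := rfl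
      rw [h2] at h1
      rw [Pi.zero_apply]
      linear_combination -h1
    · intro hc
      -- The two ends of an edge carry the same value, so the total vanishes and the partial sums
      -- close up around the circle.
      have hsum : (∑ y : G.Dart, c ⟨y.edge, y.edge_mem⟩) = 0 := by
        rw [sum_dart_eq _ out hout]
        refine Finset.sum_eq_zero fun e _ => ?_
        have : (⟨(out e).symm.edge, (out e).symm.edge_mem⟩ : G.edgeSet) =
          ⟨(out e).edge, (out e).edge_mem⟩ := Subtype.ext (Dart.edge_symm _)
        rw [this, CharTwo.add_self_eq_zero]
      have hstep := partialSum_add_sigma_inv hsum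
      have hsym : ∀ d : G.Dart, partialSum (fun y => c ⟨y.edge, y.edge_mem⟩) d.symm +
          partialSum (fun y => c ⟨y.edge, y.edge_mem⟩) d = c ⟨d.edge, d.edge_mem⟩ := by
        intro d
        rcases lt_or_gt_of_ne d.adj.ne with h | h
        · rw [partialSum_add_symm c d h, hc, Pi.zero_apply, zero_add]
        · have := partialSum_add_symm c d.symm h
          rw [hc, Pi.zero_apply, zero_add, Dart.symm_symm] at this
          rw [add_comm, this]
          congr 1
          exact Subtype.ext (Dart.edge_symm _)
      -- The partial sums change by `c` both across the edge of `d` and in the step from `d` to its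
      -- predecessor; comparing the two gives invariance.
      refine ⟨⟨partialSum fun y => c ⟨y.edge, y.edge_mem⟩, fun d => ?_⟩, ?_⟩
      · have h1 := hstep d
        have h2 := hsym d
        exact add_left_cancel ((add_comm _ _).trans (h2.trans h1.symm))
      · ext e
        have := hstep (out e)
        rw [houte] at this
        exact this
  rw [← finrank_invariants, ← LinearMap.finrank_range_add_finrank_ker D, hker, hrange]

theorem cycleCount_alpha (G : SimpleGraph (Fin n)) : cycleCount (alpha G) = Nat.card G.edgeSet := by
  refine Nat.card_eq_of_bijective
    (Quotient.lift (fun d : G.Dart => (⟨d.edge, d.edge_mem⟩ : G.edgeSet)) ?_) ⟨?_, ?_⟩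
  · rintro d x ⟨k, hk⟩
    have h1 : ∀ (k : ℤ) (d : G.Dart), ((alpha G ^ k) d).edge = d.edge := by
      intro k
      induction k using Int.induction_on with
      | zero => exact fun d => rfl
      | succ k ih =>
        intro d
        rw [zpow_add_one, Equiv.Perm.mul_apply, ih]
        exact Dart.edge_symm d
      | pred k ih =>
        intro d
        rw [zpow_sub_one, Equiv.Perm.mul_apply, ih]
        exact Dart.edge_symm d
    exact Subtype.ext ((h1 k d).symm.trans (congrArg Dart.edge hk))
  · intro q r
    induction q using Quotient.inductionOn with
    | _ d =>
      induction r using Quotient.inductionOn with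
      | _ x =>
        intro h
        apply Quotient.sound
        rcases (dart_edge_eq_iff d x).1 (congrArg Subtype.val h) with rfl | rfl
        · exact Equiv.Perm.SameCycle.refl _ _
        · exact ⟨1, Dart.symm_symm x⟩
  · rintro ⟨e, he⟩
    obtain ⟨out, hout, -⟩ := exists_out G
    exact ⟨Quotient.mk _ (out ⟨e, he⟩), Subtype.ext (hout _)⟩

theorem card_dart_eq (G : SimpleGraph (Fin n)) : Nat.card G.Dart = 2 * Nat.card G.edgeSet := by
  classical
  rw [Nat.card_eq_fintype_card, dart_card_eq_twice_card_edges, Nat.card_eq_fintype_card,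
    edgeFinset_card]

/-- The genus is half the rank of the crossing matrix. -/
theorem genus_eq [Nonempty G.Dart] :
    genus G = (Module.finrank (ZMod 2) (LinearMap.range (crossMap G)) : ℚ) / 2 := by
  classical
  have h1 := LinearMap.finrank_range_add_finrank_ker (crossMap G)
  rw [Module.finrank_fintype_fun_eq_card, ← Nat.card_eq_fintype_card] at h1
  unfold genus
  rw [cycleCount_eq, cycleCount_alpha, card_dart_eq, ← h1]
  push_cast
  ring

/-- The crossing edges of `T` fall into two or three classes such that two of them cross exactly
when they are in different classes. -/
def IsMultipartite (T : SimpleGraph (Fin n)) : Prop :=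
  (∃ e ∈ T.edgeSet, ∃ f ∈ T.edgeSet, Cross e f) ∧ ∃ cl : Sym2 (Fin n) → Fin 3,
    ∀ e f, Crossed T e → Crossed T f → (Cross e f ↔ cl e ≠ cl f)

open Classical in
theorem crossMap_single (e f : G.edgeSet) :
    crossMap G (Pi.single f 1) e = crossMatrix G e f := by
  rw [crossMap_apply]
  simp [Pi.single_apply]

open Classical in
-- The classes are represented by the three nonzero vectors of the plane over the field with two
-- elements, and uncrossed edges by zero. The crossing matrix is then the pullback of the symplectic
-- form, so its map factors through the plane. Two crossing edges supply two different nonzero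
-- vectors, which span the plane; hence nothing is lost.
theorem IsMultipartite.finrank_range (h : IsMultipartite G) :
    Module.finrank (ZMod 2) (LinearMap.range (crossMap G)) = 2 := by
  obtain ⟨⟨e₀, he₀, f₀, hf₀, hef⟩, cl, hcl⟩ := h
  let vec : Fin 3 → ZMod 2 × ZMod 2 := ![(1, 0), (0, 1), (1, 1)]
  let v : G.edgeSet → ZMod 2 × ZMod 2 := fun e => if Crossed G e then vec (cl e) else 0
  have hvec : ∀ i j : Fin 3, (vec i).1 * (vec j).2 + (vec i).2 * (vec j).1 =
      if i ≠ j then 1 else 0 := by decide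
  have hA : ∀ e f : G.edgeSet, crossMatrix G e f = (v e).1 * (v f).2 + (v e).2 * (v f).1 := by
    intro e f
    by_cases he : Crossed G (e : Sym2 (Fin n))
    · by_cases hf : Crossed G (f : Sym2 (Fin n))
      · simp only [v, if_pos he, if_pos hf, hvec]
        exact if_congr (hcl _ _ he hf) rfl rfl
      · have : ¬ Cross (e : Sym2 (Fin n)) f := fun h => hf ⟨f.2, e, e.2, (cross_comm _ _).1 h⟩
        simp [v, if_neg hf, crossMatrix, this]
    · have : ¬ Cross (e : Sym2 (Fin n)) f := fun h => he ⟨e.2, f, f.2, h⟩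
      simp [v, if_neg he, crossMatrix, this]
  let Q : (G.edgeSet → ZMod 2) →ₗ[ZMod 2] ZMod 2 × ZMod 2 :=
    { toFun := fun c => ∑ f, c f • v f
      map_add' := fun a b => by simp [add_smul, Finset.sum_add_distrib]
      map_smul' := fun r a => by simp [Finset.smul_sum, mul_smul] }
  let P : ZMod 2 × ZMod 2 →ₗ[ZMod 2] (G.edgeSet → ZMod 2) :=
    { toFun := fun w e => (v e).1 * w.2 + (v e).2 * w.1
      map_add' := fun a b => by ext e; simp; ring
      map_smul' := fun r a => by ext e; simp; ring }
  have hPQ : crossMap G = P ∘ₗ Q := by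
    refine LinearMap.ext fun c => funext fun e => ?_
    change _ = (v e).1 * (∑ x, c x • v x).2 + (v e).2 * (∑ x, c x • v x).1
    rw [crossMap_apply, Prod.snd_sum, Prod.fst_sum, Finset.mul_sum, Finset.mul_sum,
      ← Finset.sum_add_distrib]
    refine Finset.sum_congr rfl fun x _ => ?_
    rw [hA, Prod.smul_fst, Prod.smul_snd, smul_eq_mul, smul_eq_mul]
    ring
  have hv1 : v ⟨e₀, he₀⟩ = vec (cl e₀) := if_pos ⟨he₀, f₀, hf₀, hef⟩
  have hv2 : v ⟨f₀, hf₀⟩ = vec (cl f₀) := if_pos ⟨hf₀, e₀, he₀, (cross_comm _ _).1 hef⟩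
  have hne : cl e₀ ≠ cl f₀ :=
    (hcl _ _ ⟨he₀, f₀, hf₀, hef⟩ ⟨hf₀, e₀, he₀, (cross_comm _ _).1 hef⟩).1 hef
  have hspan : ∀ (i j : Fin 3), i ≠ j → ∀ w : ZMod 2 × ZMod 2, ∃ a b : ZMod 2,
      a • vec i + b • vec j = w := by decide
  have hinj : ∀ (i j : Fin 3), i ≠ j → ∀ w : ZMod 2 × ZMod 2,
      (vec i).1 * w.2 + (vec i).2 * w.1 = 0 → (vec j).1 * w.2 + (vec j).2 * w.1 = 0 → w = 0 := by
    decide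
  have hQ : Function.Surjective Q := by
    intro w
    obtain ⟨a, b, hw⟩ := hspan _ _ hne w
    have hsing : ∀ (f : G.edgeSet) (r : ZMod 2), Q (Pi.single f r) = r • v f := by
      intro f r
      change ∑ x, (Pi.single f r : G.edgeSet → ZMod 2) x • v x = _
      rw [Finset.sum_eq_single f]
      · simp
      · intro x _ hx; simp [hx]
      · simp
    exact ⟨Pi.single ⟨e₀, he₀⟩ a + Pi.single ⟨f₀, hf₀⟩ b, by
      rw [map_add, hsing, hsing, hv1, hv2, hw]⟩
  have hP : LinearMap.ker P = ⊥ := by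
    rw [LinearMap.ker_eq_bot']
    intro w hw
    have h1 := congrFun hw ⟨e₀, he₀⟩
    have h2 := congrFun hw ⟨f₀, hf₀⟩
    change (v _).1 * w.2 + (v _).2 * w.1 = 0 at h1 h2
    rw [hv1] at h1
    rw [hv2] at h2
    exact hinj _ _ hne w h1 h2
  rw [hPQ, LinearMap.range_comp, LinearMap.range_eq_top.2 hQ, Submodule.map_top,
    LinearMap.finrank_range_of_inj (LinearMap.ker_eq_bot.1 hP), Module.finrank_prod,
    Module.finrank_self]

open Classical in
-- The columns of two crossing edges `e` and `f` form a basis of the column space. Every entry is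
-- then determined by the pairs of entries in these two columns, through the symplectic form.
-- Crossed edges have nonzero pairs, and two nonzero pairs give 1 exactly when they differ, so the
-- pair serves as the class.
theorem isMultipartite_of_finrank_range
    (h : Module.finrank (ZMod 2) (LinearMap.range (crossMap G)) = 2) : IsMultipartite G := by
  have hex : ∃ e ∈ G.edgeSet, ∃ f ∈ G.edgeSet, Cross e f := by
    by_contra hno
    push Not at hno
    have : crossMap G = 0 := by
      refine LinearMap.ext fun c => funext fun e => ?_
      rw [crossMap_apply]
      refine Finset.sum_eq_zero fun x _ => ?_
      simp [crossMatrix, hno e e.2 x x.2]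
    rw [this] at h
    rw [LinearMap.range_zero, finrank_bot] at h
    exact absurd h (by norm_num)
  refine ⟨hex, ?_⟩
  obtain ⟨e₀, he₀, f₀, hf₀, hef⟩ := hex
  let A := crossMatrix G
  let e : G.edgeSet := ⟨e₀, he₀⟩
  let f : G.edgeSet := ⟨f₀, hf₀⟩
  have hAef : A e f = 1 := (crossMatrix_eq_one_iff e f).2 hef
  have hAfe : A f e = 1 := (crossMatrix_comm f e).trans hAef
  have hAee : ∀ x, A x x = 0 := fun x => if_neg (cross_irrefl _)
  let b : Fin 2 → LinearMap.range (crossMap G) :=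
    ![⟨crossMap G (Pi.single e 1), LinearMap.mem_range_self _ _⟩,
      ⟨crossMap G (Pi.single f 1), LinearMap.mem_range_self _ _⟩]
  have hb : LinearIndependent (ZMod 2) b := by
    rw [LinearIndependent.pair_iff]
    intro s t hst
    have h1 := congrArg Subtype.val hst
    have h2 := congrFun h1 e
    have h3 := congrFun h1 f
    simp only [Submodule.coe_add, Submodule.coe_smul, Pi.add_apply, Pi.smul_apply,
      smul_eq_mul, crossMap_single, ZeroMemClass.coe_zero, Pi.zero_apply] at h2 h3
    change s * A e e + t * A e f = 0 at h2
    change s * A f e + t * A f f = 0 at h3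
    rw [hAee, hAef] at h2
    rw [hAee, hAfe] at h3
    simp only [mul_zero, mul_one, zero_add, add_zero] at h2 h3
    exact ⟨h3, h2⟩
  have hspan := hb.span_eq_top_of_card_eq_finrank' (by rw [h]; rfl)
  have hform : ∀ x y, A x y = A f y * A x e + A e y * A x f := by
    intro x y
    have hy : (⟨crossMap G (Pi.single y 1), LinearMap.mem_range_self _ _⟩ :
        LinearMap.range (crossMap G)) ∈ Submodule.span (ZMod 2) (Set.range b) := by
      rw [hspan]
      trivial
    rw [Submodule.mem_span_range_iff_exists_fun] at hy
    obtain ⟨r, hst⟩ := hy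
    rw [Fin.sum_univ_two] at hst
    obtain ⟨s, hs⟩ : ∃ s, s = r 0 := ⟨_, rfl⟩
    obtain ⟨t, ht⟩ : ∃ t, t = r 1 := ⟨_, rfl⟩
    rw [← hs, ← ht] at hst
    have h1 := congrArg Subtype.val hst
    have h2 : ∀ z, s * A z e + t * A z f = A z y := by
      intro z
      have := congrFun h1 z
      change s * crossMap G (Pi.single e 1) z + t * crossMap G (Pi.single f 1) z =
        crossMap G (Pi.single y 1) z at this
      simpa only [crossMap_single] using this
    -- The rows of `e` and `f` isolate the two coefficients, because these edges cross each other
    -- and not themselves.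
    have h3 := h2 e
    have h4 := h2 f
    rw [hAee, hAef] at h3
    rw [hAee, hAfe] at h4
    simp only [mul_zero, mul_one, zero_add, add_zero] at h3 h4
    rw [← h2 x, h3, h4]
  -- Distinct numbers for the three nonzero pairs; the value at zero is irrelevant.
  let num : ZMod 2 × ZMod 2 → Fin 3 := fun p => if p.1 = 0 then 0 else if p.2 = 0 then 1 else 2
  have hnum : ∀ p q : ZMod 2 × ZMod 2, p ≠ 0 → q ≠ 0 →
      (q.2 * p.1 + q.1 * p.2 = 1 ↔ num p ≠ num q) := by decide
  refine ⟨fun x => if hx : x ∈ G.edgeSet then num (A ⟨x, hx⟩ e, A ⟨x, hx⟩ f) else 0, ?_⟩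
  intro x y hx hy
  have hnz : ∀ x (hx : Crossed G x), (A ⟨x, hx.1⟩ e, A ⟨x, hx.1⟩ f) ≠ 0 := by
    rintro x ⟨hx, z, hz, hxz⟩ h0
    rw [Prod.mk_eq_zero] at h0
    have h1 := (crossMatrix_eq_one_iff ⟨x, hx⟩ ⟨z, hz⟩).2 hxz
    change A _ _ = 1 at h1
    rw [hform, h0.1, h0.2] at h1
    simp at h1
  simp only [dif_pos hx.1, dif_pos hy.1]
  rw [← hnum _ _ (hnz x hx) (hnz y hy), ← crossMatrix_eq_one_iff ⟨x, hx.1⟩ ⟨y, hy.1⟩]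
  change A _ _ = 1 ↔ _
  rw [hform ⟨x, hx.1⟩ ⟨y, hy.1⟩]
  have h1 : A f ⟨y, hy.1⟩ = A ⟨y, hy.1⟩ f := crossMatrix_comm _ _
  have h2 : A e ⟨y, hy.1⟩ = A ⟨y, hy.1⟩ e := crossMatrix_comm _ _
  rw [h1, h2]

/-- A circle graph has genus one exactly when its crossing graph, apart from isolated vertices, is
complete bipartite or complete tripartite. -/
theorem genus_eq_one_iff : genus G = 1 ↔ IsMultipartite G := by
  classical
  by_cases hd : Nonempty G.Dart
  · have h1 : genus G = 1 ↔ Module.finrank (ZMod 2) (LinearMap.range (crossMap G)) = 2 := by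
      rw [genus_eq, div_eq_iff two_ne_zero, one_mul]
      norm_cast
    rw [h1]
    exact ⟨isMultipartite_of_finrank_range, IsMultipartite.finrank_range⟩
  · constructor
    · intro h
      have : IsEmpty G.Dart := not_nonempty_iff.1 hd
      -- Without edges all counts are zero and the genus formula gives 1/2.
      have h0 : ∀ f : Equiv.Perm G.Dart, cycleCount f = 0 := fun f => by
        have : IsEmpty (Quotient (Equiv.Perm.SameCycle.setoid f)) :=
          ⟨fun q => Quotient.inductionOn q fun d => isEmptyElim d⟩
        exact Nat.card_of_isEmpty
      unfold genus at h
      rw [h0, h0, Nat.card_of_isEmpty] at h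
      norm_num at h
    · rintro ⟨⟨e, he, -⟩, -⟩
      obtain ⟨out, -⟩ := exists_out G
      exact absurd ⟨out ⟨e, he⟩⟩ hd

end Genus

end CircleTree

namespace CircleTree

open SimpleGraph

/-! ### Invariance of the e-reduction under rotations -/

section Rotations

variable {n : ℕ}

/-- The rotation `ρ` of the circle carries `T` to `T'`. -/
structure Rotates (ρ : Fin n ≃ Fin n) (T T' : SimpleGraph (Fin n)) : Prop where
  rot : ∃ k, IsRotation k ρ
  adj : ∀ x y, T'.Adj (ρ x) (ρ y) ↔ T.Adj x y

variable {ρ : Fin n ≃ Fin n} {T T' : SimpleGraph (Fin n)}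

theorem map_symm_map (ρ : Fin n ≃ Fin n) (e : Sym2 (Fin n)) : (e.map ρ).map ρ.symm = e := by
  simp [Sym2.map_map]

theorem map_map_symm (ρ : Fin n ≃ Fin n) (e : Sym2 (Fin n)) : (e.map ρ.symm).map ρ = e := by
  simp [Sym2.map_map]

theorem exists_eq_map (ρ : Fin n ≃ Fin n) (e : Sym2 (Fin n)) : ∃ f : Sym2 (Fin n), f.map ρ = e :=
  ⟨_, map_map_symm ρ e⟩

namespace Rotates

theorem symm (h : Rotates ρ T T') : Rotates ρ.symm T' T := by
  obtain ⟨⟨k, hk⟩, ha⟩ := h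
  exact ⟨⟨_, hk.symm⟩, fun x y => by rw [← ha]; simp⟩

/-- The isomorphism of graphs given by a rotation. -/
def iso (h : Rotates ρ T T') : T ≃g T' := ⟨ρ, fun {x y} => h.adj x y⟩

theorem cross (h : Rotates ρ T T') (e f : Sym2 (Fin n)) :
    Cross (e.map ρ) (f.map ρ) ↔ Cross e f := by
  obtain ⟨⟨k, hk⟩, -⟩ := h
  exact hk.cross_map_iff e f

theorem sub (h : Rotates ρ T T') (a b : Fin n) : ρ a - ρ b = a - b := by
  obtain ⟨⟨k, hk⟩, -⟩ := h
  exact hk.sub a b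

theorem mem_edgeSet (h : Rotates ρ T T') (e : Sym2 (Fin n)) :
    e.map ρ ∈ T'.edgeSet ↔ e ∈ T.edgeSet := by
  induction e with
  | _ a b => exact h.adj a b

theorem forall_edge (_ : Rotates ρ T T') {P : Sym2 (Fin n) → Prop} :
    (∀ e, P e) ↔ ∀ e : Sym2 (Fin n), P (e.map ρ) :=
  ⟨fun h _ => h _, fun h e => by
    obtain ⟨f, rfl⟩ := exists_eq_map ρ e
    exact h f⟩

theorem exists_edge (_ : Rotates ρ T T') {P : Sym2 (Fin n) → Prop} :
    (∃ e, P e) ↔ ∃ e : Sym2 (Fin n), P (e.map ρ) :=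
  ⟨fun ⟨e, h⟩ => by
    obtain ⟨f, rfl⟩ := exists_eq_map ρ e
    exact ⟨f, h⟩, fun ⟨e, h⟩ => ⟨_, h⟩⟩

theorem crossed (h : Rotates ρ T T') (e : Sym2 (Fin n)) :
    Crossed T' (e.map ρ) ↔ Crossed T e := by
  unfold Crossed
  rw [h.mem_edgeSet, h.exists_edge]
  simp only [h.mem_edgeSet, h.cross]

theorem uncrossed (h : Rotates ρ T T') (e : Sym2 (Fin n)) :
    Uncrossed T' (e.map ρ) ↔ Uncrossed T e := by
  unfold Uncrossed
  rw [h.mem_edgeSet, h.forall_edge]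
  simp only [h.mem_edgeSet, h.cross]

theorem parallel (h : Rotates ρ T T') (e f : Sym2 (Fin n)) :
    Parallel T' (e.map ρ) (f.map ρ) ↔ Parallel T e f := by
  unfold Parallel
  rw [h.mem_edgeSet, h.mem_edgeSet, h.forall_edge (P := fun g => g ∈ T'.edgeSet → _)]
  simp only [h.mem_edgeSet, h.cross]

theorem isTree (h : Rotates ρ T T') (hT : T.IsTree) : T'.IsTree := h.iso.isTree_iff.1 hT

theorem exists_walk_map (h : Rotates ρ T T') {u v : Fin n} (p : T.Walk u v) :
    ∃ q : T'.Walk (ρ u) (ρ v), q.edges = p.edges.map (Sym2.map ρ) ∧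
      q.support = p.support.map ρ :=
  ⟨p.map h.iso.toHom, Walk.edges_map _ _, Walk.support_map _ _⟩

/-- One direction suffices, since the inverse rotation supplies the other; `connectedBy_map` is used
in the same way. -/
theorem linked_map (h : Rotates ρ T T') {e f : Sym2 (Fin n)} (hl : Linked T e f) :
    Linked T' (e.map ρ) (f.map ρ) := by
  obtain ⟨u, v, p, h1, h2, h3⟩ := hl
  obtain ⟨q, hmap, -⟩ := h.exists_walk_map p
  refine ⟨_, _, q, ?_, ?_, ?_⟩
  · rw [hmap, List.head?_map, h1]
    rfl
  · rw [hmap, List.getLast?_map, h2]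
    rfl
  · intro b hb
    rw [hmap, List.mem_map] at hb
    obtain ⟨c, hc, rfl⟩ := hb
    rw [h.uncrossed, h.parallel]
    exact h3 c hc

theorem linked (h : Rotates ρ T T') (e f : Sym2 (Fin n)) :
    Linked T' (e.map ρ) (f.map ρ) ↔ Linked T e f :=
  ⟨fun hl => by simpa only [map_symm_map] using h.symm.linked_map hl, h.linked_map⟩

theorem mem_linkedParallels (h : Rotates ρ T T') (e f : Sym2 (Fin n)) :
    f.map ρ ∈ linkedParallels T' (e.map ρ) ↔ f ∈ linkedParallels T e :=
  and_congr (h.parallel e f) (h.linked e f)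

theorem onArc (h : Rotates ρ T T') (a b x : Fin n) :
    OnArc (ρ a) (ρ b) (ρ x) ↔ OnArc a b x := by
  unfold OnArc
  rw [h.sub, h.sub]

theorem inOrder (h : Rotates ρ T T') (a b c d : Fin n) :
    InOrder (ρ a) (ρ b) (ρ c) (ρ d) ↔ InOrder a b c d := by
  unfold InOrder
  rw [h.sub, h.sub, h.sub]

theorem outermost (h : Rotates ρ T T') (e : Sym2 (Fin n)) (C D E F : Fin n) :
    Outermost (linkedParallels T' (e.map ρ)) (ρ C) (ρ D) (ρ E) (ρ F) ↔
      Outermost (linkedParallels T e) C D E F := by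
  unfold Outermost
  rw [h.inOrder, h.forall_edge]
  have h1 := h.mem_linkedParallels e s(C, D)
  have h2 := h.mem_linkedParallels e s(E, F)
  rw [Sym2.map_mk] at h1 h2
  refine and_congr h1 (and_congr h2 (and_congr Iff.rfl (forall_congr' fun f => ?_)))
  rw [h.mem_linkedParallels]
  refine imp_congr Iff.rfl ?_
  rw [← ρ.exists_congr_right]
  refine exists_congr fun x => ?_
  rw [← ρ.exists_congr_right]
  refine exists_congr fun y => ?_
  rw [h.onArc, h.onArc, ← Sym2.map_mk, (Sym2.map.injective ρ.injective).eq_iff]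

theorem exists_four (_ : Rotates ρ T T') {P : Fin n → Fin n → Fin n → Fin n → Prop} :
    (∃ C D E F, P C D E F) ↔ ∃ C D E F, P (ρ C) (ρ D) (ρ E) (ρ F) := by
  constructor
  · rintro ⟨C, D, E, F, hP⟩
    exact ⟨ρ.symm C, ρ.symm D, ρ.symm E, ρ.symm F, by simpa using hP⟩
  · rintro ⟨C, D, E, F, hP⟩
    exact ⟨_, _, _, _, hP⟩

theorem mem_eGraph (h : Rotates ρ T T') (e f : Sym2 (Fin n)) :
    f.map ρ ∈ eGraph T' (e.map ρ) ↔ f ∈ eGraph T e := by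
  change ((_ ∨ _) ∧ ∃ C D E F, _) ↔ ((_ ∨ _) ∧ ∃ C D E F, _)
  rw [h.uncrossed, h.parallel, h.exists_four]
  simp only [h.outermost, Sym2.mem_map, forall_exists_index, and_imp, forall_apply_eq_imp_iff₂,
    h.onArc]

theorem mem_eGraphPoints (h : Rotates ρ T T') (e : Sym2 (Fin n)) (x : Fin n) :
    ρ x ∈ eGraphPoints T' (e.map ρ) ↔ x ∈ eGraphPoints T e := by
  change (∃ f, _ ∧ _) ↔ ∃ f, _ ∧ _
  rw [h.exists_edge]
  simp only [h.mem_eGraph, Sym2.mem_map, EmbeddingLike.apply_eq_iff_eq, exists_eq_right]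

theorem onSameArc (h : Rotates ρ T T') (e : Sym2 (Fin n)) (x y : Fin n) :
    OnSameArc T' (e.map ρ) (ρ x) (ρ y) ↔ OnSameArc T e x y := by
  unfold OnSameArc
  rw [h.exists_four]
  simp only [h.outermost, h.onArc]

theorem eGraph_eq (h : Rotates ρ T T') (e f : Sym2 (Fin n)) :
    eGraph T' (e.map ρ) = eGraph T' (f.map ρ) ↔ eGraph T e = eGraph T f := by
  simp only [Set.ext_iff]
  rw [h.forall_edge]
  simp only [h.mem_eGraph]

theorem connectedBy_map (h : Rotates ρ T T') {e f : Sym2 (Fin n)} {u v : Fin n}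
    (hc : ConnectedBy T e f u v) : ConnectedBy T' (e.map ρ) (f.map ρ) (ρ u) (ρ v) := by
  obtain ⟨h1, h2, h3, p, h4, h5⟩ := hc
  obtain ⟨q, hmap, hsup⟩ := h.exists_walk_map p
  refine ⟨fun h6 => h1 ((h.eGraph_eq e f).1 h6), (h.mem_eGraphPoints e u).2 h2,
    (h.mem_eGraphPoints f v).2 h3, q, ?_, ?_⟩
  · intro b hb
    rw [hmap, List.mem_map] at hb
    obtain ⟨c, hc, rfl⟩ := hb
    rw [h.uncrossed]
    exact h4 c hc
  · intro x hx
    rw [hsup, List.mem_map] at hx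
    obtain ⟨y, hy, rfl⟩ := hx
    obtain ⟨h6, h7, h8⟩ := h5 y hy
    rw [h.mem_eGraphPoints, h.mem_eGraphPoints]
    refine ⟨fun h9 => congrArg ρ (h6 h9), fun h9 => congrArg ρ (h7 h9), ?_⟩
    rw [h.forall_edge]
    intro g
    rw [h.crossed, Ne, h.eGraph_eq, Ne, h.eGraph_eq, h.mem_eGraphPoints]
    exact h8 g

theorem connectedBy (h : Rotates ρ T T') (e f : Sym2 (Fin n)) (u v : Fin n) :
    ConnectedBy T' (e.map ρ) (f.map ρ) (ρ u) (ρ v) ↔ ConnectedBy T e f u v :=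
  ⟨fun hc => by simpa only [map_symm_map, Equiv.symm_apply_apply] using h.symm.connectedBy_map hc,
    h.connectedBy_map⟩

theorem mem_image (_ : Rotates ρ T T') (R : Set (Sym2 (Fin n))) (e : Sym2 (Fin n)) :
    e.map ρ ∈ Sym2.map ρ '' R ↔ e ∈ R :=
  (Sym2.map.injective ρ.injective).mem_set_image

theorem isSelection (h : Rotates ρ T T') {R : Set (Sym2 (Fin n))} (hR : IsSelection T R) :
    IsSelection T' (Sym2.map ρ '' R) := by
  constructor
  · rintro _ ⟨r, hr, rfl⟩
    exact (h.crossed r).2 (hR.1 r hr)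
  · rw [h.forall_edge]
    intro e he
    obtain ⟨r, ⟨h1, h2⟩, h3⟩ := hR.2 e ((h.crossed e).1 he)
    refine ⟨r.map ρ, ⟨⟨r, h1, rfl⟩, (h.mem_eGraph e r).2 h2⟩, ?_⟩
    rintro _ ⟨⟨r', h4, rfl⟩, h5⟩
    rw [h3 r' ⟨h4, (h.mem_eGraph e r').1 h5⟩]

theorem stepOne (h : Rotates ρ T T') (R : Set (Sym2 (Fin n))) :
    Rotates ρ (stepOne T R) (stepOne T' (Sym2.map ρ '' R)) := by
  refine ⟨h.rot, fun x y => ?_⟩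
  unfold CircleTree.stepOne
  rw [deleteEdges_adj, deleteEdges_adj, h.adj]
  change _ ∧ ¬ (Crossed T' (s(x, y).map ρ) ∧ s(x, y).map ρ ∉ _) ↔ _
  rw [h.crossed, h.mem_image]
  rfl

theorem stepTwo (h : Rotates ρ T T') (R : Set (Sym2 (Fin n))) :
    Rotates ρ (stepTwo T R) (stepTwo T' (Sym2.map ρ '' R)) := by
  refine ⟨h.rot, fun x y => ?_⟩
  unfold CircleTree.stepTwo
  rw [deleteEdges_adj, deleteEdges_adj, (h.stepOne R).adj]
  change _ ∧ ¬ (Uncrossed _ (s(x, y).map ρ)) ↔ _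
  rw [(h.stepOne R).uncrossed]
  rfl

theorem stepThree (h : Rotates ρ T T') (R : Set (Sym2 (Fin n))) :
    Rotates ρ (stepThree T R) (stepThree T' (Sym2.map ρ '' R)) := by
  refine ⟨h.rot, fun x y => ?_⟩
  unfold CircleTree.stepThree
  rw [sup_adj, sup_adj, (h.stepTwo R).adj, fromEdgeSet_adj, fromEdgeSet_adj]
  refine or_congr Iff.rfl (and_congr ?_ (not_congr ρ.apply_eq_iff_eq))
  change (∃ r₁, _ ∧ ∃ r₂, _ ∧ ∃ u v, _ ∧ ∃ a, _ ∧ ∃ b, _ ∧ _) ↔ _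
  simp only [Set.mem_image, exists_exists_and_eq_and, Sym2.mem_map]
  refine exists_congr fun r₁ => and_congr Iff.rfl (exists_congr fun r₂ => and_congr Iff.rfl ?_)
  rw [← ρ.exists_congr_right]
  refine exists_congr fun u => ?_
  rw [← ρ.exists_congr_right]
  refine exists_congr fun v => ?_
  simp only [h.connectedBy, h.onSameArc]
  refine and_congr Iff.rfl (exists_congr fun a => and_congr Iff.rfl (exists_congr fun b =>
    and_congr Iff.rfl (and_congr Iff.rfl (and_congr Iff.rfl ?_))))
  rw [← Sym2.map_mk, ← Sym2.map_mk, (Sym2.map.injective ρ.injective).eq_iff]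

theorem trimmed_eq (h : Rotates ρ T T') : trimmed T' = trimmed T := by
  obtain ⟨k, hk⟩ := h.rot
  exact trimmed_eq_of_isRotation hk T T' h.adj

end Rotates

theorem exists_rotates_of_unlabel_eq {m : ℕ} {T : SimpleGraph (Fin n)} {T' : SimpleGraph (Fin m)}
    (h : unlabel T = unlabel T') :
    ∃ (hm : m = n) (ρ : Fin n ≃ Fin n), Rotates ρ T (hm ▸ T') := by
  have hc : n = m := SameUnlabeled.card_eq (unlabel_eq_iff.1 h)
  subst hc
  obtain ⟨k, ρ, hk, ha⟩ := unlabel_eq_iff_exists_isRotation.1 h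
  exact ⟨rfl, ρ, ⟨k, hk⟩, ha⟩

theorem exists_rotates (k : ℕ) (hn : 0 < n) (T : SimpleGraph (Fin n)) :
    ∃ (ρ : Fin n ≃ Fin n) (T' : SimpleGraph (Fin n)), IsRotation k ρ ∧ Rotates ρ T T' := by
  obtain ⟨ρ, hρ⟩ := exists_isRotation k hn
  exact ⟨ρ, T.comap ρ.symm, hρ, ⟨k, hρ⟩, fun x y => by simp⟩

end Rotations

end CircleTree

namespace CircleTree

open SimpleGraph

/-! ### The blocks around the circle for graphs of genus one -/

section Frames

variable {n : ℕ}

/-- The crossed edges of `T` fall into `m` classes. The endpoints of the edges of a class fill two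
blocks; the `2 m` blocks, from `s t` to `e t` for `t < 2 m`, follow each other around the circle,
and the edges between the `t`-th and the `t + m`-th block form a class. -/
structure Frame (T : SimpleGraph (Fin n)) (m : ℕ) (s e : ℕ → Fin n) : Prop where
  m_eq : m = 2 ∨ m = 3
  per_s : ∀ t, s (t + 2 * m) = s t
  per_e : ∀ t, e (t + 2 * m) = e t
  le : ∀ t, s t ≤ e t
  lt : ∀ i j, i < j → j < 2 * m → e i < s j
  -- Read at `t + m`, this also makes `e t` and `s (t + m)` adjacent. Both bounding chords of a
  -- class are therefore edges.
  adj : ∀ t, T.Adj (s t) (e (t + m))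
  cov : ∀ x y, Crossed T s(x, y) → ∃ t < 2 * m,
    (s t ≤ x ∧ x ≤ e t) ∧ (s (t + m) ≤ y ∧ y ≤ e (t + m))
  nest : ∀ t x y x' y', T.Adj x y → T.Adj x' y' → (s t ≤ x ∧ x ≤ e t) →
    (s (t + m) ≤ y ∧ y ≤ e (t + m)) → (s t ≤ x' ∧ x' ≤ e t) →
    (s (t + m) ≤ y' ∧ y' ≤ e (t + m)) → ¬ Cross s(x, y) s(x', y')

/-- Only the first `2 * m` blocks have to be given. The continuation is periodic, and since the
opposite of `t + m` is again `t`, the conditions on pairs of opposite blocks are needed only for `t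
< m`. -/
theorem Frame.ofMod {T : SimpleGraph (Fin n)} {m : ℕ} (hm : m = 2 ∨ m = 3) (v w : ℕ → Fin n)
    (hle : ∀ t < 2 * m, v t ≤ w t) (hlt : ∀ t, t + 1 < 2 * m → w t < v (t + 1))
    (hadj : ∀ t < m, T.Adj (v t) (w (t + m)) ∧ T.Adj (v (t + m)) (w t))
    (hcov : ∀ x y, x < y → Crossed T s(x, y) → ∃ t < m,
      (v t ≤ x ∧ x ≤ w t) ∧ (v (t + m) ≤ y ∧ y ≤ w (t + m)))
    (hnest : ∀ t < m, ∀ x y x' y', T.Adj x y → T.Adj x' y' → (v t ≤ x ∧ x ≤ w t) →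
      (v (t + m) ≤ y ∧ y ≤ w (t + m)) → (v t ≤ x' ∧ x' ≤ w t) →
      (v (t + m) ≤ y' ∧ y' ≤ w (t + m)) → ¬ Cross s(x, y) s(x', y')) :
    Frame T m (fun t => v (t % (2 * m))) (fun t => w (t % (2 * m))) := by
  have hpos : 0 < 2 * m := by omega
  have hmod : ∀ t, (t % (2 * m) < m ∧ (t + m) % (2 * m) = t % (2 * m) + m) ∨
      (m ≤ t % (2 * m) ∧ t % (2 * m) < 2 * m ∧ (t + m) % (2 * m) + m = t % (2 * m)) := by
    intro t
    rcases hm with rfl | rfl <;> omega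
  refine ⟨hm, fun t => by simp, fun t => by simp, fun t => hle _ (Nat.mod_lt _ hpos), ?_, ?_, ?_, ?_⟩
  · intro i j hij hj
    rw [Nat.mod_eq_of_lt hj, Nat.mod_eq_of_lt (hij.trans hj)]
    obtain ⟨k, rfl⟩ := Nat.exists_eq_add_of_lt hij
    clear hij
    induction k with
    | zero => exact hlt i hj
    | succ k ih =>
      exact (ih (by omega)).trans_le ((hle _ (by omega)).trans (hlt (i + k + 1) hj).le)
  · intro t
    rcases hmod t with ⟨h1, h2⟩ | ⟨h1, h2, h3⟩
    · rw [h2]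
      exact (hadj _ h1).1
    · rw [← h3]
      exact (hadj _ (by omega)).2
  · intro x y hxy
    rcases lt_or_gt_of_ne (show x ≠ y from (show T.Adj x y from hxy.1).ne) with h | h
    · obtain ⟨t, ht, h1, h2⟩ := hcov x y h hxy
      refine ⟨t, by omega, ?_⟩
      rw [Nat.mod_eq_of_lt (show t < 2 * m by omega),
        Nat.mod_eq_of_lt (show t + m < 2 * m by omega)]
      exact ⟨h1, h2⟩
    · rw [Sym2.eq_swap] at hxy
      obtain ⟨t, ht, h1, h2⟩ := hcov y x h hxy
      refine ⟨t + m, by omega, ?_⟩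
      rw [Nat.mod_eq_of_lt (show t + m < 2 * m by omega),
        show t + m + m = t + 2 * m by ring, Nat.add_mod_right,
        Nat.mod_eq_of_lt (show t < 2 * m by omega)]
      exact ⟨h2, h1⟩
  · intro t x y x' y' ha ha' hx hy hx' hy'
    rcases hmod t with ⟨h1, h2⟩ | ⟨h1, h2, h3⟩
    · rw [h2] at hy hy'
      exact hnest _ h1 x y x' y' ha ha' hx hy hx' hy'
    · rw [← h3] at hx hx'
      rw [Sym2.eq_swap, Sym2.eq_swap (a := x')]
      exact hnest _ (by omega) y x y' x' ha.symm ha'.symm hy hx hy' hx'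

/-- Among finitely many nested pairs there is an outermost one. -/
theorem exists_outer {P : Fin n → Fin n → Prop} (hne : ∃ x y, P x y)
    (hnest : ∀ x y x' y', P x y → P x' y' → (x ≤ x' ∧ y' ≤ y) ∨ (x' ≤ x ∧ y ≤ y')) :
    ∃ x y, P x y ∧ ∀ x' y', P x' y' → x ≤ x' ∧ y' ≤ y := by
  obtain ⟨x, y, hxy⟩ := hne
  -- For nested pairs the outermost one minimizes the number of points that it leaves outside.
  obtain ⟨⟨a, b⟩, hab, hmin⟩ := (measure fun z : Fin n × Fin n => (z.1 : ℕ) + (n - z.2)).wf.has_min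
    {z | P z.1 z.2} ⟨(x, y), hxy⟩
  refine ⟨a, b, hab, fun x' y' h' => ?_⟩
  rcases hnest _ _ _ _ hab h' with h | h
  · exact h
  · have h2 : ¬ ((x' : ℕ) + (n - y') < (a : ℕ) + (n - b)) := hmin (x', y') h'
    have h3 := y'.isLt
    have h4 := b.isLt
    simp only [Fin.le_def] at h ⊢
    omega

theorem exists_inner {P : Fin n → Fin n → Prop} (hne : ∃ x y, P x y)
    (hnest : ∀ x y x' y', P x y → P x' y' → (x ≤ x' ∧ y' ≤ y) ∨ (x' ≤ x ∧ y ≤ y')) :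
    ∃ x y, P x y ∧ ∀ x' y', P x' y' → x' ≤ x ∧ y ≤ y' := by
  obtain ⟨y, x, h1, h2⟩ := exists_outer (P := fun y x => P x y)
    (by obtain ⟨x, y, h⟩ := hne; exact ⟨y, x, h⟩)
    (fun y x y' x' h h' => ((hnest x y x' y' h h').symm.imp And.symm And.symm))
  exact ⟨x, y, h1, fun x' y' h => (h2 y' x' h).symm⟩

theorem Rotates.trans {ρ τ : Fin n ≃ Fin n} {T T' T'' : SimpleGraph (Fin n)}
    (h : Rotates ρ T T') (h' : Rotates τ T' T'') : Rotates (ρ.trans τ) T T'' := by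
  obtain ⟨⟨k, hk⟩, ha⟩ := h
  obtain ⟨⟨l, hl⟩, hb⟩ := h'
  refine ⟨⟨k + l, fun x => ?_⟩, fun x y => (hb _ _).trans (ha _ _)⟩
  rw [Equiv.trans_apply, hl, hk, Nat.mod_add_mod, add_assoc]

/-- After a rotation, the edges of one class start before all other crossed edges. -/
theorem exists_rotates_first_class {T : SimpleGraph (Fin n)} (h : IsMultipartite T) :
    ∃ ρ T', Rotates ρ T T' ∧ ∃ (cl : Sym2 (Fin n) → Fin 3) (A : Fin 3) (b b' z x : Fin n),
      (∀ e f, Crossed T' e → Crossed T' f → (Cross e f ↔ cl e ≠ cl f)) ∧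
      Crossed T' s(b, b') ∧ cl s(b, b') ≠ A ∧
      (∀ p q, p < q → Crossed T' s(p, q) → cl s(p, q) = A → p < b ∧ b < q ∧ q < b') ∧
      (z : ℕ) = 0 ∧ z < x ∧ Crossed T' s(z, x) ∧ cl s(z, x) = A := by
  -- first rotate an endpoint of an edge outside the class to the beginning
  obtain ⟨ρ, T₁, hρ, a₀, b₀, cl, A, ha₀, hcl, hab, hA, p, q, hpq, hpq'⟩ : ∃ ρ T₁, Rotates ρ T T₁ ∧
      ∃ (a b : Fin n) (cl : Sym2 (Fin n) → Fin 3) (A : Fin 3), (a : ℕ) = 0 ∧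
      (∀ e f, Crossed T₁ e → Crossed T₁ f → (Cross e f ↔ cl e ≠ cl f)) ∧
      Crossed T₁ s(a, b) ∧ cl s(a, b) ≠ A ∧ ∃ p q, Crossed T₁ s(p, q) ∧ cl s(p, q) = A := by
    obtain ⟨⟨e₀, he₀, f₀, hf₀, hef⟩, cl, hcl⟩ := h
    induction e₀ with
    | _ p q =>
    induction f₀ with
    | _ a b =>
    have hn : 0 < n := lt_of_le_of_lt (Nat.zero_le _) a.isLt
    have ce : Crossed T s(p, q) := ⟨he₀, _, hf₀, hef⟩
    have cf : Crossed T s(a, b) := ⟨hf₀, _, he₀, (cross_comm _ _).1 hef⟩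
    obtain ⟨ρ, T₁, hr, hρ⟩ := exists_rotates (n - a) hn T
    refine ⟨ρ, T₁, hρ, ρ a, ρ b, fun e => cl (e.map ρ.symm), cl s(p, q), ?_, ?_,
      (hρ.crossed s(a, b)).2 cf, ?_, ρ p, ρ q, (hρ.crossed s(p, q)).2 ce, ?_⟩
    · rw [hr a, Nat.add_sub_cancel' a.isLt.le, Nat.mod_self]
    · rw [hρ.forall_edge]
      intro e
      rw [hρ.forall_edge]
      intro f he hf
      simp only [map_symm_map, hρ.cross]
      exact hcl e f ((hρ.crossed e).1 he) ((hρ.crossed f).1 hf)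
    · simp only [Sym2.map_mk, Equiv.symm_apply_apply]
      exact Ne.symm ((hcl _ _ ce cf).1 hef)
    · simp only [Sym2.map_mk, Equiv.symm_apply_apply]
  have hn : 0 < n := lt_of_le_of_lt (Nat.zero_le _) a₀.isLt
  have hab' : a₀ < b₀ := by
    have : a₀ ≠ b₀ := (show T₁.Adj a₀ b₀ from hab.1).ne
    rw [Fin.lt_def]
    by_contra h1
    exact this (Fin.ext (by omega))
  have hAcross : ∀ p q, p < q → Crossed T₁ s(p, q) → cl s(p, q) = A → p < b₀ ∧ b₀ < q := by
    intro p q hlt hc hcA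
    have h1 : Cross s(a₀, b₀) s(p, q) := (hcl _ _ hab hc).2 (by rw [hcA]; exact hA)
    rw [cross_iff_of_lt_lt hab' hlt] at h1
    simp only [Fin.lt_def] at *
    omega
  -- `z` is the smallest left endpoint of the class `A`. Rotating it to the beginning sends `a₀`
  -- behind all right endpoints of `A`, and `b₀` remains between the left and the right endpoints.
  obtain ⟨z, ⟨x, hzx, hcz, hclz⟩, hmin⟩ := wellFounded_lt.has_min
      {z : Fin n | ∃ x, z < x ∧ Crossed T₁ s(z, x) ∧ cl s(z, x) = A} (by
    rcases lt_or_gt_of_ne (show p ≠ q from (show T₁.Adj p q from hpq.1).ne) with h1 | h1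
    · exact ⟨p, q, h1, hpq, hpq'⟩
    · exact ⟨q, p, h1, by rwa [Sym2.eq_swap], by rwa [Sym2.eq_swap]⟩)
  obtain ⟨τ, T₂, hr, hτ⟩ := exists_rotates (n - z) hn T₁
  have hz0 : (a₀ : ℕ) < z := by
    have h1 : a₀ ≠ z := by
      rintro rfl
      have h1 : Cross s(a₀, b₀) s(a₀, x) := (hcl _ _ hab hcz).2 (by rw [hclz]; exact hA)
      rw [cross_iff_of_lt_lt hab' hzx] at h1
      simp only [Fin.lt_def] at *
      omega
    have h2 : (a₀ : ℕ) ≠ z := fun h => h1 (Fin.ext h)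
    omega
  have hv : ∀ y : Fin n, ((z : ℕ) ≤ y ∧ (τ y : ℕ) + z = y) ∨ ((y : ℕ) < z ∧ (τ y : ℕ) + z = y + n) := by
    intro y
    have h1 := z.isLt
    have h2 := y.isLt
    have := hr.val_eq (by omega) y
    omega
  refine ⟨ρ.trans τ, T₂, hρ.trans hτ, fun e => cl (e.map τ.symm), A, τ b₀, τ a₀, τ z, τ x, ?_, ?_, ?_,
    ?_, ?_, ?_, ?_, ?_⟩
  · rw [hτ.forall_edge]
    intro e
    rw [hτ.forall_edge]
    intro f he hf
    simp only [map_symm_map, hτ.cross]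
    exact hcl e f ((hτ.crossed e).1 he) ((hτ.crossed f).1 hf)
  · rw [Sym2.eq_swap]
    exact (hτ.crossed s(a₀, b₀)).2 hab
  · rw [Sym2.eq_swap]
    simpa only [Sym2.map_mk, Equiv.symm_apply_apply] using hA
  · intro p q hlt hc hcA
    obtain ⟨p, rfl⟩ := τ.surjective p
    obtain ⟨q, rfl⟩ := τ.surjective q
    simp only [Sym2.map_mk, Equiv.symm_apply_apply] at hcA
    have hc' := (hτ.crossed s(p, q)).1 hc
    have h1 := hv p
    have h2 := hv q
    have h3 := hv b₀
    have h4 := hv a₀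
    have h5 := p.isLt
    have h6 := q.isLt
    rw [Fin.lt_def] at hlt
    have hpq2 : ((p : ℕ) < q ∧ (z : ℕ) ≤ p ∧ p < b₀ ∧ b₀ < q) ∨
        ((q : ℕ) < p ∧ (z : ℕ) ≤ q ∧ q < b₀ ∧ b₀ < p) := by
      rcases lt_or_gt_of_ne (show p ≠ q from (show T₁.Adj p q from hc'.1).ne) with h7 | h7
      · exact Or.inl ⟨h7, not_lt.1 (hmin p ⟨q, h7, hc', hcA⟩), hAcross p q h7 hc' hcA⟩
      · rw [Sym2.eq_swap] at hc' hcA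
        exact Or.inr ⟨h7, not_lt.1 (hmin q ⟨p, h7, hc', hcA⟩), hAcross q p h7 hc' hcA⟩
    simp only [Fin.lt_def] at *
    omega
  · have := hv z
    omega
  · have h1 := hv z
    have h2 := hv x
    have h3 := x.isLt
    rw [Fin.lt_def] at *
    omega
  · exact (hτ.crossed s(z, x)).2 hcz
  · simpa only [Sym2.map_mk, Equiv.symm_apply_apply] using hclz

/-- Classes of nested edges that follow each other around the circle give a frame. -/
theorem exists_frame_of_classes {T : SimpleGraph (Fin n)} {m : ℕ} (hm : m = 2 ∨ m = 3)
    (cl : Sym2 (Fin n) → Fin 3)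
    (hcl : ∀ e f, Crossed T e → Crossed T f → (Cross e f ↔ cl e ≠ cl f)) (c : ℕ → Fin 3)
    (hne : ∀ t < m, ∃ x y, x < y ∧ Crossed T s(x, y) ∧ cl s(x, y) = c t)
    (hcov : ∀ e, Crossed T e → ∃ t < m, cl e = c t)
    (hord : ∀ t t', t < t' → t' < m → ∀ x y x' y', x < y → Crossed T s(x, y) →
      cl s(x, y) = c t → x' < y' → Crossed T s(x', y') → cl s(x', y') = c t' →
      x < x' ∧ x' < y ∧ y < y')
    (hnest : ∀ c x y x' y', (x < y ∧ Crossed T s(x, y) ∧ cl s(x, y) = c) →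
      (x' < y' ∧ Crossed T s(x', y') ∧ cl s(x', y') = c) →
      (x ≤ x' ∧ y' ≤ y) ∨ (x' ≤ x ∧ y ≤ y')) :
    ∃ s e, Frame T m s e := by
  have hn : Nonempty (Fin n) := by
    obtain ⟨x, -⟩ := hne 0 (by omega)
    exact ⟨x⟩
  have hout : ∀ t, ∃ x y, t < m → (x < y ∧ Crossed T s(x, y) ∧ cl s(x, y) = c t) ∧
      ∀ x' y', (x' < y' ∧ Crossed T s(x', y') ∧ cl s(x', y') = c t) → x ≤ x' ∧ y' ≤ y := by
    intro t
    by_cases ht : t < m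
    · obtain ⟨x, y, h⟩ := exists_outer (hne t ht) (hnest (c t))
      exact ⟨x, y, fun _ => h⟩
    · exact ⟨Classical.arbitrary _, Classical.arbitrary _, fun h => absurd h ht⟩
  have hin : ∀ t, ∃ x y, t < m → (x < y ∧ Crossed T s(x, y) ∧ cl s(x, y) = c t) ∧
      ∀ x' y', (x' < y' ∧ Crossed T s(x', y') ∧ cl s(x', y') = c t) → x' ≤ x ∧ y ≤ y' := by
    intro t
    by_cases ht : t < m
    · obtain ⟨x, y, h⟩ := exists_inner (hne t ht) (hnest (c t))
      exact ⟨x, y, fun _ => h⟩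
    · exact ⟨Classical.arbitrary _, Classical.arbitrary _, fun h => absurd h ht⟩
  choose o₁ o₂ ho using hout
  choose i₁ i₂ hi using hin
  have hlt' : ∀ t < m, ∀ t' < m, t < t' → o₁ t ≤ i₁ t ∧ i₁ t < o₁ t' ∧ i₁ t' < i₂ t ∧
      i₂ t ≤ o₂ t ∧ o₂ t < i₂ t' ∧ o₁ t' ≤ i₁ t' ∧ i₂ t' ≤ o₂ t' := by
    intro t ht t' ht' htt
    obtain ⟨⟨a1, a2, a3⟩, a4⟩ := ho t ht
    obtain ⟨⟨b1, b2, b3⟩, b4⟩ := hi t ht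
    obtain ⟨⟨c1, c2, c3⟩, c4⟩ := ho t' ht'
    obtain ⟨⟨d1, d2, d3⟩, d4⟩ := hi t' ht'
    have e1 := a4 _ _ ⟨b1, b2, b3⟩
    have e2 := c4 _ _ ⟨d1, d2, d3⟩
    exact ⟨e1.1, (hord t t' htt ht' _ _ _ _ b1 b2 b3 c1 c2 c3).1,
      (hord t t' htt ht' _ _ _ _ b1 b2 b3 d1 d2 d3).2.1, e1.2,
      (hord t t' htt ht' _ _ _ _ a1 a2 a3 d1 d2 d3).2.2, e2.1, e2.2⟩
  have hle1 : ∀ t < m, o₁ t ≤ i₁ t ∧ i₂ t ≤ o₂ t := fun t ht => (ho t ht).2 _ _ (hi t ht).1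
  -- On the left, a block runs from the outermost to the innermost left endpoint of its class; on
  -- the right, from the innermost to the outermost right endpoint.
  let v : ℕ → Fin n := fun t => if t < m then o₁ t else i₂ (t - m)
  let w : ℕ → Fin n := fun t => if t < m then i₁ t else o₂ (t - m)
  have v1 : ∀ t < m, v t = o₁ t := fun t ht => if_pos ht
  have w1 : ∀ t < m, w t = i₁ t := fun t ht => if_pos ht
  have v2 : ∀ t, v (t + m) = i₂ t := fun t => by simp [v]
  have w2 : ∀ t, w (t + m) = o₂ t := fun t => by simp [w]
  refine ⟨_, _, Frame.ofMod hm v w ?_ ?_ ?_ ?_ ?_⟩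
  · intro t ht
    rcases lt_or_ge t m with h | h
    · rw [v1 t h, w1 t h]
      exact (hle1 t h).1
    · obtain ⟨t, rfl⟩ := Nat.exists_eq_add_of_le' h
      rw [v2, w2]
      exact (hle1 t (by omega)).2
  · intro t ht
    rcases lt_or_ge (t + 1) m with h | h
    · rw [v1 _ h, w1 t (by omega)]
      exact (hlt' t (by omega) (t + 1) h (by omega)).2.1
    · obtain ⟨k, hk⟩ := Nat.exists_eq_add_of_le' h
      rw [hk, v2]
      cases k with
      | zero =>
        rw [w1 t (by omega)]
        exact (hlt' 0 (by omega) t (by omega) (by omega)).2.2.1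
      | succ k =>
        obtain rfl : t = k + m := by omega
        rw [w2]
        exact (hlt' k (by omega) (k + 1) (by omega) (by omega)).2.2.2.2.1
  · intro t ht
    rw [v1 t ht, w2, v2, w1 t ht]
    exact ⟨(ho t ht).1.2.1.1, (show T.Adj _ _ from (hi t ht).1.2.1.1).symm⟩
  · intro x y hxy hc
    obtain ⟨t, ht, h1⟩ := hcov _ hc
    refine ⟨t, ht, ?_⟩
    rw [v1 t ht, w1 t ht, v2, w2]
    have h2 := (ho t ht).2 x y ⟨hxy, hc, h1⟩
    have h3 := (hi t ht).2 x y ⟨hxy, hc, h1⟩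
    exact ⟨⟨h2.1, h3.1⟩, h3.2, h2.2⟩
  · intro t ht
    -- An edge between opposite blocks crosses the outer chords of all other classes. So it is
    -- crossed and belongs to the class of these blocks.
    have key : ∀ x y, T.Adj x y → (v t ≤ x ∧ x ≤ w t) → (v (t + m) ≤ y ∧ y ≤ w (t + m)) →
        Crossed T s(x, y) ∧ cl s(x, y) = c t := by
      intro x y hxy hx hy
      rw [v1 t ht, w1 t ht] at hx
      rw [v2, w2] at hy
      have hcr : ∀ t' < m, t' ≠ t → Cross s(x, y) s(o₁ t', o₂ t') := by
        intro t' ht' hne'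
        have h1 := (ho t' ht').1.1
        have h2 := hle1 t' ht'
        have h3 := hle1 t ht
        rw [cross_mk_iff]
        rcases lt_or_gt_of_ne hne' with h | h
        · have := hlt' t' ht' t ht h
          simp only [Fin.le_def, Fin.lt_def] at *
          omega
        · have := hlt' t ht t' ht' h
          simp only [Fin.le_def, Fin.lt_def] at *
          omega
      have hcx : Crossed T s(x, y) := by
        obtain ⟨t', h1, h2⟩ : ∃ t' < m, t' ≠ t := by
          rcases Nat.eq_zero_or_pos t with h | h
          · exact ⟨1, by omega, by omega⟩
          · exact ⟨0, by omega, by omega⟩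
        exact ⟨hxy, _, (ho t' h1).1.2.1.1, hcr t' h1 h2⟩
      refine ⟨hcx, ?_⟩
      obtain ⟨t', ht', h1⟩ := hcov _ hcx
      by_cases h2 : t' = t
      · rw [← h2, h1]
      · exact absurd (((hcl _ _ hcx (ho t' ht').1.2.1).1 (hcr t' ht' h2)))
          (by rw [h1, (ho t' ht').1.2.2]; exact fun h => h rfl)
    intro x y x' y' ha ha' hx hy hx' hy'
    obtain ⟨h1, h2⟩ := key x y ha hx hy
    obtain ⟨h3, h4⟩ := key x' y' ha' hx' hy'
    rw [hcl _ _ h1 h3, h2, h4]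
    exact fun h => h rfl

/-- A graph of genus one has a frame after a rotation. -/
theorem exists_frame {T : SimpleGraph (Fin n)} (h : IsMultipartite T) :
    ∃ ρ T', Rotates ρ T T' ∧ ∃ m s e, Frame T' m s e := by
  obtain ⟨ρ, T', hρ, cl, A, b, b', z, x, hcl, hb, hbA, hAb, hz, hzx, hcz, hclz⟩ :=
    exists_rotates_first_class h
  refine ⟨ρ, T', hρ, ?_⟩
  let P : Fin 3 → Fin n → Fin n → Prop := fun c x y => x < y ∧ Crossed T' s(x, y) ∧ cl s(x, y) = c
  have hcross : ∀ c c' x y x' y', P c x y → P c' x' y' → c ≠ c' →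
      (x < x' ∧ x' < y ∧ y < y') ∨ (x' < x ∧ x < y' ∧ y' < y) := by
    rintro c c' x y x' y' ⟨h1, h2, rfl⟩ ⟨h3, h4, rfl⟩ hne
    exact (cross_iff_of_lt_lt h1 h3).1 ((hcl _ _ h2 h4).2 hne)
  have hnc : ∀ c x y x' y', P c x y → P c x' y' →
      ¬ ((x < x' ∧ x' < y ∧ y < y') ∨ (x' < x ∧ x < y' ∧ y' < y)) := by
    rintro c x y x' y' ⟨h1, h2, rfl⟩ ⟨h3, h4, h5⟩ hc
    exact (hcl _ _ h2 h4).1 ((cross_iff_of_lt_lt h1 h3).2 hc) h5.symm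
  have hPz : P A z x := ⟨hzx, hcz, hclz⟩
  -- the edges outside the class `A`
  have hA : ∀ c p q d d', P A p q → P c d d' → c ≠ A → p < d ∧ d < q ∧ q < d' := by
    intro c p q d d' hp hd hc
    have h1 := hcross _ _ _ _ _ _ hp hd hc.symm
    have h2 := hcross _ _ _ _ _ _ hPz hd hc.symm
    have h3 := hnc _ _ _ _ _ hPz hp
    have h4 := hAb p q hp.1 hp.2.1 hp.2.2
    have h5 := hAb z x hzx hcz hclz
    simp only [Fin.lt_def] at *
    omega
  have hnestA : ∀ x y x' y', P A x y → P A x' y' → (x ≤ x' ∧ y' ≤ y) ∨ (x' ≤ x ∧ y ≤ y') := by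
    intro x y x' y' h1 h2
    have h3 := hnc _ _ _ _ _ h1 h2
    have h4 := hAb _ _ h1.1 h1.2.1 h1.2.2
    have h5 := hAb _ _ h2.1 h2.2.1 h2.2.2
    simp only [Fin.lt_def, Fin.le_def] at *
    omega
  have hnest : ∀ c x y x' y', P c x y → P c x' y' → (x ≤ x' ∧ y' ≤ y) ∨ (x' ≤ x ∧ y ≤ y') := by
    intro c x y x' y' h1 h2
    by_cases hc : c = A
    · subst hc
      exact hnestA _ _ _ _ h1 h2
    · have h3 := hnc _ _ _ _ _ h1 h2
      have h4 := hA _ _ _ _ _ hPz h1 hc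
      have h5 := hA _ _ _ _ _ hPz h2 hc
      simp only [Fin.lt_def, Fin.le_def] at *
      omega
  have hbb : P (cl s(b, b')) b b' := by
    have h5 := hAb z x hzx hcz hclz
    exact ⟨h5.2.1.trans h5.2.2, hb, rfl⟩
  have horient : ∀ e, Crossed T' e → ∃ x y, P (cl e) x y := by
    intro e he
    induction e with
    | _ x y =>
      rcases lt_or_gt_of_ne (show x ≠ y from (show T'.Adj x y from he.1).ne) with h1 | h1
      · exact ⟨x, y, h1, he, rfl⟩
      · rw [Sym2.eq_swap] at he ⊢
        exact ⟨y, x, h1, he, rfl⟩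
  by_cases hC : ∃ e, Crossed T' e ∧ cl e ≠ A ∧ cl e ≠ cl s(b, b')
  · -- three classes
    obtain ⟨B, C, hBA, hCA, hBC, d, d', g, g', hd, hg, hdg⟩ : ∃ B C : Fin 3, B ≠ A ∧ C ≠ A ∧
        B ≠ C ∧ ∃ d d' g g', P B d d' ∧ P C g g' ∧ d < g ∧ g < d' ∧ d' < g' := by
      obtain ⟨e, he, h1, h2⟩ := hC
      obtain ⟨g, g', hg⟩ := horient e he
      rcases hcross _ _ _ _ _ _ hbb hg h2.symm with h3 | h3
      · exact ⟨_, _, hbA, h1, h2.symm, b, b', g, g', hbb, hg, h3⟩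
      · exact ⟨_, _, h1, hbA, h2, g, g', b, b', hg, hbb, h3⟩
    -- The order found for one edge of `B` and one of `C` holds for all of them, since edges of the
    -- same class do not cross.
    have hB : ∀ x y x' y', P B x y → P C x' y' → x < x' ∧ x' < y ∧ y < y' := by
      intro x y x' y' h1 h2
      have k1 := hcross _ _ _ _ _ _ h1 h2 hBC
      have k2 := hcross _ _ _ _ _ _ hd h2 hBC
      have k3 := hcross _ _ _ _ _ _ h1 hg hBC
      have k4 := hnc _ _ _ _ _ h1 hd
      have k5 := hnc _ _ _ _ _ h2 hg
      have k6 := hA _ _ _ _ _ hPz h1 hBA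
      have k7 := hA _ _ _ _ _ hPz h2 hCA
      have k8 := hA _ _ _ _ _ hPz hd hBA
      have k9 := hA _ _ _ _ _ hPz hg hCA
      simp only [Fin.lt_def] at *
      omega
    have hall : ∀ i j k l : Fin 3, j ≠ i → k ≠ i → j ≠ k → l = i ∨ l = j ∨ l = k := by decide
    obtain ⟨s, e, hF⟩ := exists_frame_of_classes (m := 3) (Or.inr rfl) cl hcl
      (fun t => if t = 0 then A else if t = 1 then B else C) (fun t ht => by
        interval_cases t
        · exact ⟨_, _, hPz⟩
        · exact ⟨_, _, hd⟩
        · exact ⟨_, _, hg⟩) (fun e _ => by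
        rcases hall A B C (cl e) hBA hCA hBC with h | h | h
        · exact ⟨0, by norm_num, h⟩
        · exact ⟨1, by norm_num, h⟩
        · exact ⟨2, by norm_num, h⟩) (fun t t' htt ht x y x' y' h1 h2 h3 h4 h5 h6 => by
        interval_cases t'
        · omega
        · obtain rfl : t = 0 := by omega
          exact hA _ _ _ _ _ ⟨h1, h2, h3⟩ ⟨h4, h5, h6⟩ hBA
        · interval_cases t
          · exact hA _ _ _ _ _ ⟨h1, h2, h3⟩ ⟨h4, h5, h6⟩ hCA
          · exact hB _ _ _ _ ⟨h1, h2, h3⟩ ⟨h4, h5, h6⟩) hnest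
    exact ⟨3, s, e, hF⟩
  · -- two classes
    push Not at hC
    obtain ⟨s, e, hF⟩ := exists_frame_of_classes (m := 2) (Or.inl rfl) cl hcl
      (fun t => if t = 0 then A else cl s(b, b')) (fun t ht => by
        interval_cases t
        · exact ⟨_, _, hPz⟩
        · exact ⟨_, _, hbb⟩) (fun e he => by
        by_cases h : cl e = A
        · exact ⟨0, by norm_num, h⟩
        · exact ⟨1, by norm_num, hC e he h⟩) (fun t t' htt ht x y x' y' h1 h2 h3 h4 h5 h6 => by
        obtain rfl : t = 0 := by omega
        obtain rfl : t' = 1 := by omega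
        exact hA _ _ _ _ _ ⟨h1, h2, h3⟩ ⟨h4, h5, h6⟩ hbA) hnest
    exact ⟨2, s, e, hF⟩

end Frames

end CircleTree

namespace CircleTree

open SimpleGraph

/-! ### Chords, parallel classes and linking inside a class -/

section Structure

variable {n m : ℕ} {T : SimpleGraph (Fin n)} {s e : ℕ → Fin n}

theorem reachable_induction {V : Type*} {G : SimpleGraph V} {P : V → Prop} {u v : V}
    (h : G.Reachable u v) (hstep : ∀ x y, G.Adj x y → P x → P y) (hu : P u) : P v := by
  obtain ⟨p⟩ := h
  induction p with
  | nil => exact hu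
  | cons hadj p ih => exact ih (hstep _ _ hadj hu)

/-- A connected graph has an edge leaving every set that contains `u` and not `v`. -/
theorem exists_adj_of_reachable {V : Type*} {G : SimpleGraph V} {P : V → Prop} {u v : V}
    (h : G.Reachable u v) (hu : P u) (hv : ¬ P v) : ∃ x y, G.Adj x y ∧ P x ∧ ¬ P y := by
  by_contra hno
  push Not at hno
  exact hv (reachable_induction h hno hu)

/-- The point `x` lies in the block `t`. -/
def InBlock (s e : ℕ → Fin n) (t : ℕ) (x : Fin n) : Prop := s t ≤ x ∧ x ≤ e t

/-- `xy` is an edge from the block `t` to the opposite block. -/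
def Chord (T : SimpleGraph (Fin n)) (m : ℕ) (s e : ℕ → Fin n) (t : ℕ) (x y : Fin n) : Prop :=
  T.Adj x y ∧ InBlock s e t x ∧ InBlock s e (t + m) y

/-- The uncrossed edges and the edges between the block `t` and the opposite block. -/
def classGraph (T : SimpleGraph (Fin n)) (m : ℕ) (s e : ℕ → Fin n) (t : ℕ) :
    SimpleGraph (Fin n) where
  Adj x y := T.Adj x y ∧ (Uncrossed T s(x, y) ∨ Chord T m s e t x y ∨ Chord T m s e t y x)
  symm := ⟨fun x y h => ⟨h.1.symm, by rw [Sym2.eq_swap]; exact h.2.imp id Or.symm⟩⟩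
  loopless := ⟨fun _ h => h.1.ne rfl⟩

/-- The uncrossed edges. -/
def uncrossedGraph (T : SimpleGraph (Fin n)) : SimpleGraph (Fin n) where
  Adj x y := T.Adj x y ∧ Uncrossed T s(x, y)
  symm := ⟨fun x y h => ⟨h.1.symm, by rw [Sym2.eq_swap]; exact h.2⟩⟩
  loopless := ⟨fun _ h => h.1.ne rfl⟩

theorem uncrossed_or_crossed {f : Sym2 (Fin n)} (hf : f ∈ T.edgeSet) :
    Uncrossed T f ∨ Crossed T f := by
  by_cases h : ∃ g ∈ T.edgeSet, Cross f g
  · exact Or.inr ⟨hf, h⟩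
  · push Not at h
    exact Or.inl ⟨hf, h⟩

theorem uncrossedGraph_le_classGraph (t : ℕ) : uncrossedGraph T ≤ classGraph T m s e t :=
  fun _ _ h => ⟨h.1, Or.inl h.2⟩

theorem classGraph_le (t : ℕ) : classGraph T m s e t ≤ T := fun _ _ h => h.1

theorem Chord.classGraph_adj {t : ℕ} {x y : Fin n} (h : Chord T m s e t x y) :
    (classGraph T m s e t).Adj x y := ⟨h.1, Or.inr (Or.inl h)⟩

theorem Chord.reachable {t : ℕ} {x y : Fin n} (h : Chord T m s e t x y) :
    (classGraph T m s e t).Reachable x y := h.classGraph_adj.reachable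

namespace Frame

theorem two_le (F : Frame T m s e) : 2 ≤ m := by
  rcases F.m_eq with h | h <;> omega

theorem s_mod (F : Frame T m s e) (t : ℕ) : s (t % (2 * m)) = s t := by
  conv_rhs => rw [← Nat.mod_add_div t (2 * m)]
  induction t / (2 * m) with
  | zero => simp
  | succ k ih => rw [Nat.mul_succ, ← add_assoc, F.per_s, ← ih]

theorem e_mod (F : Frame T m s e) (t : ℕ) : e (t % (2 * m)) = e t := by
  conv_rhs => rw [← Nat.mod_add_div t (2 * m)]
  induction t / (2 * m) with
  | zero => simp
  | succ k ih => rw [Nat.mul_succ, ← add_assoc, F.per_e, ← ih]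

theorem s_congr (F : Frame T m s e) {t t' : ℕ} (h : t % (2 * m) = t' % (2 * m)) : s t = s t' := by
  rw [← F.s_mod, h, F.s_mod]

theorem e_congr (F : Frame T m s e) {t t' : ℕ} (h : t % (2 * m) = t' % (2 * m)) : e t = e t' := by
  rw [← F.e_mod, h, F.e_mod]

theorem inBlock_congr (F : Frame T m s e) {t t' : ℕ} (h : t % (2 * m) = t' % (2 * m)) :
    InBlock s e t = InBlock s e t' := by
  unfold InBlock
  rw [F.s_congr h, F.e_congr h]

theorem chord_congr (F : Frame T m s e) {t t' : ℕ} (h : t % (2 * m) = t' % (2 * m)) :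
    Chord T m s e t = Chord T m s e t' := by
  unfold Chord
  rw [F.inBlock_congr h, F.inBlock_congr (Nat.ModEq.add_right m h)]

theorem chord_swap (F : Frame T m s e) {t : ℕ} {x y : Fin n} :
    Chord T m s e (t + m) y x ↔ Chord T m s e t x y := by
  have h : InBlock s e (t + m + m) = InBlock s e t := F.inBlock_congr (by
    rw [show t + m + m = t + 2 * m by ring, Nat.add_mod_right])
  unfold Chord
  rw [h, T.adj_comm]
  exact and_congr Iff.rfl and_comm

/-- A chord of the class of `t` in one of the two directions. -/
theorem chord_of_mod_eq (F : Frame T m s e) {t t' : ℕ} (h : t % m = t' % m) {x y : Fin n}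
    (hc : Chord T m s e t x y) : Chord T m s e t' x y ∨ Chord T m s e t' y x := by
  have : t % (2 * m) = t' % (2 * m) ∨ (t' + m) % (2 * m) = t % (2 * m) := by
    rcases F.m_eq with rfl | rfl <;> omega
  rcases this with h1 | h1
  · rw [F.chord_congr h1] at hc
    exact Or.inl hc
  · rw [← F.chord_congr h1, F.chord_swap] at hc
    exact Or.inr hc

theorem classGraph_congr (F : Frame T m s e) {t t' : ℕ} (h : t % m = t' % m) :
    classGraph T m s e t = classGraph T m s e t' := by
  have key : ∀ {t t' : ℕ}, t % m = t' % m → classGraph T m s e t ≤ classGraph T m s e t' := by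
    rintro t t' h x y ⟨h1, h2 | h2 | h2⟩
    · exact ⟨h1, Or.inl h2⟩
    · exact ⟨h1, Or.inr (F.chord_of_mod_eq h h2)⟩
    · exact ⟨h1, Or.inr (F.chord_of_mod_eq h h2).symm⟩
  exact le_antisymm (key h) (key h.symm)

theorem classGraph_add (F : Frame T m s e) (t : ℕ) :
    classGraph T m s e (t + m) = classGraph T m s e t := F.classGraph_congr (Nat.add_mod_right _ _)

theorem chord_start (F : Frame T m s e) (t : ℕ) : Chord T m s e t (s t) (e (t + m)) :=
  ⟨F.adj t, ⟨le_rfl, F.le t⟩, ⟨F.le _, le_rfl⟩⟩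

theorem chord_end (F : Frame T m s e) (t : ℕ) : Chord T m s e t (e t) (s (t + m)) := by
  rw [← F.chord_swap]
  have h := F.chord_start (t + m)
  rwa [show t + m + m = t + 2 * m by ring, F.per_e] at h

theorem mod_eq_of_inBlock (F : Frame T m s e) {i j : ℕ} {x : Fin n} (hi : InBlock s e i x)
    (hj : InBlock s e j x) : i % (2 * m) = j % (2 * m) := by
  have hpos : 0 < 2 * m := by have := F.two_le; omega
  rw [← F.inBlock_congr (Nat.mod_mod i (2 * m))] at hi
  rw [← F.inBlock_congr (Nat.mod_mod j (2 * m))] at hj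
  rcases lt_trichotomy (i % (2 * m)) (j % (2 * m)) with h | h | h
  · exact absurd (hi.2.trans_lt (F.lt _ _ h (Nat.mod_lt _ hpos))) (not_lt.2 hj.1)
  · exact h
  · exact absurd (hj.2.trans_lt (F.lt _ _ h (Nat.mod_lt _ hpos))) (not_lt.2 hi.1)

theorem cov' (F : Frame T m s e) {x y : Fin n} (h : Crossed T s(x, y)) :
    ∃ t, Chord T m s e t x y := by
  obtain ⟨t, -, h1, h2⟩ := F.cov x y h
  exact ⟨t, h.1, h1, h2⟩

theorem chord_norm (F : Frame T m s e) {t : ℕ} {x y : Fin n} (h : Chord T m s e t x y) :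
    Chord T m s e (t % m) x y ∨ Chord T m s e (t % m) y x :=
  F.chord_of_mod_eq (Nat.mod_mod _ _).symm h

/-- The blocks occur in the order `t`, `t'`, `t + m`, `t' + m`, so the endpoints alternate. -/
theorem cross_of_lt (F : Frame T m s e) {t t' : ℕ} (h1 : t < t') (h2 : t' < m) {x y x' y' : Fin n}
    (hc : Chord T m s e t x y) (hc' : Chord T m s e t' x' y') : Cross s(x, y) s(x', y') := by
  obtain ⟨-, ⟨-, a1⟩, ⟨a2, a3⟩⟩ := hc
  obtain ⟨-, ⟨b1, b2⟩, ⟨b3, -⟩⟩ := hc'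
  exact ⟨x, x', y, y', a1.trans_lt ((F.lt _ _ h1 (by omega)).trans_le b1),
    b2.trans_lt ((F.lt t' (t + m) (by omega) (by omega)).trans_le a2),
    a3.trans_lt ((F.lt _ _ (by omega) (by omega)).trans_le b3), Or.inl ⟨rfl, rfl⟩⟩

theorem cross_of_mod_ne (F : Frame T m s e) {t t' : ℕ} (h : t % m ≠ t' % m) {x y x' y' : Fin n}
    (hc : Chord T m s e t x y) (hc' : Chord T m s e t' x' y') : Cross s(x, y) s(x', y') := by
  have hm : 0 < m := by have := F.two_le; omega
  have key : ∀ {t t' : ℕ} {x y x' y' : Fin n}, t % m < t' % m → Chord T m s e t x y →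
      Chord T m s e t' x' y' → Cross s(x, y) s(x', y') := by
    intro t t' x y x' y' h hc hc'
    have hl := Nat.mod_lt t' hm
    rcases F.chord_norm hc with h1 | h1 <;> rcases F.chord_norm hc' with h2 | h2
    · exact F.cross_of_lt h hl h1 h2
    · rw [Sym2.eq_swap (a := x')]
      exact F.cross_of_lt h hl h1 h2
    · rw [Sym2.eq_swap (a := x)]
      exact F.cross_of_lt h hl h1 h2
    · rw [Sym2.eq_swap (a := x), Sym2.eq_swap (a := x')]
      exact F.cross_of_lt h hl h1 h2
  rcases lt_or_gt_of_ne h with h1 | h1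
  · exact key h1 hc hc'
  · exact (cross_comm _ _).1 (key h1 hc' hc)

theorem not_cross_of_chord (F : Frame T m s e) {t : ℕ} {x y x' y' : Fin n}
    (hc : Chord T m s e t x y) (hc' : Chord T m s e t x' y') : ¬ Cross s(x, y) s(x', y') :=
  F.nest t x y x' y' hc.1 hc'.1 hc.2.1 hc.2.2 hc'.2.1 hc'.2.2

theorem cross_iff (F : Frame T m s e) {t t' : ℕ} {x y x' y' : Fin n}
    (hc : Chord T m s e t x y) (hc' : Chord T m s e t' x' y') :
    Cross s(x, y) s(x', y') ↔ t % m ≠ t' % m := by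
  refine ⟨fun h h1 => ?_, fun h => F.cross_of_mod_ne h hc hc'⟩
  rcases F.chord_of_mod_eq h1.symm hc' with h2 | h2
  · exact F.not_cross_of_chord hc h2 h
  · rw [Sym2.eq_swap (a := x')] at h
    exact F.not_cross_of_chord hc h2 h

theorem succ_mod_ne (F : Frame T m s e) (t : ℕ) : t % m ≠ (t + 1) % m := by
  rcases F.m_eq with rfl | rfl <;> omega

theorem crossed_of_chord (F : Frame T m s e) {t : ℕ} {x y : Fin n} (hc : Chord T m s e t x y) :
    Crossed T s(x, y) :=
  ⟨hc.1, _, F.adj (t + 1), F.cross_of_mod_ne (F.succ_mod_ne t) hc (F.chord_start (t + 1))⟩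

/-- The class is the residue modulo `m`. It is well defined because chords with different residues
cross and no edge crosses itself. -/
theorem isMultipartite (F : Frame T m s e) : IsMultipartite T := by
  have hm := F.two_le
  refine ⟨⟨_, F.adj 0, _, F.adj 1, F.cross_of_mod_ne (F.succ_mod_ne 0) (F.chord_start 0)
    (F.chord_start 1)⟩, ?_⟩
  have hex : ∀ f : Sym2 (Fin n), ∃ c : Fin 3, ∀ t x y, f = s(x, y) → Chord T m s e t x y →
      (c : ℕ) = t % m := by
    intro f
    by_cases hf : ∃ t x y, f = s(x, y) ∧ Chord T m s e t x y
    · obtain ⟨t, x, y, rfl, hc⟩ := hf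
      have h3 : t % m < 3 := by rcases F.m_eq with rfl | rfl <;> omega
      refine ⟨⟨t % m, h3⟩, fun t' x' y' h hc' => ?_⟩
      by_contra hne
      have := F.cross_of_mod_ne hne hc hc'
      rw [h] at this
      exact cross_irrefl _ this
    · exact ⟨0, fun t x y h hc => absurd ⟨t, x, y, h, hc⟩ hf⟩
  choose cl hcl using hex
  refine ⟨cl, fun f g hf hg => ?_⟩
  induction f with
  | _ x y =>
  induction g with
  | _ x' y' =>
  obtain ⟨t, ht⟩ := F.cov' hf
  obtain ⟨t', ht'⟩ := F.cov' hg
  rw [F.cross_iff ht ht', Ne, Ne, Fin.ext_iff, hcl _ t x y rfl ht, hcl _ t' x' y' rfl ht']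

theorem mod_eq_of_chord (F : Frame T m s e) {t t' : ℕ} {x y x' y' : Fin n}
    (hc : Chord T m s e t x y) (hc' : Chord T m s e t' x' y') (h : s(x, y) = s(x', y')) :
    t % m = t' % m := by
  by_contra hne
  have := F.cross_of_mod_ne hne hc hc'
  rw [h] at this
  exact cross_irrefl _ this

/-- A parallel edge is crossed, hence a chord of some class. In a different class it would cross the
given chord, and by parallelism itself. -/
theorem parallel_iff (F : Frame T m s e) {t : ℕ} {x y : Fin n} (hc : Chord T m s e t x y)
    (f : Sym2 (Fin n)) :
    Parallel T s(x, y) f ↔ ∃ x' y', f = s(x', y') ∧ Chord T m s e t x' y' := by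
  constructor
  · rintro ⟨h1, h2, h3⟩
    have h4 : Crossed T f := by
      obtain ⟨-, g, hg, hg'⟩ := F.crossed_of_chord hc
      exact ⟨h2, g, hg, (h3 g hg).1 hg'⟩
    induction f with
    | _ x' y' =>
    obtain ⟨t', ht'⟩ := F.cov' h4
    by_cases hmod : t' % m = t % m
    · rcases F.chord_of_mod_eq hmod ht' with h5 | h5
      · exact ⟨_, _, rfl, h5⟩
      · exact ⟨_, _, Sym2.eq_swap, h5⟩
    · exact absurd ((h3 _ h2).1 (F.cross_of_mod_ne (Ne.symm hmod) hc ht')) (cross_irrefl _)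
  · rintro ⟨x', y', rfl, hc'⟩
    refine ⟨hc.1, hc'.1, fun g hg => ?_⟩
    have key : ∀ {x y x' y'}, Chord T m s e t x y → Chord T m s e t x' y' → Cross s(x, y) g →
        Cross s(x', y') g := by
      intro x y x' y' hc hc' h
      have h1 : Crossed T g := ⟨hg, _, hc.1, (cross_comm _ _).1 h⟩
      induction g with
      | _ a b =>
      obtain ⟨t', ht'⟩ := F.cov' h1
      rw [F.cross_iff hc ht'] at h
      exact F.cross_of_mod_ne h hc' ht'
    exact ⟨key hc hc', key hc' hc⟩

/-- Chords serve as fences for all paths that may be used for linking within their class. -/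
theorem not_cross_of_classGraph_adj (F : Frame T m s e) {t : ℕ} {x y z w : Fin n}
    (hc : Chord T m s e t x y) (h : (classGraph T m s e t).Adj z w) : ¬ Cross s(x, y) s(z, w) := by
  rcases h with ⟨-, h | h | h⟩
  · exact fun h1 => h.2 _ hc.1 ((cross_comm _ _).1 h1)
  · exact F.not_cross_of_chord hc h
  · rw [Sym2.eq_swap (a := z)]
    exact F.not_cross_of_chord hc h

theorem mem_classGraph_edgeSet_iff (F : Frame T m s e) {t : ℕ} {x y : Fin n}
    (hc : Chord T m s e t x y) (b : Sym2 (Fin n)) :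
    b ∈ (classGraph T m s e t).edgeSet ↔ Uncrossed T b ∨ Parallel T s(x, y) b := by
  rw [F.parallel_iff hc]
  induction b with
  | _ z w =>
  constructor
  · rintro ⟨-, h | h | h⟩
    · exact Or.inl h
    · exact Or.inr ⟨_, _, rfl, h⟩
    · exact Or.inr ⟨_, _, Sym2.eq_swap, h⟩
  · rintro (h | ⟨x', y', h, hc'⟩)
    · exact ⟨h.1, Or.inl h⟩
    · rw [h]
      exact hc'.classGraph_adj

end Frame

theorem mem_of_head?_edges {V : Type*} {G : SimpleGraph V} {u v : V} (p : G.Walk u v) {f : Sym2 V}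
    (h : p.edges.head? = some f) : u ∈ f := by
  cases p with
  | nil => simp at h
  | cons hadj p =>
    rw [Walk.edges_cons, List.head?_cons, Option.some_inj] at h
    rw [← h]
    exact Sym2.mem_mk_left _ _

theorem mem_of_getLast?_edges {V : Type*} {G : SimpleGraph V} {u v : V} (p : G.Walk u v)
    {f : Sym2 V} (h : p.edges.getLast? = some f) : v ∈ f := by
  apply mem_of_head?_edges p.reverse
  rw [Walk.edges_reverse, List.head?_reverse, h]

namespace Frame

/-- Parallel edges are linked exactly when they are joined by uncrossed and parallel edges. -/
theorem linked_iff (F : Frame T m s e) {t : ℕ} {x y x' y' : Fin n} (hc : Chord T m s e t x y)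
    (hc' : Chord T m s e t x' y') :
    Linked T s(x, y) s(x', y') ↔ (classGraph T m s e t).Reachable x x' := by
  constructor
  · rintro ⟨u, v, p, h1, h2, h3⟩
    have h4 : (classGraph T m s e t).Reachable u v :=
      ⟨p.transfer _ fun b hb => (F.mem_classGraph_edgeSet_iff hc b).2 (h3 b hb)⟩
    have h5 : (classGraph T m s e t).Reachable x u := by
      rcases Sym2.mem_iff.1 (mem_of_head?_edges p h1) with rfl | rfl
      · exact Reachable.refl _
      · exact hc.reachable
    have h6 : (classGraph T m s e t).Reachable v x' := by
      rcases Sym2.mem_iff.1 (mem_of_getLast?_edges p h2) with rfl | rfl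
      · exact Reachable.refl _
      · exact hc'.reachable.symm
    exact h5.trans (h4.trans h6)
  · rintro ⟨q⟩
    -- The walk has to begin with the first chord and to end with the second, so it is extended at
    -- both ends to the opposite endpoints.
    let p : (classGraph T m s e t).Walk y y' := .cons hc.classGraph_adj.symm (q.concat hc'.classGraph_adj)
    refine ⟨y, y', p.mapLe (classGraph_le t), ?_, ?_, ?_⟩
    · rw [Walk.edges_mapLe_eq_edges, Walk.edges_cons, List.head?_cons, Sym2.eq_swap]
    · rw [Walk.edges_mapLe_eq_edges, Walk.edges_cons, Walk.edges_concat, List.concat_eq_append,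
        List.getLast?_cons, List.getLast?_append]
      rfl
    · intro b hb
      rw [Walk.edges_mapLe_eq_edges] at hb
      exact (F.mem_classGraph_edgeSet_iff hc b).1 (p.edges_subset_edgeSet hb)

theorem mem_linkedParallels_iff (F : Frame T m s e) {t : ℕ} {x y : Fin n}
    (hc : Chord T m s e t x y) (f : Sym2 (Fin n)) : f ∈ linkedParallels T s(x, y) ↔
      ∃ x' y', f = s(x', y') ∧ Chord T m s e t x' y' ∧ (classGraph T m s e t).Reachable x x' := by
  change _ ∧ _ ↔ _
  rw [F.parallel_iff hc]
  constructor
  · rintro ⟨⟨x', y', rfl, hc'⟩, h⟩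
    exact ⟨x', y', rfl, hc', (F.linked_iff hc hc').1 h⟩
  · rintro ⟨x', y', rfl, hc', h⟩
    exact ⟨⟨x', y', rfl, hc'⟩, (F.linked_iff hc hc').2 h⟩

end Frame

theorem onArc_iff_of_le {a b : Fin n} (h : a ≤ b) (x : Fin n) : OnArc a b x ↔ a ≤ x ∧ x ≤ b := by
  unfold OnArc
  have h1 := fin_val_sub_cases x a
  have h2 := fin_val_sub_cases b a
  have h3 := x.isLt
  have h4 := b.isLt
  rw [Fin.le_def] at *
  rw [Fin.le_def, Fin.le_def]
  omega

theorem onArc_iff_of_lt {a b : Fin n} (h : b < a) (x : Fin n) : OnArc a b x ↔ a ≤ x ∨ x ≤ b := by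
  unfold OnArc
  have h1 := fin_val_sub_cases x a
  have h2 := fin_val_sub_cases b a
  have h3 := x.isLt
  have h4 := b.isLt
  rw [Fin.lt_def] at h
  rw [Fin.le_def, Fin.le_def, Fin.le_def]
  omega

/-- The four cases tell between which two successive points the labelling begins. -/
theorem inOrder_iff (a b c d : Fin n) : InOrder a b c d ↔
    (a ≤ b ∧ b ≤ c ∧ c ≤ d) ∨ (d < a ∧ a ≤ b ∧ b ≤ c) ∨ (c ≤ d ∧ d < a ∧ a ≤ b) ∨
      (b ≤ c ∧ c ≤ d ∧ d < a) := by
  unfold InOrder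
  have h1 := fin_val_sub_cases b a
  have h2 := fin_val_sub_cases c a
  have h3 := fin_val_sub_cases d a
  have l1 := b.isLt
  have l2 := c.isLt
  have l3 := d.isLt
  simp only [Fin.le_def, Fin.lt_def] at *
  omega

end Structure

end CircleTree

namespace CircleTree

open SimpleGraph

/-! ### The e-graphs of a class and the selected edges -/

section Groups

variable {n m : ℕ} {T : SimpleGraph (Fin n)} {s e : ℕ → Fin n}

/-- `a ≤ b` and `c ≤ d` bound the two arcs of the e-graph containing the chord `xy`. -/
structure GroupArcs (T : SimpleGraph (Fin n)) (m : ℕ) (s e : ℕ → Fin n) (t : ℕ) (x y a b c d : Fin n) :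
    Prop where
  bounds : ∀ x' y', Chord T m s e t x' y' → (classGraph T m s e t).Reachable x x' →
    (a ≤ x' ∧ x' ≤ b) ∧ (c ≤ y' ∧ y' ≤ d)
  chord_ad : Chord T m s e t a d
  chord_bc : Chord T m s e t b c
  reach_a : (classGraph T m s e t).Reachable x a
  reach_b : (classGraph T m s e t).Reachable x b
  outermost : ∀ C D E F, Outermost (linkedParallels T s(x, y)) C D E F ↔
    (D = a ∧ E = b ∧ F = c ∧ C = d) ∨ (D = c ∧ E = d ∧ F = a ∧ C = b)

namespace Frame

theorem chord_lt (F : Frame T m s e) {t : ℕ} (ht : t < m) {x y : Fin n}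
    (hc : Chord T m s e t x y) : x < y :=
  hc.2.1.2.trans_lt ((F.lt t (t + m) (by have := F.two_le; omega) (by omega)).trans_le hc.2.2.1)

/-- The linked chords of a class are nested, so one of them is outermost and one innermost, and the
other chords join the two arcs that these cut out. Any other admissible quadruple must enclose both
extreme chords and hence names the same two edges, possibly exchanged. -/
theorem exists_groupArcs_of_lt (F : Frame T m s e) {t : ℕ} (ht : t < m) {x y : Fin n}
    (hc : Chord T m s e t x y) : ∃ a b c d, GroupArcs T m s e t x y a b c d := by
  let P : Fin n → Fin n → Prop := fun x' y' =>
    Chord T m s e t x' y' ∧ (classGraph T m s e t).Reachable x x'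
  have hP : P x y := ⟨hc, Reachable.refl _⟩
  have hlr : ∀ {x y x' y'}, Chord T m s e t x y → Chord T m s e t x' y' → x < y' := by
    intro x y x' y' h h'
    exact h.2.1.2.trans_lt ((F.lt t (t + m) (by have := F.two_le; omega) (by omega)).trans_le h'.2.2.1)
  have hnest : ∀ x y x' y', P x y → P x' y' → (x ≤ x' ∧ y' ≤ y) ∨ (x' ≤ x ∧ y ≤ y') := by
    rintro x y x' y' ⟨h1, -⟩ ⟨h2, -⟩
    have h3 := F.not_cross_of_chord h1 h2
    rw [cross_iff_of_lt_lt (F.chord_lt ht h1) (F.chord_lt ht h2)] at h3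
    have h4 := hlr h1 h2
    have h5 := hlr h2 h1
    simp only [Fin.lt_def, Fin.le_def] at *
    omega
  obtain ⟨a, d, hadP, had⟩ := exists_outer ⟨x, y, hP⟩ hnest
  obtain ⟨b, c, hbcP, hbc⟩ := exists_inner ⟨x, y, hP⟩ hnest
  have hab := (had _ _ hbcP).1
  have hcd := (had _ _ hbcP).2
  have hbc' : b < c := F.chord_lt ht hbcP.1
  have hadS : s(a, d) ∈ linkedParallels T s(x, y) :=
    (F.mem_linkedParallels_iff hc _).2 ⟨a, d, rfl, hadP⟩
  have hbcS : s(b, c) ∈ linkedParallels T s(x, y) :=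
    (F.mem_linkedParallels_iff hc _).2 ⟨b, c, rfl, hbcP⟩
  refine ⟨a, b, c, d, ⟨fun x' y' h1 h2 => ?_, hadP.1, hbcP.1, hadP.2, hbcP.2, ?_⟩⟩
  · exact ⟨⟨(had _ _ ⟨h1, h2⟩).1, (hbc _ _ ⟨h1, h2⟩).1⟩, (hbc _ _ ⟨h1, h2⟩).2, (had _ _ ⟨h1, h2⟩).2⟩
  · intro C D E F'
    constructor
    · rintro ⟨h1, h2, h3, h4⟩
      obtain ⟨x₁, y₁, h5, h6⟩ := (F.mem_linkedParallels_iff hc _).1 h1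
      obtain ⟨x₂, y₂, h7, h8⟩ := (F.mem_linkedParallels_iff hc _).1 h2
      obtain ⟨x₃, y₃, h9, h10, h11⟩ := h4 _ hadS
      obtain ⟨x₄, y₄, h12, h13, h14⟩ := h4 _ hbcS
      have k1 := had _ _ h6
      have k2 := hbc _ _ h6
      have k3 := had _ _ h8
      have k4 := hbc _ _ h8
      rw [inOrder_iff] at h3
      rw [Sym2.eq_iff] at h5 h7 h9 h12
      have arc : ∀ p q r : Fin n, OnArc p q r →
          (p ≤ q ∧ p ≤ r ∧ r ≤ q) ∨ (q < p ∧ (p ≤ r ∨ r ≤ q)) := by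
        intro p q r h
        rcases le_or_gt p q with h' | h'
        · exact Or.inl ⟨h', (onArc_iff_of_le h' r).1 h⟩
        · exact Or.inr ⟨h', (onArc_iff_of_lt h' r).1 h⟩
      replace h10 := arc _ _ _ h10
      replace h11 := arc _ _ _ h11
      replace h13 := arc _ _ _ h13
      replace h14 := arc _ _ _ h14
      clear arc h4 had hbc hnest hlr h1 h2 hadS hbcS hadP hbcP hP
      simp only [Fin.ext_iff, Fin.lt_def, Fin.le_def] at *
      -- The cyclic order excludes `D` and `E` on different sides of the class. The two remaining
      -- cases are the two namings of the extreme chords.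
      rcases h5 with ⟨h5, h5'⟩ | ⟨h5, h5'⟩ <;> rcases h7 with ⟨h7, h7'⟩ | ⟨h7, h7'⟩
      · omega
      · right
        rcases h9 with ⟨h9, h9'⟩ | ⟨h9, h9'⟩ <;> rcases h12 with ⟨h12, h12'⟩ | ⟨h12, h12'⟩ <;> omega
      · left
        rcases h9 with ⟨h9, h9'⟩ | ⟨h9, h9'⟩ <;> rcases h12 with ⟨h12, h12'⟩ | ⟨h12, h12'⟩ <;> omega
      · omega
    · rintro (⟨rfl, rfl, rfl, rfl⟩ | ⟨rfl, rfl, rfl, rfl⟩)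
      · refine ⟨by rw [Sym2.eq_swap (a := C)]; exact hadS, hbcS, (inOrder_iff _ _ _ _).2 (Or.inl ⟨hab, hbc'.le, hcd⟩), ?_⟩
        intro f hf
        obtain ⟨x', y', rfl, h⟩ := (F.mem_linkedParallels_iff hc _).1 hf
        exact ⟨x', y', rfl, (onArc_iff_of_le hab _).2 ⟨(had _ _ h).1, (hbc _ _ h).1⟩,
          (onArc_iff_of_le hcd _).2 ⟨(hbc _ _ h).2, (had _ _ h).2⟩⟩
      · refine ⟨hbcS, by rw [Sym2.eq_swap (a := E)]; exact hadS, (inOrder_iff _ _ _ _).2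
          (Or.inr (Or.inr (Or.inl ⟨hab, hbc', hcd⟩))), ?_⟩
        intro f hf
        obtain ⟨x', y', rfl, h⟩ := (F.mem_linkedParallels_iff hc _).1 hf
        exact ⟨y', x', Sym2.eq_swap, (onArc_iff_of_le hcd _).2 ⟨(hbc _ _ h).2, (had _ _ h).2⟩,
          (onArc_iff_of_le hab _).2 ⟨(had _ _ h).1, (hbc _ _ h).1⟩⟩

/-- An index in the second half of the blocks describes the same class with left and right
exchanged. -/
theorem exists_groupArcs (F : Frame T m s e) {t : ℕ} {x y : Fin n}
    (hc : Chord T m s e t x y) : ∃ a b c d, GroupArcs T m s e t x y a b c d := by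
  have hm := F.two_le
  have hpos : 0 < 2 * m := by omega
  have hl := Nat.mod_lt t hpos
  obtain ⟨r, hr⟩ : ∃ r, r = t % (2 * m) := ⟨_, rfl⟩
  have hmod : r % (2 * m) = t % (2 * m) := by rw [hr, Nat.mod_mod]
  have hmodm : r % m = t % m := by rcases F.m_eq with rfl | rfl <;> omega
  have hch : Chord T m s e r = Chord T m s e t := F.chord_congr hmod
  have hH : classGraph T m s e r = classGraph T m s e t := F.classGraph_congr hmodm
  rcases lt_or_ge r m with h | h
  · rw [← hch] at hc
    obtain ⟨a, b, c, d, h1, h2, h3, h4, h5, h6⟩ := F.exists_groupArcs_of_lt h hc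
    rw [hch, hH] at *
    exact ⟨a, b, c, d, h1, h2, h3, h4, h5, h6⟩
  · obtain ⟨k, rfl⟩ := Nat.exists_eq_add_of_le' h
    rw [← hch, F.chord_swap] at hc
    rw [F.classGraph_add] at hH
    have hsw : ∀ x y, Chord T m s e k x y ↔ Chord T m s e t y x := fun x y => by
      rw [← hch, F.chord_swap]
    obtain ⟨a, b, c, d, h1, h2, h3, h4, h5, h6⟩ := F.exists_groupArcs_of_lt (by omega) hc
    have hxy : (classGraph T m s e t).Reachable y x := hH ▸ hc.reachable
    rw [hsw] at h2 h3 hc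
    rw [hH] at h4 h5
    refine ⟨c, d, a, b, ⟨?_, h3, h2, ?_, ?_, ?_⟩⟩
    · intro x' y' hc' hr'
      have := h1 y' x' ((hsw _ _).2 hc') (by rw [hH]; exact hxy.trans (hr'.trans hc'.reachable))
      exact ⟨this.2, this.1⟩
    · exact hxy.symm.trans (h5.trans h3.reachable.symm)
    · exact hxy.symm.trans (h4.trans h2.reachable.symm)
    · intro C D E F'
      rw [Sym2.eq_swap, h6, or_comm]

/-- A point of a block between two chords of the class is joined to one of them. -/
theorem reachable_of_between (F : Frame T m s e) (hT : T.Connected) {t : ℕ} {x₁ y₁ x₂ y₂ v : Fin n}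
    (h₁ : Chord T m s e t x₁ y₁) (h₂ : Chord T m s e t x₂ y₂) (hv₁ : x₁ ≤ v) (hv₂ : v ≤ x₂) :
    (classGraph T m s e t).Reachable v x₁ ∨ (classGraph T m s e t).Reachable v x₂ := by
  by_contra hno
  push Not at hno
  obtain ⟨hno₁, hno₂⟩ := hno
  have hne : x₁ < v ∧ v < x₂ := by
    refine ⟨lt_of_le_of_ne hv₁ ?_, lt_of_le_of_ne hv₂ ?_⟩
    · rintro rfl
      exact hno₁ (Reachable.refl _)
    · rintro rfl
      exact hno₂ (Reachable.refl _)
  have hord : e t < s (t + m) ∨ e (t + m) < s t := by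
    have hm := F.two_le
    have hl := Nat.mod_lt t (show 0 < 2 * m by omega)
    rcases lt_or_ge (t % (2 * m)) m with h | h
    · left
      rw [← F.e_mod t, ← F.s_congr (show (t % (2 * m) + m) % (2 * m) = (t + m) % (2 * m) by
        rw [Nat.mod_add_mod])]
      exact F.lt _ _ (by omega) (by omega)
    · right
      have h1 : (t + m) % (2 * m) = t % (2 * m) - m := by
        rcases F.m_eq with rfl | rfl <;> omega
      rw [← F.e_mod (t + m), ← F.s_mod t, h1]
      exact F.lt _ _ (by omega) (by omega)
  have hb₁ := h₁.2
  have hb₂ := h₂.2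
  unfold InBlock at hb₁ hb₂
  have hyy : y₂ ≤ y₁ := by
    have := F.not_cross_of_chord h₁ h₂
    rw [cross_mk_iff] at this
    simp only [Fin.lt_def, Fin.le_def] at *
    omega
  -- the points joined to `v` stay strictly between the two chords
  have hinv : ∀ z, (classGraph T m s e t).Reachable v z → (x₁ < z ∧ z < x₂) ∨ (y₂ < z ∧ z < y₁) := by
    intro z hz
    have key : (classGraph T m s e t).Reachable v z ∧
        ((x₁ < z ∧ z < x₂) ∨ (y₂ < z ∧ z < y₁)) := by
      refine reachable_induction (P := fun z => (classGraph T m s e t).Reachable v z ∧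
        ((x₁ < z ∧ z < x₂) ∨ (y₂ < z ∧ z < y₁))) hz ?_ ⟨Reachable.refl _, Or.inl hne⟩
      rintro z w hzw ⟨hz1, hz2⟩
      have hw := hz1.trans hzw.reachable
      refine ⟨hw, ?_⟩
      have n1 : w ≠ x₁ := by rintro rfl; exact hno₁ hw
      have n2 : w ≠ x₂ := by rintro rfl; exact hno₂ hw
      have n3 : w ≠ y₁ := by rintro rfl; exact hno₁ (hw.trans h₁.reachable.symm)
      have n4 : w ≠ y₂ := by rintro rfl; exact hno₂ (hw.trans h₂.reachable.symm)
      have c1 := F.not_cross_of_classGraph_adj h₁ hzw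
      have c2 := F.not_cross_of_classGraph_adj h₂ hzw
      simp only [Fin.lt_def, Fin.le_def, ne_eq, Fin.ext_iff] at *
      rcases hord with hord | hord
      · rw [not_cross_iff_of_lt (Fin.lt_def.2 (by omega))] at c1 c2
        rcases hz2 with hz2 | hz2 <;> omega
      · rw [Sym2.eq_swap, not_cross_iff_of_lt (Fin.lt_def.2 (by omega))] at c1 c2
        rcases hz2 with hz2 | hz2 <;> omega
    exact key.2
  -- By connectedness some edge of `T` leaves the component of `v`. It is uncrossed, or it is a
  -- chord, and a chord at a point of these two blocks belongs to this class. In both cases it does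
  -- not leave the component after all.
  obtain ⟨z, w, hzw, hz, hw⟩ := exists_adj_of_reachable (hT.preconnected v x₁)
    (P := fun z => (classGraph T m s e t).Reachable v z) (Reachable.refl _) hno₁
  apply hw
  refine hz.trans (Adj.reachable (G := classGraph T m s e t) ⟨hzw, ?_⟩)
  rcases uncrossed_or_crossed (show s(z, w) ∈ T.edgeSet from hzw) with h | h
  · exact Or.inl h
  · right
    obtain ⟨t', ht'⟩ := F.cov' h
    have hmod : t' % m = t % m := by
      have hm := F.two_le
      rcases hinv z hz with h3 | h3
      · have h4 : InBlock s e t z := ⟨hb₁.1.1.trans h3.1.le, h3.2.le.trans hb₂.1.2⟩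
        have := F.mod_eq_of_inBlock ht'.2.1 h4
        rcases F.m_eq with rfl | rfl <;> omega
      · have h4 : InBlock s e (t + m) z := ⟨hb₂.2.1.trans h3.1.le, h3.2.le.trans hb₁.2.2⟩
        have := F.mod_eq_of_inBlock ht'.2.1 h4
        rcases F.m_eq with rfl | rfl <;> omega
    exact F.chord_of_mod_eq hmod ht'

/-- Consequently a class has at most two e-graphs, those of its bounding chords. -/
theorem reachable_start_or_end (F : Frame T m s e) (hT : T.Connected) {t : ℕ} {x : Fin n}
    (hx : InBlock s e t x) :
    (classGraph T m s e t).Reachable x (s t) ∨ (classGraph T m s e t).Reachable x (e t) :=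
  F.reachable_of_between hT (F.chord_start t) (F.chord_end t) hx.1 hx.2

end Frame

namespace GroupArcs

variable {t : ℕ} {x y a b c d : Fin n}

theorem le_ab (hc : Chord T m s e t x y) (h : GroupArcs T m s e t x y a b c d) :
    a ≤ b ∧ c ≤ d := by
  have := h.bounds x y hc (Reachable.refl _)
  exact ⟨this.1.1.trans this.1.2, this.2.1.trans this.2.2⟩

theorem onSameArc_iff (hc : Chord T m s e t x y)
    (h : GroupArcs T m s e t x y a b c d) (p q : Fin n) : OnSameArc T s(x, y) p q ↔
      ((a ≤ p ∧ p ≤ b) ∧ (a ≤ q ∧ q ≤ b)) ∨ ((c ≤ p ∧ p ≤ d) ∧ (c ≤ q ∧ q ≤ d)) := by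
  obtain ⟨hab, hcd⟩ := h.le_ab hc
  unfold OnSameArc
  simp only [h.outermost]
  constructor
  · rintro ⟨C, D, E, F', ⟨rfl, rfl, rfl, rfl⟩ | ⟨rfl, rfl, rfl, rfl⟩, h1, h2⟩
    · exact Or.inl ⟨(onArc_iff_of_le hab _).1 h1, (onArc_iff_of_le hab _).1 h2⟩
    · exact Or.inr ⟨(onArc_iff_of_le hcd _).1 h1, (onArc_iff_of_le hcd _).1 h2⟩
  · rintro (⟨h1, h2⟩ | ⟨h1, h2⟩)
    · exact ⟨d, a, b, c, Or.inl ⟨rfl, rfl, rfl, rfl⟩, (onArc_iff_of_le hab _).2 h1,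
        (onArc_iff_of_le hab _).2 h2⟩
    · exact ⟨b, c, d, a, Or.inr ⟨rfl, rfl, rfl, rfl⟩, (onArc_iff_of_le hcd _).2 h1,
        (onArc_iff_of_le hcd _).2 h2⟩

theorem mem_eGraph_iff (hc : Chord T m s e t x y)
    (h : GroupArcs T m s e t x y a b c d) (f : Sym2 (Fin n)) : f ∈ eGraph T s(x, y) ↔
      (Uncrossed T f ∨ Parallel T s(x, y) f) ∧ ∀ z ∈ f, (a ≤ z ∧ z ≤ b) ∨ (c ≤ z ∧ z ≤ d) := by
  obtain ⟨hab, hcd⟩ := h.le_ab hc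
  change (_ ∧ ∃ C D E F', _) ↔ _
  simp only [h.outermost]
  refine and_congr Iff.rfl ?_
  constructor
  · rintro ⟨C, D, E, F', ⟨rfl, rfl, rfl, rfl⟩ | ⟨rfl, rfl, rfl, rfl⟩, h1⟩ z hz
    · have := h1 z hz
      rwa [onArc_iff_of_le hab, onArc_iff_of_le hcd] at this
    · have := h1 z hz
      rw [onArc_iff_of_le hab, onArc_iff_of_le hcd] at this
      exact this.symm
  · intro h1
    refine ⟨d, a, b, c, Or.inl ⟨rfl, rfl, rfl, rfl⟩, fun z hz => ?_⟩
    rw [onArc_iff_of_le hab, onArc_iff_of_le hcd]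
    exact h1 z hz

end GroupArcs

namespace Frame

/-- The arcs of an e-graph are bounded by two chords joined to each other, so every point on them is
joined to the e-graph. This identifies e-graphs of a class with components of `classGraph` that
contain chords. -/
theorem mem_eGraphPoints (F : Frame T m s e) (hT : T.Connected) {t : ℕ} {x y z : Fin n}
    (hc : Chord T m s e t x y) (hz : z ∈ eGraphPoints T s(x, y)) :
    (InBlock s e t z ∨ InBlock s e (t + m) z) ∧ (classGraph T m s e t).Reachable x z := by
  obtain ⟨a, b, c, d, h⟩ := F.exists_groupArcs hc
  obtain ⟨f, hf, hzf⟩ := hz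
  rw [h.mem_eGraph_iff hc] at hf
  rcases hf.2 z hzf with h1 | h1
  · refine ⟨Or.inl ⟨h.chord_ad.2.1.1.trans h1.1, h1.2.trans h.chord_bc.2.1.2⟩, ?_⟩
    rcases F.reachable_of_between hT h.chord_ad h.chord_bc h1.1 h1.2 with h2 | h2
    · exact h.reach_a.trans h2.symm
    · exact h.reach_b.trans h2.symm
  · refine ⟨Or.inr ⟨h.chord_bc.2.2.1.trans h1.1, h1.2.trans h.chord_ad.2.2.2⟩, ?_⟩
    have := F.reachable_of_between hT (F.chord_swap.2 h.chord_bc) (F.chord_swap.2 h.chord_ad)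
      h1.1 h1.2
    rw [F.classGraph_add] at this
    rcases this with h2 | h2
    · exact h.reach_b.trans (h.chord_bc.reachable.trans h2.symm)
    · exact h.reach_a.trans (h.chord_ad.reachable.trans h2.symm)

theorem chord_mem_eGraph_iff (F : Frame T m s e) (hT : T.Connected) {t : ℕ} {x y x' y' : Fin n}
    (hc : Chord T m s e t x y) (hc' : Chord T m s e t x' y') :
    s(x', y') ∈ eGraph T s(x, y) ↔ (classGraph T m s e t).Reachable x x' := by
  constructor
  · intro h
    exact (F.mem_eGraphPoints hT hc ⟨_, h, Sym2.mem_mk_left _ _⟩).2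
  · intro h
    obtain ⟨a, b, c, d, hg⟩ := F.exists_groupArcs hc
    rw [hg.mem_eGraph_iff hc, F.parallel_iff hc]
    refine ⟨Or.inr ⟨_, _, rfl, hc'⟩, fun z hz => ?_⟩
    have := hg.bounds _ _ hc' h
    rcases Sym2.mem_iff.1 hz with rfl | rfl
    · exact Or.inl this.1
    · exact Or.inr this.2

theorem eGraph_eq_of_reachable (F : Frame T m s e) {t : ℕ} {x y x' y' : Fin n}
    (hc : Chord T m s e t x y) (hc' : Chord T m s e t x' y')
    (h : (classGraph T m s e t).Reachable x x') : eGraph T s(x, y) = eGraph T s(x', y') := by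
  have h1 : linkedParallels T s(x, y) = linkedParallels T s(x', y') := by
    ext f
    rw [F.mem_linkedParallels_iff hc, F.mem_linkedParallels_iff hc']
    exact exists_congr fun _ => exists_congr fun _ => and_congr Iff.rfl (and_congr Iff.rfl
      ⟨fun h2 => h.symm.trans h2, fun h2 => h.trans h2⟩)
  unfold eGraph
  rw [h1]
  ext f
  change (_ ∨ _) ∧ _ ↔ (_ ∨ _) ∧ _
  rw [F.parallel_iff hc, F.parallel_iff hc']

theorem self_mem_eGraph (F : Frame T m s e) (hT : T.Connected) {t : ℕ} {x y : Fin n}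
    (hc : Chord T m s e t x y) : s(x, y) ∈ eGraph T s(x, y) :=
  (F.chord_mem_eGraph_iff hT hc hc).2 (Reachable.refl _)

/-- Chords in the same e-graph are in the same class and joined to each other. -/
theorem of_eGraph_eq (F : Frame T m s e) (hT : T.Connected) {t t' : ℕ} {x y x' y' : Fin n}
    (hc : Chord T m s e t x y) (hc' : Chord T m s e t' x' y')
    (h : eGraph T s(x, y) = eGraph T s(x', y')) :
    t % m = t' % m ∧ (classGraph T m s e t).Reachable x x' := by
  have h1 : s(x', y') ∈ eGraph T s(x, y) := by
    rw [h]
    exact F.self_mem_eGraph hT hc'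
  have hmod : t % m = t' % m := by
    obtain ⟨a, b, c, d, hg⟩ := F.exists_groupArcs hc
    rw [hg.mem_eGraph_iff hc, F.parallel_iff hc] at h1
    rcases h1.1 with h2 | ⟨x'', y'', h2, h3⟩
    · obtain ⟨-, f, hf, hf'⟩ := F.crossed_of_chord hc'
      exact absurd hf' (h2.2 f hf)
    · exact (F.mod_eq_of_chord hc' h3 h2).symm
  refine ⟨hmod, ?_⟩
  rcases F.chord_of_mod_eq hmod.symm hc' with h2 | h2
  · exact (F.chord_mem_eGraph_iff hT hc h2).1 h1
  · rw [Sym2.eq_swap (a := x')] at h1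
    exact ((F.chord_mem_eGraph_iff hT hc h2).1 h1).trans h2.reachable

/-- Every crossed edge is in the e-graph of the outer or of the inner chord of its class. -/
theorem exists_chord_of_crossed (F : Frame T m s e) (hT : T.Connected) {f : Sym2 (Fin n)}
    (hf : Crossed T f) : ∃ t x y, f = s(x, y) ∧ Chord T m s e t x y ∧
      (classGraph T m s e t).Reachable (s t) x := by
  induction f with
  | _ x y =>
  obtain ⟨t, hc⟩ := F.cov' hf
  rcases F.reachable_start_or_end hT hc.2.1 with h | h
  · exact ⟨t, x, y, rfl, hc, h.symm⟩
  -- Seen from the opposite block, the inner chord is the one that starts at the lower bound.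
  · refine ⟨t + m, y, x, Sym2.eq_swap, F.chord_swap.2 hc, ?_⟩
    rw [F.classGraph_add]
    exact (F.chord_end t).reachable.symm.trans (h.symm.trans hc.reachable)

/-- `R` contains one edge of the e-graph of each of the chords that bound the classes. -/
theorem exists_selected (F : Frame T m s e) (hT : T.Connected) {R : Set (Sym2 (Fin n))}
    (hR : IsSelection T R) : ∃ X Y : ℕ → Fin n,
      (∀ t, Chord T m s e t (X t) (Y t)) ∧
      (∀ t, (classGraph T m s e t).Reachable (s t) (X t)) ∧
      (∀ t, s(X t, Y t) ∈ R) ∧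
      (∀ t x y, Chord T m s e t x y → (classGraph T m s e t).Reachable (s t) x → s(x, y) ∈ R →
        x = X t ∧ y = Y t) ∧
      ∀ f, f ∈ R ↔ ∃ t, f = s(X t, Y t) := by
  have hex : ∀ t, ∃ x y, Chord T m s e t x y ∧ (classGraph T m s e t).Reachable (s t) x ∧
      s(x, y) ∈ R ∧ ∀ x' y', Chord T m s e t x' y' →
        (classGraph T m s e t).Reachable (s t) x' → s(x', y') ∈ R → x' = x ∧ y' = y := by
    intro t
    have hK := F.chord_start t
    obtain ⟨r, ⟨hr1, hr2⟩, hr3⟩ := hR.2 _ (F.crossed_of_chord hK)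
    obtain ⟨x, y, rfl, hc⟩ : ∃ x y, r = s(x, y) ∧ Chord T m s e t x y := by
      obtain ⟨a, b, c, d, hg⟩ := F.exists_groupArcs hK
      have h2 := (hg.mem_eGraph_iff hK _).1 hr2
      rcases h2.1 with h3 | h3
      · obtain ⟨-, f, hf, hf'⟩ := hR.1 r hr1
        exact absurd hf' (h3.2 f hf)
      · exact (F.parallel_iff hK r).1 h3
    refine ⟨x, y, hc, (F.chord_mem_eGraph_iff hT hK hc).1 hr2, hr1, fun x' y' h1 h2 h3 => ?_⟩
    have h4 := hr3 _ ⟨h3, (F.chord_mem_eGraph_iff hT hK h1).2 h2⟩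
    rcases Sym2.eq_iff.1 h4 with h5 | ⟨rfl, rfl⟩
    · exact h5
    · have := F.mod_eq_of_inBlock h1.2.1 hc.2.2
      have hm := F.two_le
      rcases F.m_eq with rfl | rfl <;> omega
  choose X Y h1 h2 h3 h4 using hex
  refine ⟨X, Y, h1, h2, h3, h4, fun f => ⟨fun hf => ?_, ?_⟩⟩
  · obtain ⟨t, x, y, rfl, hc, hr⟩ := F.exists_chord_of_crossed hT (hR.1 f hf)
    obtain ⟨rfl, rfl⟩ := h4 t x y hc hr hf
    exact ⟨t, rfl⟩
  · rintro ⟨t, rfl⟩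
    exact h3 t

end Frame

/-- If an edge crosses a selected edge, then so does the selected representative of its e-graph,
which is parallel to it. Selected edges thus stay crossed after the first step, and the second step
removes exactly the others. -/
theorem stepTwo_adj_iff {R : Set (Sym2 (Fin n))}
    (hR : IsSelection T R) (p q : Fin n) : (stepTwo T R).Adj p q ↔ s(p, q) ∈ R := by
  have hone : ∀ f, f ∈ (stepOne T R).edgeSet ↔ f ∈ T.edgeSet ∧ (Crossed T f → f ∈ R) := by
    intro f
    unfold stepOne
    rw [edgeSet_deleteEdges]
    change _ ∧ ¬ (_ ∧ _) ↔ _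
    rw [not_and, not_not]
  unfold stepTwo
  rw [deleteEdges_adj]
  change s(p, q) ∈ (stepOne T R).edgeSet ∧ ¬ (Uncrossed (stepOne T R) s(p, q)) ↔ _
  rw [hone]
  constructor
  · rintro ⟨⟨h1, h2⟩, h3⟩
    by_contra h4
    apply h3
    refine ⟨(hone _).2 ⟨h1, h2⟩, fun f hf hcr => h4 (h2 ⟨h1, f, ((hone _).1 hf).1, hcr⟩)⟩
  · intro hr
    have hcr := hR.1 _ hr
    refine ⟨⟨hcr.1, fun _ => hr⟩, fun hun => ?_⟩
    obtain ⟨-, g, hg, hcg⟩ := hcr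
    have hcg' : Crossed T g := ⟨hg, _, (hR.1 _ hr).1, (cross_comm _ _).1 hcg⟩
    obtain ⟨r', ⟨hr', hr2⟩, -⟩ := hR.2 g hcg'
    have hpar : Parallel T g r' := by
      rcases hr2.1 with h | h
      · obtain ⟨-, f, hf, hf'⟩ := hR.1 r' hr'
        exact absurd hf' (h.2 f hf)
      · exact h
    refine hun.2 r' ((hone _).2 ⟨hpar.2.1, fun _ => hr'⟩) ?_
    exact (cross_comm _ _).1 ((hpar.2.2 _ (hR.1 _ hr).1).1 ((cross_comm _ _).1 hcg))

end Groups

end CircleTree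

namespace CircleTree

open SimpleGraph

/-! ### Uncrossed paths between blocks -/

section Gaps

variable {n m : ℕ} {T : SimpleGraph (Fin n)} {s e : ℕ → Fin n}

/-- An edge that starts strictly inside the arc from `p` to `q` and crosses neither of two
disjoint chords from `p` and from `q` stays in this arc. -/
theorem onArc_of_not_cross {p q p' q' x y : Fin n} (h : InOrder q p' q' p)
    (hpq' : p' ≠ q') (hx : OnArc p q x) (hxp : x ≠ p) (hxq : x ≠ q)
    (h₁ : ¬ Cross s(p, p') s(x, y)) (h₂ : ¬ Cross s(q, q') s(x, y)) : OnArc p q y := by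
  rw [inOrder_iff] at h
  rw [Ne, Fin.ext_iff] at hpq' hxp hxq
  simp only [Fin.le_def, Fin.lt_def] at h
  rcases h with h | h | h | h
  · rw [onArc_iff_of_lt (Fin.lt_def.2 (by omega))] at hx ⊢
    rw [Sym2.eq_swap, not_cross_iff_of_lt (Fin.lt_def.2 (by omega))] at h₁
    rw [not_cross_iff_of_lt (Fin.lt_def.2 (by omega))] at h₂
    rw [Fin.le_def, Fin.le_def] at *
    omega
  · rw [onArc_iff_of_le (Fin.le_def.2 (by omega))] at hx ⊢
    rw [not_cross_iff_of_lt (Fin.lt_def.2 (by omega))] at h₁ h₂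
    rw [Fin.le_def, Fin.le_def] at *
    omega
  · rw [onArc_iff_of_le (Fin.le_def.2 (by omega))] at hx ⊢
    rw [Sym2.eq_swap, not_cross_iff_of_lt (Fin.lt_def.2 (by omega))] at h₂
    rw [not_cross_iff_of_lt (Fin.lt_def.2 (by omega))] at h₁
    rw [Fin.le_def, Fin.le_def] at *
    omega
  · rw [onArc_iff_of_le (Fin.le_def.2 (by omega))] at hx ⊢
    rw [Sym2.eq_swap, not_cross_iff_of_lt (Fin.lt_def.2 (by omega))] at h₁ h₂
    rw [Fin.le_def, Fin.le_def] at *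
    omega

/-- Arcs become intervals once distances are measured counterclockwise from a point that precedes
them. -/
theorem onArc_iff_sub {p q r : Fin n} (h : q - p ≤ r - p) (y : Fin n) :
    OnArc q r y ↔ q - p ≤ y - p ∧ y - p ≤ r - p := by
  unfold OnArc
  have h1 := fin_val_sub_cases q p
  have h2 := fin_val_sub_cases r p
  have h3 := fin_val_sub_cases y p
  have h4 := fin_val_sub_cases y q
  have h5 := fin_val_sub_cases r q
  have l1 := q.isLt
  have l2 := r.isLt
  have l3 := y.isLt
  have l4 := p.isLt
  rw [Fin.le_def] at h ⊢
  rw [Fin.le_def, Fin.le_def]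
  omega

theorem onArc_left (a b : Fin n) : OnArc a b a := by
  unfold OnArc
  rw [Fin.le_def, fin_val_sub_of_le le_rfl]
  omega

theorem onArc_right (a b : Fin n) : OnArc a b b := le_refl (b - a)

namespace Frame

/-- The blocks follow each other around the circle. -/
theorem sub_lt_sub (F : Frame T m s e) {i j k : ℕ} {u v w : Fin n} (hw : InBlock s e i w)
    (hu : InBlock s e j u) (hv : InBlock s e k v) (hij : i < j) (hjk : j < k)
    (hk : k < i + 2 * m ∨ (k = i + 2 * m ∧ v < w)) :
    ((u - w : Fin n) : ℕ) < ((v - w : Fin n) : ℕ) := by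
  have hpos : 0 < 2 * m := by have := F.two_le; omega
  have h1 := fin_val_sub_cases u w
  have h2 := fin_val_sub_cases v w
  have lu := u.isLt
  have lv := v.isLt
  have lw := w.isLt
  rw [← F.inBlock_congr (Nat.mod_mod _ (2 * m))] at hw hu hv
  have key : ∀ {i j : ℕ} {u v : Fin n}, InBlock s e i u → InBlock s e j v → i < j → j < 2 * m →
      (u : ℕ) < v := fun h h' hij hj =>
    Fin.lt_def.1 (h.2.trans_lt ((F.lt _ _ hij hj).trans_le h'.1))
  have li := Nat.mod_lt i hpos
  have lj := Nat.mod_lt j hpos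
  have lk := Nat.mod_lt k hpos
  -- The first three cases are the positions of the cut of the labelling; in the last one `k` is
  -- back in the block `i` after a full turn.
  have hmod : (i % (2 * m) < j % (2 * m) ∧ j % (2 * m) < k % (2 * m)) ∨
      (k % (2 * m) < i % (2 * m) ∧ i % (2 * m) < j % (2 * m)) ∨
      (j % (2 * m) < k % (2 * m) ∧ k % (2 * m) < i % (2 * m)) ∨
      (k % (2 * m) = i % (2 * m) ∧ v < w ∧ i % (2 * m) ≠ j % (2 * m)) := by
    rcases F.m_eq with rfl | rfl <;> omega
  rcases hmod with ⟨a, b⟩ | ⟨a, b⟩ | ⟨a, b⟩ | ⟨a, b, c⟩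
  · have := key hw hu a lj
    have := key hu hv b lk
    omega
  · have := key hv hw a li
    have := key hw hu b lj
    omega
  · have := key hu hv a lk
    have := key hv hw b li
    omega
  · rw [Fin.lt_def] at b
    rcases lt_or_gt_of_ne c with c | c
    · have := key hw hu c lj
      omega
    · have := key hu hw c li
      have := key hu hv (by omega) lk
      omega

theorem sub_le_sub (F : Frame T m s e) {i j : ℕ} {u v w : Fin n} (hw : InBlock s e i w)
    (hu : InBlock s e j u) (hv : InBlock s e j v) (huv : u ≤ v)
    (h : i % (2 * m) ≠ j % (2 * m)) : ((u - w : Fin n) : ℕ) ≤ ((v - w : Fin n) : ℕ) := by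
  have hpos : 0 < 2 * m := by have := F.two_le; omega
  have h1 := fin_val_sub_cases u w
  have h2 := fin_val_sub_cases v w
  have lu := u.isLt
  have lv := v.isLt
  have lw := w.isLt
  rw [← F.inBlock_congr (Nat.mod_mod _ (2 * m))] at hw hu hv
  have key : ∀ {i j : ℕ} {u v : Fin n}, InBlock s e i u → InBlock s e j v → i < j → j < 2 * m →
      (u : ℕ) < v := fun h h' hij hj =>
    Fin.lt_def.1 (h.2.trans_lt ((F.lt _ _ hij hj).trans_le h'.1))
  have li := Nat.mod_lt i hpos
  have lj := Nat.mod_lt j hpos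
  rw [Fin.le_def] at huv
  rcases lt_or_gt_of_ne h with c | c
  · have := key hw hu c lj
    have := key hw hv c lj
    omega
  · have := key hu hw c li
    have := key hv hw c li
    omega

theorem inBlock_s (F : Frame T m s e) (t : ℕ) : InBlock s e t (s t) := ⟨le_rfl, F.le t⟩

theorem inBlock_e (F : Frame T m s e) (t : ℕ) : InBlock s e t (e t) := ⟨F.le t, le_rfl⟩

theorem e_ne_s (F : Frame T m s e) {i j : ℕ} (h : i % (2 * m) ≠ j % (2 * m)) : e i ≠ s j :=
  fun h1 => h (F.mod_eq_of_inBlock (F.inBlock_e i) (h1 ▸ F.inBlock_s j))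

theorem e_ne_e (F : Frame T m s e) {i j : ℕ} (h : i % (2 * m) ≠ j % (2 * m)) : e i ≠ e j :=
  fun h1 => h (F.mod_eq_of_inBlock (F.inBlock_e i) (h1 ▸ F.inBlock_e j))

theorem s_ne_s (F : Frame T m s e) {i j : ℕ} (h : i % (2 * m) ≠ j % (2 * m)) : s i ≠ s j :=
  fun h1 => h (F.mod_eq_of_inBlock (F.inBlock_s i) (h1 ▸ F.inBlock_s j))

/-- The arc from the end of the block `t` to the start of the block `t + r` meets another block
only if that block lies in between. -/
theorem eq_or_eq_of_onArc (F : Frame T m s e) {t r k : ℕ} {z : Fin n} (hr : 0 < r)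
    (hrk : t + r ≤ k) (hk : k ≤ t + 2 * m) (hr' : r < 2 * m) (hz : InBlock s e k z)
    (h : OnArc (e t) (s (t + r)) z) : z = e t ∨ z = s (t + r) := by
  have hw := F.inBlock_e t
  have hs := F.inBlock_s (t + r)
  have h' : ((z - e t : Fin n) : ℕ) ≤ ((s (t + r) - e t : Fin n) : ℕ) := h
  have hinj : ∀ {a b : Fin n}, ((a - e t : Fin n) : ℕ) = ((b - e t : Fin n) : ℕ) → a = b := by
    intro a b h
    have h1 := fin_val_sub_cases a (e t)
    have h2 := fin_val_sub_cases b (e t)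
    have := a.isLt
    have := b.isLt
    exact Fin.ext (by omega)
  rcases eq_or_lt_of_le hrk with rfl | h1
  · right
    have hmod : t % (2 * m) ≠ (t + r) % (2 * m) := by
      rcases F.m_eq with rfl | rfl <;> omega
    exact hinj (le_antisymm h' (F.sub_le_sub hw hs hz hz.1 hmod))
  · rcases eq_or_lt_of_le hk with rfl | h2
    · left
      by_contra hne
      rw [F.inBlock_congr (Nat.add_mod_right t (2 * m))] at hz
      have hlt : z < e t := lt_of_le_of_ne hz.2 hne
      rw [← F.inBlock_congr (Nat.add_mod_right t (2 * m))] at hz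
      have := F.sub_lt_sub hw hs hz (by omega) h1 (Or.inr ⟨rfl, hlt⟩)
      omega
    · have := F.sub_lt_sub hw hs hz (by omega) h1 (Or.inl h2)
      omega

theorem exists_mod_eq (F : Frame T m s e) (t i : ℕ) :
    ∃ k, t < k ∧ k ≤ t + 2 * m ∧ k % (2 * m) = i % (2 * m) := by
  rcases F.m_eq with rfl | rfl
  -- As 3 is -1 modulo 4, and 5 is -1 modulo 6, the remainder is that of `i - (t + 1)`, written
  -- without subtraction.
  · exact ⟨t + 1 + (i + 3 * (t + 1)) % 4, by omega, by omega, by omega⟩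
  · exact ⟨t + 1 + (i + 5 * (t + 1)) % 6, by omega, by omega, by omega⟩

/-- A gap meets the blocks only in its two ends. -/
theorem eq_or_eq_of_inGap (F : Frame T m s e) {t i : ℕ} {z : Fin n} (hz : InBlock s e i z)
    (h : OnArc (e t) (s (t + 1)) z) : z = e t ∨ z = s (t + 1) := by
  obtain ⟨k, h1, h2, h3⟩ := F.exists_mod_eq t i
  rw [← F.inBlock_congr h3] at hz
  exact F.eq_or_eq_of_onArc one_pos h1 h2 (by have := F.two_le; omega) hz h

end Frame

/-- The uncrossed edges in the gap between the blocks `t` and `t + 1`. -/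
def gapGraph (T : SimpleGraph (Fin n)) (s e : ℕ → Fin n) (t : ℕ) : SimpleGraph (Fin n) where
  Adj x y := T.Adj x y ∧ Uncrossed T s(x, y) ∧ OnArc (e t) (s (t + 1)) x ∧
    OnArc (e t) (s (t + 1)) y
  symm := ⟨fun x y h => ⟨h.1.symm, by rw [Sym2.eq_swap]; exact h.2.1, h.2.2.2, h.2.2.1⟩⟩
  loopless := ⟨fun _ h => h.1.ne rfl⟩

/-- The uncrossed edges between points that bound no block, except for `u` and `v`. -/
def avoidGraph (T : SimpleGraph (Fin n)) (s e : ℕ → Fin n) (u v : Fin n) :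
    SimpleGraph (Fin n) where
  Adj x y := T.Adj x y ∧ Uncrossed T s(x, y) ∧ (∀ t, x = s t ∨ x = e t → x = u ∨ x = v) ∧
    ∀ t, y = s t ∨ y = e t → y = u ∨ y = v
  symm := ⟨fun x y h => ⟨h.1.symm, by rw [Sym2.eq_swap]; exact h.2.1, h.2.2.2, h.2.2.1⟩⟩
  loopless := ⟨fun _ h => h.1.ne rfl⟩

theorem avoidGraph_comm (u v : Fin n) : avoidGraph T s e u v = avoidGraph T s e v u := by
  ext x y
  simp only [avoidGraph, or_comm]

namespace Frame

theorem not_cross_of_uncrossed (_ : Frame T m s e) {t : ℕ} {x y z w : Fin n}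
    (hc : Chord T m s e t x y) (h : Uncrossed T s(z, w)) : ¬ Cross s(x, y) s(z, w) :=
  fun h1 => h.2 _ hc.1 ((cross_comm _ _).1 h1)

theorem add_two_mul (_ : Frame T m s e) (t : ℕ) : (t + 2 * m) % (2 * m) = t % (2 * m) :=
  Nat.add_mod_right _ _

/-- An uncrossed edge from a point strictly between the blocks `t` and `t + 2` does not leave the
arc between these blocks. -/
theorem onArc_two (F : Frame T m s e) {t : ℕ} {x y : Fin n} (h : Uncrossed T s(x, y))
    (hx : OnArc (e t) (s (t + 2)) x) (hx₁ : x ≠ e t) (hx₂ : x ≠ s (t + 2)) :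
    OnArc (e t) (s (t + 2)) y := by
  have hm := F.m_eq
  refine onArc_of_not_cross (p' := s (t + m)) (q' := e (t + 2 + m)) ?_
    (F.e_ne_s (by rcases hm with rfl | rfl <;> omega)).symm hx hx₁ hx₂
    (F.not_cross_of_uncrossed (F.chord_end t) h) (F.not_cross_of_uncrossed (F.chord_start _) h)
  have hs := F.inBlock_s (t + 2)
  have he := F.inBlock_e t
  rw [← F.inBlock_congr (F.add_two_mul t)] at he
  -- For `m = 2` both fences are the same chord, between `e t` and `s (t + 2)`.
  rcases hm with rfl | rfl
  · have h1 : e (t + 2 + 2) = e t := F.per_e t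
    rw [h1]
    exact ⟨onArc_left _ _, le_rfl⟩
  · exact ⟨(F.sub_lt_sub hs (F.inBlock_s (t + 3)) (F.inBlock_e (t + 2 + 3)) (by omega) (by omega)
      (Or.inl (by omega))).le, (F.sub_lt_sub hs (F.inBlock_e (t + 2 + 3)) he (by omega) (by omega)
      (Or.inl (by omega))).le⟩

/-- The fences are the inner chord at `e t` and the outer chord at `s (t + 1)`. The next lemma uses
the inner chords at the ends of both blocks. -/
theorem onArc_gap (F : Frame T m s e) {t : ℕ} {x y : Fin n} (h : Uncrossed T s(x, y))
    (hx : OnArc (e t) (s (t + 1)) x) (hx₁ : x ≠ e t) (hx₂ : x ≠ s (t + 1)) :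
    OnArc (e t) (s (t + 1)) y := by
  have hm := F.m_eq
  have hm' := F.two_le
  refine onArc_of_not_cross (p' := s (t + m)) (q' := e (t + 1 + m)) ?_
    (F.e_ne_s (by rcases hm with rfl | rfl <;> omega)).symm hx hx₁ hx₂
    (F.not_cross_of_uncrossed (F.chord_end t) h) (F.not_cross_of_uncrossed (F.chord_start _) h)
  have hs := F.inBlock_s (t + 1)
  have he := F.inBlock_e t
  rw [← F.inBlock_congr (F.add_two_mul t)] at he
  exact ⟨(F.sub_lt_sub hs (F.inBlock_s (t + m)) (F.inBlock_e (t + 1 + m)) (by omega) (by omega)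
    (Or.inl (by omega))).le, (F.sub_lt_sub hs (F.inBlock_e (t + 1 + m)) he (by omega) (by omega)
    (Or.inl (by omega))).le⟩

theorem onArc_ends (F : Frame T m s e) {t : ℕ} {x y : Fin n} (h : Uncrossed T s(x, y))
    (hx : OnArc (e t) (e (t + 1)) x) (hx₁ : x ≠ e t) (hx₂ : x ≠ e (t + 1)) :
    OnArc (e t) (e (t + 1)) y := by
  have hm := F.m_eq
  have hm' := F.two_le
  refine onArc_of_not_cross (p' := s (t + m)) (q' := s (t + 1 + m)) ?_
    (F.s_ne_s (by rcases hm with rfl | rfl <;> omega)) hx hx₁ hx₂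
    (F.not_cross_of_uncrossed (F.chord_end t) h) (F.not_cross_of_uncrossed (F.chord_end _) h)
  have hs := F.inBlock_e (t + 1)
  have he := F.inBlock_e t
  rw [← F.inBlock_congr (F.add_two_mul t)] at he
  exact ⟨(F.sub_lt_sub hs (F.inBlock_s (t + m)) (F.inBlock_s (t + 1 + m)) (by omega) (by omega)
    (Or.inl (by omega))).le, (F.sub_lt_sub hs (F.inBlock_s (t + 1 + m)) he (by omega) (by omega)
    (Or.inl (by omega))).le⟩

/-- A path of uncrossed edges from the block `t + 1` to another block, not meeting the bounds of
the blocks in between, ends at an adjacent block. -/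
theorem eq_of_avoidGraph_reachable (F : Frame T m s e) {t j : ℕ} {u v : Fin n}
    (h : (avoidGraph T s e u v).Reachable u v) (hu : InBlock s e (t + 1) u) (hv : InBlock s e j v)
    (hj : (t + 1) % (2 * m) ≠ j % (2 * m)) : v = e t ∨ v = s (t + 2) := by
  have hm := F.m_eq
  have hm' := F.two_le
  by_cases hend : v = e t ∨ v = s (t + 2)
  · exact hend
  exfalso
  -- The path has to leave the open arc between the blocks `t` and `t + 2`. By the fences it can do
  -- so only at an end of this arc. Such an end bounds a block, so it would have to be `u` or `v`.
  obtain ⟨x, y, hxy, ⟨hx1, hx2, hx3⟩, hy⟩ := exists_adj_of_reachable h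
    (P := fun x => OnArc (e t) (s (t + 2)) x ∧ x ≠ e t ∧ x ≠ s (t + 2)) (by
      refine ⟨?_, ?_, ?_⟩
      · have he := F.inBlock_e t
        exact (F.sub_lt_sub he hu (F.inBlock_s (t + 2)) (by omega) (by omega)
          (Or.inl (by omega))).le
      · rintro rfl
        have := F.mod_eq_of_inBlock hu (F.inBlock_e t)
        rcases hm with rfl | rfl <;> omega
      · rintro rfl
        have := F.mod_eq_of_inBlock hu (F.inBlock_s (t + 2))
        rcases hm with rfl | rfl <;> omega) (by
      rintro ⟨h1, h2, h3⟩
      obtain ⟨k, h4, h5, h6⟩ := F.exists_mod_eq t j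
      have h7 : k ≠ t + 1 := by
        rintro rfl
        exact hj h6
      rw [← F.inBlock_congr h6] at hv
      rcases F.eq_or_eq_of_onArc (r := 2) two_pos (by omega) h5 (by omega) hv h1 with h8 | h8
      · exact h2 h8
      · exact h3 h8)
  have hyarc := F.onArc_two hxy.2.1 hx1 hx2 hx3
  have hy' : y = e t ∨ y = s (t + 2) := by
    by_contra h1
    push Not at h1
    exact hy ⟨hyarc, h1⟩
  have hyuv : y = u ∨ y = v := by
    rcases hy' with h1 | h1
    · exact hxy.2.2.2 t (Or.inr h1)
    · exact hxy.2.2.2 (t + 2) (Or.inl h1)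
  have hyu : y ≠ u := by
    rintro rfl
    rcases hy' with h1 | h1
    · rw [h1] at hu
      have := F.mod_eq_of_inBlock hu (F.inBlock_e t)
      rcases hm with rfl | rfl <;> omega
    · rw [h1] at hu
      have := F.mod_eq_of_inBlock hu (F.inBlock_s (t + 2))
      rcases hm with rfl | rfl <;> omega
  rcases hyuv with h1 | h1
  · exact hyu h1
  · exact hend (h1 ▸ hy')

/-- A path that avoids the bounds of the other blocks can be deformed into the gap. -/
theorem gapGraph_reachable (F : Frame T m s e) {t : ℕ}
    (h : (avoidGraph T s e (e (t + 1)) (s (t + 2))).Reachable (e (t + 1)) (s (t + 2))) :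
    (gapGraph T s e (t + 1)).Reachable (e (t + 1)) (s (t + 2)) := by
  classical
  have hm := F.m_eq
  have hm' := F.two_le
  have n1 : e t ≠ e (t + 1) := F.e_ne_e (by rcases hm with rfl | rfl <;> omega)
  have n2 : e t ≠ s (t + 2) := F.e_ne_s (by rcases hm with rfl | rfl <;> omega)
  have n3 : e (t + 1) ≠ s (t + 2) := F.e_ne_s (by rcases hm with rfl | rfl <;> omega)
  have hES := F.sub_lt_sub (F.inBlock_e t) (F.inBlock_e (t + 1)) (F.inBlock_s (t + 2)) (by omega)
    (by omega) (Or.inl (by omega))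
  have hinj : ∀ a b : Fin n, ((a - e t : Fin n) : ℕ) = ((b - e t : Fin n) : ℕ) ↔ a = b := by
    intro a b
    refine ⟨fun h => ?_, fun h => h ▸ rfl⟩
    have h1 := fin_val_sub_cases a (e t)
    have h2 := fin_val_sub_cases b (e t)
    have := a.isLt
    have := b.isLt
    exact Fin.ext (by omega)
  have h0 : ((e t - e t : Fin n) : ℕ) = 0 := by
    rw [fin_val_sub_of_le le_rfl, Nat.sub_self]
  let κ : Fin n → ℕ := fun x => ((x - e t : Fin n) : ℕ)
  have hgap : ∀ x, OnArc (e (t + 1)) (s (t + 2)) x ↔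
      κ (e (t + 1)) ≤ κ x ∧ κ x ≤ κ (s (t + 2)) := onArc_iff_sub hES.le
  have hk0 : ∀ x, x ≠ e t → 0 < κ x := by
    intro x hx
    rw [Nat.pos_iff_ne_zero, ← h0]
    exact fun h => hx ((hinj _ _).1 h)
  have hkE : ∀ x, κ x = κ (e (t + 1)) ↔ x = e (t + 1) := fun x => hinj _ _
  have hkS : ∀ x, κ x = κ (s (t + 2)) ↔ x = s (t + 2) := fun x => hinj _ _
  -- The three fence lemmas in terms of the distance `κ` from `e t`: no admissible edge jumps over
  -- `e (t + 1)` or `s (t + 2)`.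
  have hstep : ∀ x y, Uncrossed T s(x, y) → x ≠ e t → y ≠ e t →
      (κ x < κ (s (t + 2)) → κ y ≤ κ (s (t + 2))) ∧ (κ x < κ (e (t + 1)) → κ y ≤ κ (e (t + 1))) ∧
      (κ (e (t + 1)) < κ x → κ x < κ (s (t + 2)) → κ (e (t + 1)) ≤ κ y) := by
    intro x y hxy hx hy
    refine ⟨fun h1 => ?_, fun h1 => ?_, fun h1 h2 => ?_⟩
    · exact F.onArc_two hxy (show κ x ≤ _ from h1.le) hx (fun h2 => h1.ne ((hkS x).2 h2))
    · exact F.onArc_ends hxy (show κ x ≤ _ from h1.le) hx (fun h2 => h1.ne ((hkE x).2 h2))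
    · have := F.onArc_gap (t := t + 1) hxy ((hgap x).2 ⟨h1.le, h2.le⟩)
        (fun h3 => h1.ne' ((hkE x).2 h3)) (fun h3 => h2.ne ((hkS x).2 h3))
      exact ((hgap y).1 this).1
  -- The retraction of the circle onto the gap. An edge of the path either lies in the gap or is
  -- collapsed to one of its ends.
  let f : Fin n → Fin n := fun x =>
    if κ x < κ (e (t + 1)) then e (t + 1) else if κ (s (t + 2)) < κ x then s (t + 2) else x
  have hf1 : ∀ x, κ x ≤ κ (e (t + 1)) → f x = e (t + 1) := by
    intro x hx
    by_cases h1 : κ x < κ (e (t + 1))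
    · exact if_pos h1
    · have h2 : x = e (t + 1) := (hkE x).1 (by omega)
      rw [h2]
      have h3 : ¬ κ (s (t + 2)) < κ (e (t + 1)) := by exact hES.le.not_gt
      simp [f, h3]
  have hf2 : ∀ x, κ (s (t + 2)) ≤ κ x → f x = s (t + 2) := by
    intro x hx
    have h3 : ¬ κ x < κ (e (t + 1)) := (hES.le.trans hx).not_gt
    by_cases h1 : κ (s (t + 2)) < κ x
    · simp [f, h1, h3]
    · have h2 : x = s (t + 2) := (hkS x).1 (by omega)
      simp only [f, if_neg h3, if_neg h1]
      exact h2
  have hf3 : ∀ x, κ (e (t + 1)) ≤ κ x → κ x ≤ κ (s (t + 2)) → f x = x := by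
    intro x h1 h2
    simp only [f, if_neg h1.not_gt, if_neg h2.not_gt]
  have key : (gapGraph T s e (t + 1)).Reachable (e (t + 1)) (f (s (t + 2))) := by
    refine reachable_induction (P := fun x => (gapGraph T s e (t + 1)).Reachable (e (t + 1)) (f x))
      h ?_ ?_
    · rintro x y ⟨hadj, hun, hx, hy⟩ hr
      have hxt : x ≠ e t := by
        rintro rfl
        rcases hx t (Or.inr rfl) with h1 | h1
        · exact n1 h1
        · exact n2 h1
      have hyt : y ≠ e t := by
        rintro rfl
        rcases hy t (Or.inr rfl) with h1 | h1
        · exact n1 h1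
        · exact n2 h1
      have s1 := hstep x y hun hxt hyt
      have s2 := hstep y x (by rwa [Sym2.eq_swap]) hyt hxt
      have hcase : (κ (e (t + 1)) ≤ κ x ∧ κ x ≤ κ (s (t + 2)) ∧ κ (e (t + 1)) ≤ κ y ∧
            κ y ≤ κ (s (t + 2))) ∨ (κ x ≤ κ (e (t + 1)) ∧ κ y ≤ κ (e (t + 1))) ∨
          (κ (s (t + 2)) ≤ κ x ∧ κ (s (t + 2)) ≤ κ y) := by
        have : κ (e (t + 1)) < κ (s (t + 2)) := hES
        omega
      rcases hcase with ⟨a, b, c, d⟩ | ⟨a, b⟩ | ⟨a, b⟩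
      · rw [hf3 x a b] at hr
        rw [hf3 y c d]
        exact hr.trans (Adj.reachable (G := gapGraph T s e (t + 1))
          ⟨hadj, hun, (hgap x).2 ⟨a, b⟩, (hgap y).2 ⟨c, d⟩⟩)
      · rw [hf1 y b]
      · rw [hf2 y b]
        rwa [hf2 x a] at hr
    · rw [hf1 _ le_rfl]
  rwa [hf2 _ le_rfl] at key

/-- Two blocks of different classes joined by uncrossed edges, not meeting the bounds of other
blocks, are adjacent and joined in the gap between them. -/
theorem exists_gap_of_avoidGraph_reachable (F : Frame T m s e) {i j : ℕ} {u v : Fin n}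
    (h : (avoidGraph T s e u v).Reachable u v) (hu : InBlock s e i u) (hv : InBlock s e j v)
    (hij : i % m ≠ j % m) : ∃ t, (gapGraph T s e t).Reachable (e t) (s (t + 1)) ∧
      ((u = e t ∧ v = s (t + 1)) ∨ (v = e t ∧ u = s (t + 1))) := by
  have hm := F.m_eq
  have hm' := F.two_le
  -- the case in which the path leads to the next block
  have main : ∀ {i j : ℕ} {u v : Fin n}, (avoidGraph T s e u v).Reachable u v →
      InBlock s e (i + 1) u → InBlock s e j v → (i + 1) % (2 * m) ≠ j % (2 * m) → v = s (i + 2) →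
      ∃ t, (gapGraph T s e t).Reachable (e t) (s (t + 1)) ∧ u = e t ∧ v = s (t + 1) := by
    intro i j u v h hu hv hij hvs
    have hvb : InBlock s e (i + 1 + 1) v := hvs ▸ F.inBlock_s (i + 2)
    have h' := h.symm
    rw [avoidGraph_comm] at h'
    have hue : u = e (i + 1) := by
      rcases F.eq_of_avoidGraph_reachable h' hvb hu
        (by rcases hm with rfl | rfl <;> omega) with h1 | h1
      · exact h1
      · rw [h1] at hu
        have := F.mod_eq_of_inBlock hu (F.inBlock_s _)
        rcases hm with rfl | rfl <;> omega
    refine ⟨i + 1, F.gapGraph_reachable (t := i) ?_, hue, hvs⟩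
    rw [← hue, ← hvs]
    exact h
  -- `i'` is the index before `i` modulo `2 * m`; a full turn is added to avoid subtracting from
  -- zero.
  have shift : ∀ i, ∃ i', i' + 1 = i + 2 * m ∧ ∀ x, InBlock s e (i' + 1) x ↔ InBlock s e i x := by
    intro i
    refine ⟨i + 2 * m - 1, by omega, fun x => ?_⟩
    rw [F.inBlock_congr (t := i + 2 * m - 1 + 1) (t' := i)]
    rw [show i + 2 * m - 1 + 1 = i + 2 * m by omega, F.add_two_mul]
  obtain ⟨i', hi', hii⟩ := shift i
  have hmod : (i' + 1) % (2 * m) ≠ j % (2 * m) := by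
    rw [hi']
    rcases hm with rfl | rfl <;> omega
  rw [← hii] at hu
  rcases F.eq_of_avoidGraph_reachable h hu hv hmod with h1 | h1
  · obtain ⟨k, hk, hkk⟩ := shift i'
    have hv' : InBlock s e (k + 1) v := (hkk v).2 (h1 ▸ F.inBlock_e i')
    have h' := h.symm
    rw [avoidGraph_comm] at h'
    have hmod' : (k + 1) % (2 * m) ≠ (i' + 1) % (2 * m) := by
      rw [hk]
      rcases hm with rfl | rfl <;> omega
    rcases F.eq_of_avoidGraph_reachable h' hv' hu hmod' with h2 | h2
    · have := F.mod_eq_of_inBlock hu (h2 ▸ F.inBlock_e k)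
      rcases hm with rfl | rfl <;> omega
    · obtain ⟨t, ht, h3, h4⟩ := main h' hv' hu hmod' h2
      exact ⟨t, ht, Or.inr ⟨h3, h4⟩⟩
  · obtain ⟨t, ht, h3, h4⟩ := main h hu hv hmod h1
    exact ⟨t, ht, Or.inl ⟨h3, h4⟩⟩

end Frame

end Gaps

end CircleTree

namespace CircleTree

open SimpleGraph

/-! ### The result of the e-reduction in terms of merged classes and joined gaps -/

section Connections

variable {n m : ℕ} {T : SimpleGraph (Fin n)} {s e : ℕ → Fin n}

/-- The two chords that bound the class of `t` are in the same e-graph. -/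
def Merged (T : SimpleGraph (Fin n)) (m : ℕ) (s e : ℕ → Fin n) (t : ℕ) : Prop :=
  (classGraph T m s e t).Reachable (s t) (e t)

/-- The blocks `t` and `t + 1` are joined in the gap between them. -/
def Joined (T : SimpleGraph (Fin n)) (s e : ℕ → Fin n) (t : ℕ) : Prop :=
  (gapGraph T s e t).Reachable (e t) (s (t + 1))

theorem onArc_of_gapGraph_reachable {t : ℕ} {x : Fin n}
    (h : (gapGraph T s e t).Reachable (e t) x) : OnArc (e t) (s (t + 1)) x :=
  reachable_induction h (fun _ _ hxy _ => hxy.2.2.2) (onArc_left _ _)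

namespace Frame

theorem merged_congr (F : Frame T m s e) {t t' : ℕ} (h : t % (2 * m) = t' % (2 * m)) :
    Merged T m s e t ↔ Merged T m s e t' := by
  unfold Merged
  rw [F.s_congr h, F.e_congr h, F.classGraph_congr (t := t) (t' := t')]
  rcases F.m_eq with rfl | rfl <;> omega

/-- The bounds of the opposite block are the other endpoints of the same two chords. -/
theorem merged_add (F : Frame T m s e) (t : ℕ) : Merged T m s e (t + m) ↔ Merged T m s e t := by
  unfold Merged
  rw [F.classGraph_add]
  have h1 := (F.chord_start t).reachable
  have h2 := (F.chord_end t).reachable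
  exact ⟨fun h => h1.trans (h.symm.trans h2.symm), fun h => h2.symm.trans (h.symm.trans h1)⟩

theorem joined_congr (F : Frame T m s e) {t t' : ℕ} (h : t % (2 * m) = t' % (2 * m)) :
    Joined T s e t ↔ Joined T s e t' := by
  have h1 : s (t + 1) = s (t' + 1) := F.s_congr (Nat.ModEq.add_right 1 h)
  have h2 : gapGraph T s e t = gapGraph T s e t' := by
    ext x y
    simp only [gapGraph]
    rw [h1, F.e_congr h]
  unfold Joined
  rw [h2, h1, F.e_congr h]

theorem mod_eq_of_inBlock_or (F : Frame T m s e) {i j : ℕ} {z : Fin n}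
    (hi : InBlock s e i z ∨ InBlock s e (i + m) z) (hj : InBlock s e j z ∨ InBlock s e (j + m) z) :
    i % m = j % m := by
  rcases hi with h1 | h1 <;> rcases hj with h2 | h2 <;> have := F.mod_eq_of_inBlock h1 h2 <;>
    rcases F.m_eq with rfl | rfl <;> omega

/-- E-graphs of the same class with connected points are equal. -/
theorem eGraph_eq_of_points (F : Frame T m s e) (hT : T.Connected) {t t' : ℕ}
    {x y x' y' z z' : Fin n} (hc : Chord T m s e t x y) (hc' : Chord T m s e t' x' y')
    (hmod : t % m = t' % m) (hz : z ∈ eGraphPoints T s(x, y)) (hz' : z' ∈ eGraphPoints T s(x', y'))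
    (h : (classGraph T m s e t).Reachable z z') : eGraph T s(x, y) = eGraph T s(x', y') := by
  have h1 := (F.mem_eGraphPoints hT hc hz).2
  have h2 := (F.mem_eGraphPoints hT hc' hz').2
  rw [F.classGraph_congr hmod.symm] at h2
  have h3 := h1.trans (h.trans h2.symm)
  rcases F.chord_of_mod_eq hmod.symm hc' with h4 | h4
  · exact F.eGraph_eq_of_reachable hc h4 h3
  · rw [Sym2.eq_swap (a := x')]
    exact F.eGraph_eq_of_reachable hc h4 (h3.trans h4.reachable.symm)

theorem eGraph_eq_of_common_point (F : Frame T m s e) (hT : T.Connected) {t t' : ℕ}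
    {x y x' y' z : Fin n} (hc : Chord T m s e t x y) (hc' : Chord T m s e t' x' y')
    (hz : z ∈ eGraphPoints T s(x, y)) (hz' : z ∈ eGraphPoints T s(x', y')) :
    eGraph T s(x, y) = eGraph T s(x', y') :=
  F.eGraph_eq_of_points hT hc hc' (F.mod_eq_of_inBlock_or (F.mem_eGraphPoints hT hc hz).1
    (F.mem_eGraphPoints hT hc' hz').1) hz hz' (Reachable.refl _)

theorem s_mem_eGraphPoints (F : Frame T m s e) (hT : T.Connected) (t : ℕ) :
    s t ∈ eGraphPoints T s(s t, e (t + m)) :=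
  ⟨_, F.self_mem_eGraph hT (F.chord_start t), Sym2.mem_mk_left _ _⟩

theorem e_mem_eGraphPoints (F : Frame T m s e) (hT : T.Connected) (t : ℕ) :
    e t ∈ eGraphPoints T s(s (t + m), e (t + m + m)) := by
  refine ⟨_, F.self_mem_eGraph hT (F.chord_start (t + m)), ?_⟩
  rw [show t + m + m = t + 2 * m by ring, F.per_e]
  exact Sym2.mem_mk_right _ _

theorem eGraphPoints_congr {f g : Sym2 (Fin n)} (h : eGraph T f = eGraph T g) :
    eGraphPoints T f = eGraphPoints T g := by
  unfold eGraphPoints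
  rw [h]

theorem exists_bound_eGraph (F : Frame T m s e) (hT : T.Connected) {t : ℕ} {x : Fin n}
    (hx : x = s t ∨ x = e t) : ∃ g, Crossed T g ∧ x ∈ eGraphPoints T g := by
  rcases hx with rfl | rfl
  · exact ⟨_, F.crossed_of_chord (F.chord_start t), F.s_mem_eGraphPoints hT t⟩
  · exact ⟨_, F.crossed_of_chord (F.chord_start (t + m)), F.e_mem_eGraphPoints hT t⟩

/-- Every bound of a block is a point of some e-graph, so a connecting path avoids all bounds except
its ends. The two classes differ, because uncrossed edges between e-graphs of one class would make
these equal. The deformation into a gap then applies. -/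
theorem exists_joined_of_connectedBy (F : Frame T m s e) (hT : T.Connected)
    {f g : Sym2 (Fin n)} (hf : Crossed T f) (hg : Crossed T g) {u v : Fin n}
    (h : ConnectedBy T f g u v) :
    ∃ t, Joined T s e t ∧ ((u = e t ∧ v = s (t + 1)) ∨ (v = e t ∧ u = s (t + 1))) := by
  induction f with
  | _ x y =>
  induction g with
  | _ x' y' =>
  obtain ⟨i, hc⟩ := F.cov' hf
  obtain ⟨j, hc'⟩ := F.cov' hg
  obtain ⟨hne, hu, hv, p, hp, hsupp⟩ := h
  have hmod : i % m ≠ j % m := by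
    intro hmod
    refine hne (F.eGraph_eq_of_points hT hc hc' hmod hu hv ⟨p.transfer _ fun b hb => ?_⟩)
    have := hp b hb
    induction b with
    | _ z w => exact ⟨this.1, Or.inl this⟩
  have hreach : (avoidGraph T s e u v).Reachable u v := by
    have hb : ∀ x ∈ p.support, ∀ t, x = s t ∨ x = e t → x = u ∨ x = v := by
      intro z hz t hzt
      obtain ⟨g, hg1, hg2⟩ := F.exists_bound_eGraph hT hzt
      obtain ⟨h1, h2, h3⟩ := hsupp z hz
      by_cases e1 : eGraph T g = eGraph T s(x, y)
      · exact Or.inl (h1 (eGraphPoints_congr e1 ▸ hg2))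
      · by_cases e2 : eGraph T g = eGraph T s(x', y')
        · exact Or.inr (h2 (eGraphPoints_congr e2 ▸ hg2))
        · exact absurd hg2 (h3 g hg1 e1 e2)
    refine ⟨p.transfer _ fun b hbp => ?_⟩
    have hun := hp b hbp
    induction b with
    | _ z w =>
      exact ⟨hun.1, hun, hb z (p.fst_mem_support_of_mem_edges hbp),
        hb w (p.snd_mem_support_of_mem_edges hbp)⟩
  rcases (F.mem_eGraphPoints hT hc hu).1 with h1 | h1 <;>
    rcases (F.mem_eGraphPoints hT hc' hv).1 with h2 | h2 <;>
    exact F.exists_gap_of_avoidGraph_reachable hreach h1 h2 (by simpa using hmod)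

theorem inBlock_of_onSameArc (F : Frame T m s e) {t : ℕ} {x y p q : Fin n}
    (hc : Chord T m s e t x y) (h : OnSameArc T s(x, y) p q) :
    (InBlock s e t p ∧ InBlock s e t q) ∨ (InBlock s e (t + m) p ∧ InBlock s e (t + m) q) := by
  obtain ⟨a, b, c, d, hg⟩ := F.exists_groupArcs hc
  have ha := hg.chord_ad.2
  have hb := hg.chord_bc.2
  unfold InBlock at *
  rcases (hg.onSameArc_iff hc p q).1 h with ⟨h1, h2⟩ | ⟨h1, h2⟩
  · exact Or.inl ⟨⟨ha.1.1.trans h1.1, h1.2.trans hb.1.2⟩, ha.1.1.trans h2.1, h2.2.trans hb.1.2⟩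
  · exact Or.inr ⟨⟨hb.2.1.trans h1.1, h1.2.trans ha.2.2⟩, hb.2.1.trans h2.1, h2.2.trans ha.2.2⟩

theorem onSameArc_of_reachable (F : Frame T m s e) {t : ℕ} {x y x' y' : Fin n}
    (hc : Chord T m s e t x y) (hc' : Chord T m s e t x' y')
    (h : (classGraph T m s e t).Reachable x x') :
    OnSameArc T s(x, y) x x' ∧ OnSameArc T s(x, y) y y' := by
  obtain ⟨a, b, c, d, hg⟩ := F.exists_groupArcs hc
  have h1 := hg.bounds x y hc (Reachable.refl _)
  have h2 := hg.bounds x' y' hc' h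
  rw [hg.onSameArc_iff hc, hg.onSameArc_iff hc]
  exact ⟨Or.inl ⟨h1.1, h2.1⟩, Or.inr ⟨h1.2, h2.2⟩⟩

/-- A path inside a gap meets e-graphs only at the two ends of the gap. The left end `e t` belongs
to the e-graph of the chord that starts at `s (t + m)`, hence the index `t + m`. -/
theorem connectedBy_of_joined (F : Frame T m s e) (hT : T.Connected) {t : ℕ}
    (h : Joined T s e t) {x y x' y' : Fin n} (hc : Chord T m s e (t + m) x y)
    (hr : (classGraph T m s e (t + m)).Reachable (s (t + m)) x)
    (hc' : Chord T m s e (t + 1) x' y')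
    (hr' : (classGraph T m s e (t + 1)).Reachable (s (t + 1)) x') :
    ConnectedBy T s(x, y) s(x', y') (e t) (s (t + 1)) := by
  have hm := F.two_le
  have hnmod : ∀ i, i % m = (t + m) % m → i % m = (t + 1) % m → False := by
    intro i h1 h2
    rcases F.m_eq with rfl | rfl <;> omega
  have he : e t ∈ eGraphPoints T s(x, y) := by
    rw [← eGraphPoints_congr (F.eGraph_eq_of_reachable (F.chord_start _) hc hr)]
    exact F.e_mem_eGraphPoints hT t
  have hs : s (t + 1) ∈ eGraphPoints T s(x', y') := by
    rw [← eGraphPoints_congr (F.eGraph_eq_of_reachable (F.chord_start _) hc' hr')]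
    exact F.s_mem_eGraphPoints hT _
  obtain ⟨q⟩ := h
  have hle : gapGraph T s e t ≤ T := fun _ _ h => h.1
  refine ⟨fun h1 => ?_, he, hs, q.mapLe hle, ?_, ?_⟩
  · exact hnmod _ rfl (F.of_eGraph_eq hT hc hc' h1).1
  · intro b hb
    rw [Walk.edges_mapLe_eq_edges] at hb
    have := q.edges_subset_edgeSet hb
    induction b with
    | _ z w => exact this.2.1
  · intro z hz
    rw [Walk.support_mapLe_eq_support] at hz
    classical
    have harc := onArc_of_gapGraph_reachable (q.takeUntil z hz).reachable
    have hends : ∀ {i : ℕ} {a b : Fin n}, Chord T m s e i a b → z ∈ eGraphPoints T s(a, b) →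
        z = e t ∨ z = s (t + 1) := by
      intro i a b hab hza
      rcases (F.mem_eGraphPoints hT hab hza).1 with h1 | h1 <;> exact F.eq_or_eq_of_inGap h1 harc
    refine ⟨fun h1 => ?_, fun h1 => ?_, fun g hg h1 h2 h3 => ?_⟩
    · refine (hends hc h1).resolve_right ?_
      rintro rfl
      exact hnmod _ rfl (F.mod_eq_of_inBlock_or (F.mem_eGraphPoints hT hc h1).1
        (F.mem_eGraphPoints hT hc' hs).1)
    · refine (hends hc' h1).resolve_left ?_
      rintro rfl
      exact hnmod _ rfl (F.mod_eq_of_inBlock_or (F.mem_eGraphPoints hT hc he).1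
        (F.mem_eGraphPoints hT hc' h1).1)
    · induction g with
      | _ a b =>
      obtain ⟨i, hi⟩ := F.cov' hg
      rcases hends hi h3 with rfl | rfl
      · exact h1 (F.eGraph_eq_of_common_point hT hi hc h3 he)
      · exact h2 (F.eGraph_eq_of_common_point hT hi hc' h3 hs)

/-- The points of the step graphs: `a t` and `b t` are the endpoints in the block `t` of the
selected edges in the e-graphs of the chords that start and end at the bounds of this block. -/
theorem exists_points (F : Frame T m s e) (hT : T.Connected) {R : Set (Sym2 (Fin n))}
    (hR : IsSelection T R) : ∃ a b : ℕ → Fin n,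
      (∀ t, a (t + 2 * m) = a t ∧ b (t + 2 * m) = b t) ∧
      (∀ t, Merged T m s e t → a t = b t) ∧ (∀ t, ¬ Merged T m s e t → a t < b t) ∧
      (∀ i j, i < j → j < 2 * m → b i < a j) ∧
      (∀ p q, (stepTwo T R).Adj p q ↔ ∃ t, s(p, q) = s(a t, b (t + m))) ∧
      ∀ p q, (stepThree T R).Adj p q ↔ (∃ t, s(p, q) = s(a t, b (t + m))) ∨
        ∃ t, Joined T s e t ∧ s(p, q) = s(b t, a (t + 1)) := by
  obtain ⟨X, Y, hc, hr, hXR, huniq, hRiff⟩ := F.exists_selected hT hR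
  have hm := F.two_le
  have htwo : ∀ t, t + m + m = t + 2 * m := fun t => by ring
  have hperX : ∀ t, X t = X (t + 2 * m) ∧ Y t = Y (t + 2 * m) := by
    intro t
    refine huniq _ _ _ ?_ ?_ (hXR t)
    · rw [F.chord_congr (F.add_two_mul t)]
      exact hc t
    · rw [F.classGraph_congr (t := t + 2 * m) (t' := t) (by
        rcases F.m_eq with rfl | rfl <;> omega), F.per_s]
      exact hr t
  have hYb : ∀ t, InBlock s e t (Y (t + m)) := by
    intro t
    have := (hc (t + m)).2.2
    rwa [htwo, F.inBlock_congr (F.add_two_mul t)] at this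
  have hYr : ∀ t, (classGraph T m s e t).Reachable (e t) (Y (t + m)) := by
    intro t
    have h1 := hr (t + m)
    have h2 := (hc (t + m)).reachable
    rw [F.classGraph_add] at h1 h2
    exact (F.chord_end t).reachable.trans (h1.trans h2)
  have hYback : ∀ t, Y (t + m + m) = Y t := fun t => by rw [htwo, ← (hperX t).2]
  have hselected : ∀ {r : Sym2 (Fin n)} {t : ℕ}, r ∈ R →
      eGraph T r = eGraph T s(s t, e (t + m)) → r = s(X t, Y t) := by
    intro r t hrR hrt
    obtain ⟨i, rfl⟩ := (hRiff r).1 hrR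
    obtain ⟨h1, h2⟩ := F.of_eGraph_eq hT (F.chord_start t) (hc i) hrt.symm
    rcases F.chord_of_mod_eq h1.symm (hc i) with h3 | h3
    · obtain ⟨h4, h5⟩ := huniq t _ _ h3 h2 hrR
      rw [h4, h5]
    · rw [Sym2.eq_swap] at hrR ⊢
      obtain ⟨h4, h5⟩ := huniq t _ _ h3 (h2.trans h3.reachable.symm) hrR
      rw [h4, h5]
  have hstart : ∀ {r : Sym2 (Fin n)} {t : ℕ}, r ∈ R → s t ∈ eGraphPoints T r → r = s(X t, Y t) := by
    intro r t hrR hmem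
    refine hselected hrR ?_
    obtain ⟨i, rfl⟩ := (hRiff r).1 hrR
    exact F.eGraph_eq_of_common_point hT (hc i) (F.chord_start t) hmem (F.s_mem_eGraphPoints hT t)
  have hend : ∀ {r : Sym2 (Fin n)} {t : ℕ}, r ∈ R → e t ∈ eGraphPoints T r →
      r = s(X (t + m), Y (t + m)) := by
    intro r t hrR hmem
    refine hselected hrR ?_
    obtain ⟨i, rfl⟩ := (hRiff r).1 hrR
    exact F.eGraph_eq_of_common_point hT (hc i) (F.chord_start _) hmem (F.e_mem_eGraphPoints hT t)
  -- the endpoints on the arcs of the ends of a gap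
  have hleft : ∀ {t : ℕ} {a : Fin n}, a ∈ s(X (t + m), Y (t + m)) →
      OnSameArc T s(X (t + m), Y (t + m)) a (e t) → a = Y (t + m) := by
    intro t a ha hs
    rcases Sym2.mem_iff.1 ha with rfl | rfl
    · rcases F.inBlock_of_onSameArc (hc _) hs with ⟨h1, h2⟩ | ⟨h1, h2⟩
      · have := F.mod_eq_of_inBlock h2 (F.inBlock_e t)
        rcases F.m_eq with rfl | rfl <;> omega
      · have := F.mod_eq_of_inBlock h1 (hc (t + m)).2.1
        rcases F.m_eq with rfl | rfl <;> omega
    · rfl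
  have hright : ∀ {t : ℕ} {a : Fin n}, a ∈ s(X t, Y t) →
      OnSameArc T s(X t, Y t) a (s t) → a = X t := by
    intro t a ha hs
    rcases Sym2.mem_iff.1 ha with rfl | rfl
    · rfl
    · rcases F.inBlock_of_onSameArc (hc _) hs with ⟨h1, h2⟩ | ⟨h1, h2⟩
      · have := F.mod_eq_of_inBlock h1 (hc t).2.2
        rcases F.m_eq with rfl | rfl <;> omega
      · have := F.mod_eq_of_inBlock h2 (F.inBlock_s t)
        rcases F.m_eq with rfl | rfl <;> omega
  have htwoadj : ∀ p q, (stepTwo T R).Adj p q ↔ ∃ t, s(p, q) = s(X t, Y (t + m + m)) := by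
    intro p q
    rw [stepTwo_adj_iff hR, hRiff]
    simp only [hYback]
  -- The second point of the block `t` comes from the edge selected for `t + m`, since the chord
  -- starting at `s (t + m)` ends at `e t`.
  refine ⟨X, fun t => Y (t + m), fun t => ⟨(hperX t).1.symm, ?_⟩, fun t ht => ?_, fun t ht => ?_,
    fun i j hij hj => ?_, htwoadj, fun p q => ?_⟩
  · change Y (t + 2 * m + m) = Y (t + m)
    rw [show t + 2 * m + m = t + m + 2 * m by ring]
    exact (hperX _).2.symm
  · refine ((huniq t (Y (t + m)) (X (t + m)) (F.chord_swap.1 (hc _))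
      (ht.trans (hYr t)) ?_).1).symm
    rw [Sym2.eq_swap]
    exact hXR _
  -- In the reverse order the second point would lie between two chords joined to `s t`, hence be
  -- joined to `s t` itself, and the class would be merged.
  · by_contra hno
    refine ht ?_
    rcases F.reachable_of_between hT (F.chord_start t) (hc t) (hYb t).1 (not_lt.1 hno) with h1 | h1
    · exact h1.symm.trans (hYr t).symm
    · exact (hr t).trans (h1.symm.trans (hYr t).symm)
  · exact (hYb i).2.trans_lt ((F.lt i j hij hj).trans_le (hc j).2.1.1)
  · change (stepTwo T R).Adj p q ∨ (fromEdgeSet _).Adj p q ↔ _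
    rw [htwoadj, fromEdgeSet_adj]
    refine or_congr Iff.rfl ⟨?_, ?_⟩
    · rintro ⟨⟨r₁, hr₁, r₂, hr₂, u, v, hcon, a, ha, b, hb, hau, hbv, hab⟩, -⟩
      obtain ⟨t, ht, ⟨rfl, rfl⟩ | ⟨rfl, rfl⟩⟩ :=
        F.exists_joined_of_connectedBy hT (hR.1 _ hr₁) (hR.1 _ hr₂) hcon
      · obtain rfl := hend hr₁ hcon.2.1
        obtain rfl := hstart hr₂ hcon.2.2.1
        exact ⟨t, ht, by rw [hab, hleft ha hau, hright hb hbv]⟩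
      · obtain rfl := hstart hr₁ hcon.2.1
        obtain rfl := hend hr₂ hcon.2.2.1
        exact ⟨t, ht, by rw [hab, hright ha hau, hleft hb hbv, Sym2.eq_swap]⟩
    · rintro ⟨t, ht, hpq⟩
      refine ⟨⟨_, hXR (t + m), _, hXR (t + 1), e t, s (t + 1), F.connectedBy_of_joined hT ht
        (hc _) (hr _) (hc _) (hr _), Y (t + m), Sym2.mem_mk_right _ _, X (t + 1),
        Sym2.mem_mk_left _ _, ?_, ?_, hpq⟩, ?_⟩
      · have := (F.onSameArc_of_reachable (hc _) (F.chord_start (t + m)) (hr _).symm).2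
        rwa [htwo, F.per_e] at this
      · exact (F.onSameArc_of_reachable (hc _) (F.chord_start (t + 1)) (hr _).symm).1
      · rintro rfl
        have h1 : Y (t + m) = X (t + 1) := by
          rcases Sym2.eq_iff.1 hpq with ⟨h1, h2⟩ | ⟨h1, h2⟩
          · exact h1.symm.trans h2
          · exact h2.symm.trans h1
        have := F.mod_eq_of_inBlock (hYb t) (h1 ▸ (hc (t + 1)).2.1)
        rcases F.m_eq with rfl | rfl <;> omega

end Frame

end Connections

end CircleTree

namespace CircleTree

open SimpleGraph

/-! ### Trees of genus one as spanning trees on the e-graphs -/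

section Spanning

/-- In a walk between disjoint sets `A` and `B` there is a part between `A` and `B` with no other
points in these sets, if the edges of `G` that are not in `H` do not leave `A`. -/
theorem exists_reachable_avoiding {V : Type*} {G H : SimpleGraph V} {A B : V → Prop} {u v : V}
    (h : G.Reachable u v) (hAB : ∀ x, A x → ¬ B x) (hu : A u) (hv : B v)
    (hGH : ∀ x y, G.Adj x y → H.Adj x y ∨ ((A x ∨ B x) ∧ (A x → A y))) :
    ∃ a b, A a ∧ B b ∧ ∃ N : SimpleGraph V, N ≤ H ∧ N.Reachable a b ∧
      ∀ x y, N.Adj x y → (A x ∨ B x → x = a ∨ x = b) := by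
  let N : V → V → SimpleGraph V := fun a b =>
    { Adj := fun x y => H.Adj x y ∧ (A x ∨ B x → x = a ∨ x = b) ∧ (A y ∨ B y → y = a ∨ y = b)
      symm := ⟨fun _ _ h => ⟨h.1.symm, h.2.2, h.2.1⟩⟩
      loopless := ⟨fun _ h => h.1.ne rfl⟩ }
  -- Along the walk, `a` is the most recent point of `A`. The invariant can fail only on entering
  -- `B`, and the part since `a` is then as required.
  obtain ⟨x, y, hxy, ⟨hx1, hx2⟩, hy⟩ := exists_adj_of_reachable h
    (P := fun x => ¬ B x ∧ ∃ a, A a ∧ (N a x).Reachable a x ∧ (A x → a = x))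
    ⟨hAB u hu, u, hu, Reachable.refl _, fun _ => rfl⟩ (fun h => h.1 hv)
  obtain ⟨a, ha, hax, hAx⟩ := hx2
  rcases hGH x y hxy with hH | ⟨h1, h2⟩
  · have hstep : ¬ A y → (N a y).Reachable a y := by
      intro hAy
      refine Reachable.trans (v := x) (hax.mono ?_) (Adj.reachable (G := N a y) ⟨hH, ?_, ?_⟩)
      · rintro z w ⟨hzw, hz, hw⟩
        refine ⟨hzw, fun h => Or.inl ?_, fun h => Or.inl ?_⟩
        · rcases hz h with h3 | rfl
          · exact h3
          · exact (hAx (h.resolve_right hx1)).symm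
        · rcases hw h with h3 | rfl
          · exact h3
          · exact (hAx (h.resolve_right hx1)).symm
      · exact fun h => Or.inl (hAx (h.resolve_right hx1)).symm
      · exact fun _ => Or.inr rfl
    by_cases hB : B y
    · have hAy : ¬ A y := fun h => hAB y h hB
      exact ⟨a, y, ha, hB, N a y, fun _ _ h => h.1, hstep hAy, fun _ _ h => h.2.1⟩
    · refine absurd ⟨hB, ?_⟩ hy
      by_cases hA : A y
      · exact ⟨y, hA, Reachable.refl _, fun _ => rfl⟩
      · exact ⟨a, ha, hstep hA, fun h => absurd h hA⟩
  · have hAy := h2 (h1.resolve_right hx1)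
    exact absurd ⟨hAB y hAy, y, hAy, Reachable.refl _, fun _ => rfl⟩ hy

/-- A path does not use its first edge again. -/
theorem exists_adj_reachable_deleteEdges {V : Type*} {G : SimpleGraph V} {u v : V}
    (h : G.Reachable u v) (hne : u ≠ v) :
    ∃ w, G.Adj u w ∧ (G.deleteEdges {s(u, w)}).Reachable w v := by
  classical
  obtain ⟨p, hp⟩ := h.exists_isPath
  cases p with
  | nil => exact absurd rfl hne
  | @cons _ w _ hadj q =>
    refine ⟨w, hadj, ⟨q.transfer _ fun b hb => ?_⟩⟩
    rw [Walk.cons_isPath_iff] at hp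
    rw [edgeSet_deleteEdges]
    refine ⟨q.edges_subset_edgeSet hb, ?_⟩
    rintro rfl
    exact hp.2 (q.fst_mem_support_of_mem_edges hb)

variable {n m : ℕ} {T : SimpleGraph (Fin n)} {s e : ℕ → Fin n}

namespace Frame

/-- The e-graphs are connected by the merged classes and the joined blocks. -/
theorem iff_of_connected (F : Frame T m s e) (hT : T.Connected) {X : ℕ → Prop}
    (hper : ∀ i, X (i + 2 * m) ↔ X i) (hM : ∀ i, Merged T m s e i → (X (i + m) ↔ X i))
    (hJ : ∀ i, Joined T s e i → (X (i + m) ↔ X (i + 1))) {i j : ℕ} (hi : X i) : X j := by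
  have hm := F.m_eq
  by_contra hj
  -- `Q t` contains the points of the e-graph of the chord starting at `s t`. The upper bound `e t`
  -- belongs to the index `t + m`.
  let Q : ℕ → Fin n → Prop := fun t v =>
    (InBlock s e t v ∨ InBlock s e (t + m) v) ∧ (classGraph T m s e t).Reachable (s t) v
  have hmodeq : ∀ i, X (i % (2 * m)) ↔ X i := by
    intro i
    conv_rhs => rw [← Nat.mod_add_div i (2 * m)]
    induction i / (2 * m) with
    | zero => simp
    | succ k ih => rw [Nat.mul_succ, ← add_assoc, hper, ih]
  have hiff : ∀ {t t' : ℕ}, t % m = t' % m → (classGraph T m s e t).Reachable (s t) (s t') →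
      (X t ↔ X t') := by
    intro t t' hmod hr
    by_cases h : t % (2 * m) = t' % (2 * m)
    · rw [← hmodeq t, h, hmodeq]
    · have h1 : (t + m) % (2 * m) = t' % (2 * m) := by rcases hm with rfl | rfl <;> omega
      rw [← hmodeq t', ← h1, hmodeq]
      refine (hM t ?_).symm
      rw [← F.s_congr h1] at hr
      exact hr.trans (F.chord_end t).reachable.symm
  have hQ : ∀ {t t' : ℕ} {v : Fin n}, Q t v → Q t' v → (X t ↔ X t') := by
    intro t t' v h1 h2
    have hmod := F.mod_eq_of_inBlock_or h1.1 h2.1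
    refine hiff hmod (h1.2.trans ?_)
    rw [F.classGraph_congr hmod]
    exact h2.2.symm
  have hQs : ∀ t, Q t (s t) := fun t => ⟨Or.inl (F.inBlock_s t), Reachable.refl _⟩
  have hQe : ∀ t, Q (t + m) (e t) := by
    intro t
    refine ⟨Or.inr ?_, ?_⟩
    · rw [F.inBlock_congr (t := t + m + m) (t' := t) (by rcases hm with rfl | rfl <;> omega)]
      exact F.inBlock_e t
    · rw [F.classGraph_add]
      exact (F.chord_end t).reachable.symm
  let A : Fin n → Prop := fun v => ∃ t, X t ∧ Q t v
  let B : Fin n → Prop := fun v => ∃ t, ¬ X t ∧ Q t v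
  obtain ⟨a, b, ⟨t, hXt, hQt⟩, ⟨t', hXt', hQt'⟩, N, hN, hab, hav⟩ :=
    exists_reachable_avoiding (H := uncrossedGraph T) (A := A) (B := B)
      (hT.preconnected (s i) (s j))
      (fun x ⟨t, h1, h2⟩ ⟨t', h3, h4⟩ => h3 ((hQ h2 h4).1 h1)) ⟨i, hi, hQs i⟩ ⟨j, hj, hQs j⟩ (by
        intro x y hxy
        rcases uncrossed_or_crossed (show s(x, y) ∈ T.edgeSet from hxy) with h | h
        · exact Or.inl ⟨hxy, h⟩
        · right
          obtain ⟨k, z, w, hzw, hc, hr⟩ := F.exists_chord_of_crossed hT h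
          have hz : Q k z := ⟨Or.inl hc.2.1, hr⟩
          have hw : Q k w := ⟨Or.inr hc.2.2, hr.trans hc.reachable⟩
          have hx : Q k x := by
            rcases Sym2.eq_iff.1 hzw with ⟨rfl, rfl⟩ | ⟨rfl, rfl⟩ <;> assumption
          have hy : Q k y := by
            rcases Sym2.eq_iff.1 hzw with ⟨rfl, rfl⟩ | ⟨rfl, rfl⟩ <;> assumption
          refine ⟨?_, ?_⟩
          · by_cases hk : X k
            · exact Or.inl ⟨k, hk, hx⟩
            · exact Or.inr ⟨k, hk, hx⟩
          · rintro ⟨l, hl, hlx⟩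
            exact ⟨k, (hQ hlx hx).1 hl, hy⟩)
  -- Within one class the path would join the two e-graphs, and `X` does not distinguish merged
  -- ones.
  have hmod : t % m ≠ t' % m := by
    intro hmod
    refine hXt' ((hiff hmod (hQt.2.trans ((hab.mono (hN.trans
      (uncrossedGraph_le_classGraph t))).trans ?_))).1 hXt)
    rw [F.classGraph_congr hmod]
    exact hQt'.2.symm
  have hbound : ∀ x, (∃ t, x = s t ∨ x = e t) → A x ∨ B x := by
    rintro x ⟨k, rfl | rfl⟩
    · by_cases hk : X k
      · exact Or.inl ⟨k, hk, hQs k⟩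
      · exact Or.inr ⟨k, hk, hQs k⟩
    · by_cases hk : X (k + m)
      · exact Or.inl ⟨_, hk, hQe k⟩
      · exact Or.inr ⟨_, hk, hQe k⟩
  have hreach : (avoidGraph T s e a b).Reachable a b := hab.mono fun x y hxy =>
    ⟨(hN hxy).1, (hN hxy).2, fun t ht => hav x y hxy (hbound x ⟨t, ht⟩),
      fun t ht => hav y x hxy.symm (hbound y ⟨t, ht⟩)⟩
  obtain ⟨τ, hτ, h⟩ : ∃ τ, Joined T s e τ ∧
      ((a = e τ ∧ b = s (τ + 1)) ∨ (b = e τ ∧ a = s (τ + 1))) := by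
    rcases hQt.1 with h1 | h1 <;> rcases hQt'.1 with h2 | h2 <;>
      exact F.exists_gap_of_avoidGraph_reachable hreach h1 h2 (by simpa using hmod)
  rcases h with ⟨rfl, rfl⟩ | ⟨rfl, rfl⟩
  · exact hXt' ((hQ hQt' (hQs _)).2 ((hJ τ hτ).1 ((hQ hQt (hQe τ)).1 hXt)))
  · exact hXt' ((hQ hQt' (hQe τ)).2 ((hJ τ hτ).2 ((hQ hQt (hQs _)).1 hXt)))

end Frame

/-- The edges with both ends in the blocks `t` and `t + m`. -/
def blockGraph (T : SimpleGraph (Fin n)) (m : ℕ) (s e : ℕ → Fin n) (t : ℕ) :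
    SimpleGraph (Fin n) where
  Adj x y := T.Adj x y ∧ (InBlock s e t x ∨ InBlock s e (t + m) x) ∧
    (InBlock s e t y ∨ InBlock s e (t + m) y)
  symm := ⟨fun _ _ h => ⟨h.1.symm, h.2.2, h.2.1⟩⟩
  loopless := ⟨fun _ h => h.1.ne rfl⟩

theorem Chord.blockGraph_adj {t : ℕ} {x y : Fin n} (h : Chord T m s e t x y) :
    (blockGraph T m s e t).Adj x y := ⟨h.1, Or.inl h.2.1, Or.inr h.2.2⟩

namespace Frame

/-- The outer and the inner chord separate the blocks from the rest. A path that wanders off returns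
at an endpoint of the same chord and can be replaced by this chord. The retraction `f` sends the
outside to `s t` and the inside to `e t`. Connections within a class thus become independent of the
edges in the gaps. -/
theorem blockGraph_reachable_of_lt (F : Frame T m s e) {t : ℕ} (ht : t < m)
    (h : Merged T m s e t) : (blockGraph T m s e t).Reachable (s t) (e t) := by
  classical
  have hst := F.chord_start t
  have hen := F.chord_end t
  have o1 := F.le t
  have o2 := F.lt t (t + m) (by omega) (by omega)
  have o3 := F.le (t + m)
  simp only [Fin.le_def, Fin.lt_def] at o1 o2 o3
  let f : Fin n → Fin n := fun x =>
    if x < s t ∨ e (t + m) < x then s t else if e t < x ∧ x < s (t + m) then e t else x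
  have hf1 : ∀ x, x < s t ∨ e (t + m) < x → f x = s t := fun x hx => if_pos hx
  have hf2 : ∀ x, e t < x ∧ x < s (t + m) → f x = e t := by
    intro x hx
    simp only [Fin.lt_def] at hx
    have h1 : ¬ (x < s t ∨ e (t + m) < x) := by
      simp only [Fin.lt_def]
      omega
    exact (if_neg h1).trans (if_pos (by simpa only [Fin.lt_def] using hx))
  have hf3 : ∀ x, InBlock s e t x ∨ InBlock s e (t + m) x → f x = x := by
    intro x hx
    simp only [InBlock, Fin.le_def] at hx
    have h1 : ¬ (x < s t ∨ e (t + m) < x) := by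
      simp only [Fin.lt_def]
      omega
    have h2 : ¬ (e t < x ∧ x < s (t + m)) := by
      simp only [Fin.lt_def]
      omega
    exact (if_neg h1).trans (if_neg h2)
  have hcases : ∀ x : Fin n, (x < s t ∨ e (t + m) < x) ∨ (e t < x ∧ x < s (t + m)) ∨
      (InBlock s e t x ∨ InBlock s e (t + m) x) := by
    intro x
    simp only [InBlock, Fin.le_def, Fin.lt_def]
    omega
  have hchord : (blockGraph T m s e t).Reachable (s t) (e (t + m)) :=
    hst.blockGraph_adj.reachable
  have hchord' : (blockGraph T m s e t).Reachable (e t) (s (t + m)) :=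
    hen.blockGraph_adj.reachable
  -- the end of an edge that starts outside the blocks
  have hout : ∀ {x y}, (classGraph T m s e t).Adj x y → (x < s t ∨ e (t + m) < x) →
      (blockGraph T m s e t).Reachable (s t) (f y) := by
    intro x y hxy hx
    have h1 := F.not_cross_of_classGraph_adj hst hxy
    rw [not_cross_iff_of_lt (Fin.lt_def.2 (by omega))] at h1
    have hy : (y < s t ∨ e (t + m) < y) ∨ y = s t ∨ y = e (t + m) := by
      simp only [Fin.lt_def, Fin.ext_iff] at *
      omega
    rcases hy with hy | rfl | rfl
    · rw [hf1 y hy]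
    · rw [hf3 _ (Or.inl (F.inBlock_s t))]
    · rw [hf3 _ (Or.inr (F.inBlock_e _))]
      exact hchord
  have hin : ∀ {x y}, (classGraph T m s e t).Adj x y → (e t < x ∧ x < s (t + m)) →
      (blockGraph T m s e t).Reachable (e t) (f y) := by
    intro x y hxy hx
    have h1 := F.not_cross_of_classGraph_adj hen hxy
    rw [not_cross_iff_of_lt (Fin.lt_def.2 (by omega))] at h1
    have hy : (e t < y ∧ y < s (t + m)) ∨ y = e t ∨ y = s (t + m) := by
      simp only [Fin.lt_def, Fin.ext_iff] at *
      omega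
    rcases hy with hy | rfl | rfl
    · rw [hf2 y hy]
    · rw [hf3 _ (Or.inl (F.inBlock_e t))]
    · rw [hf3 _ (Or.inr (F.inBlock_s _))]
      exact hchord'
  have key := reachable_induction
    (P := fun x => (blockGraph T m s e t).Reachable (s t) (f x)) h (by
      intro x y hxy hr
      rcases hcases x with hx | hx | hx
      · exact hout hxy hx
      · rw [hf2 x hx] at hr
        exact hr.trans (hin hxy hx)
      · rw [hf3 x hx] at hr
        rcases hcases y with hy | hy | hy
        · rw [hf1 y hy]
        · rw [hf2 y hy]
          have := hin hxy.symm hy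
          rw [hf3 x hx] at this
          exact hr.trans this.symm
        · rw [hf3 y hy]
          exact hr.trans (Adj.reachable (G := blockGraph T m s e t) ⟨hxy.1, hx, hy⟩))
    (by rw [hf3 _ (Or.inl (F.inBlock_s t))])
  rwa [hf3 _ (Or.inl (F.inBlock_e t))] at key

theorem blockGraph_congr (F : Frame T m s e) {t t' : ℕ} (h : t % m = t' % m) :
    blockGraph T m s e t = blockGraph T m s e t' := by
  have h1 : (t % (2 * m) = t' % (2 * m) ∧ (t + m) % (2 * m) = (t' + m) % (2 * m)) ∨
      (t % (2 * m) = (t' + m) % (2 * m) ∧ (t + m) % (2 * m) = t' % (2 * m)) := by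
    rcases F.m_eq with rfl | rfl <;> omega
  ext x y
  simp only [blockGraph]
  rcases h1 with ⟨h1, h2⟩ | ⟨h1, h2⟩
  · rw [F.inBlock_congr h1, F.inBlock_congr h2]
  · rw [F.inBlock_congr h1, F.inBlock_congr h2, or_comm (a := InBlock s e (t' + m) x),
      or_comm (a := InBlock s e (t' + m) y)]

theorem blockGraph_reachable (F : Frame T m s e) {t : ℕ} (h : Merged T m s e t) :
    (blockGraph T m s e t).Reachable (s t) (s (t + m)) := by
  have hm := F.m_eq
  have hpos : 0 < m := by omega
  have hM : Merged T m s e (t % m) := by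
    have h1 : t % (2 * m) = (t % m) % (2 * m) ∨ t % (2 * m) = (t % m + m) % (2 * m) := by
      rcases hm with rfl | rfl <;> omega
    rcases h1 with h1 | h1
    · exact (F.merged_congr h1).1 h
    · exact (F.merged_add _).1 ((F.merged_congr h1).1 h)
  have h2 := (F.blockGraph_reachable_of_lt (Nat.mod_lt _ hpos) hM).trans
    (F.chord_end (t % m)).blockGraph_adj.reachable
  rw [F.blockGraph_congr (Nat.mod_mod t m)] at h2
  have h1 : (t % (2 * m) = (t % m) % (2 * m) ∧ (t + m) % (2 * m) = (t % m + m) % (2 * m)) ∨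
      (t % (2 * m) = (t % m + m) % (2 * m) ∧ (t + m) % (2 * m) = (t % m) % (2 * m)) := by
    rcases hm with rfl | rfl <;> omega
  rcases h1 with ⟨h1, h3⟩ | ⟨h1, h3⟩
  · rwa [F.s_congr h1, F.s_congr h3]
  · rw [F.s_congr h1, F.s_congr h3]
    exact h2.symm

/-- Consequently an edge in one gap starting at `e t` lies in no other gap, even if the block `t` is
a single point that both gaps share. -/
theorem eq_of_onArc_gaps (F : Frame T m s e) {t t' : ℕ} {w : Fin n}
    (ht : t % (2 * m) ≠ t' % (2 * m)) (h : OnArc (e t) (s (t + 1)) w)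
    (h' : OnArc (e t') (s (t' + 1)) w) (he : OnArc (e t') (s (t' + 1)) (e t)) : w = e t := by
  have hm := F.m_eq
  rcases F.eq_or_eq_of_inGap (F.inBlock_e t) he with h1 | h1
  · exact absurd h1 (F.e_ne_e ht)
  · have hmod := F.mod_eq_of_inBlock (F.inBlock_e t) (h1 ▸ F.inBlock_s (t' + 1))
    rw [← h1] at h'
    have hmod2 : t' % (2 * m) = (t + 2 * m - 1) % (2 * m) := by
      rcases hm with rfl | rfl <;> omega
    have h2 := F.sub_lt_sub (F.inBlock_e t) (F.inBlock_s (t + 1))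
      (F.inBlock_e (t + 2 * m - 1)) (by omega) (by omega) (Or.inl (by omega))
    rw [← F.e_congr hmod2] at h2
    unfold OnArc at h h'
    rw [Fin.le_def] at h h'
    have c1 := fin_val_sub_cases w (e t')
    have c2 := fin_val_sub_cases (e t) (e t')
    have c3 := fin_val_sub_cases w (e t)
    have c4 := fin_val_sub_cases (e t') (e t)
    have := w.isLt
    have := (e t).isLt
    have := (e t').isLt
    exact Fin.ext (by omega)

/-- No joined pair of blocks can be left out without disconnecting the e-graphs. -/
theorem exists_separation (F : Frame T m s e) (hT : T.IsTree) {t : ℕ} (ht : Joined T s e t) :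
    ∃ X : ℕ → Prop, (∀ i, X (i + 2 * m) ↔ X i) ∧ (∀ i, Merged T m s e i → (X (i + m) ↔ X i)) ∧
      (∀ i, i % (2 * m) ≠ t % (2 * m) → Joined T s e i → (X (i + m) ↔ X (i + 1))) ∧
      X (t + m) ∧ ¬ X (t + 1) := by
  classical
  have hm := F.m_eq
  have htree := hT.isAcyclic
  have hne : e t ≠ s (t + 1) := F.e_ne_s (by rcases hm with rfl | rfl <;> omega)
  -- The first edge of a path through the gap `t`. In a tree it is a bridge, while the rest of the
  -- path stays available after its removal.
  obtain ⟨w, hw, hwr'⟩ := exists_adj_reachable_deleteEdges ht hne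
  have hwr : (T.deleteEdges {s(e t, w)}).Reachable w (s (t + 1)) :=
    hwr'.mono (deleteEdges_mono (show gapGraph T s e t ≤ T from fun _ _ h => h.1))
  have hbridge : ¬ (T.deleteEdges {s(e t, w)}).Reachable (e t) w := by
    have := isAcyclic_iff_forall_adj_isBridge.1 htree hw.1
    rw [isBridge_iff] at this
    exact this
  have hmono : ∀ {G : SimpleGraph (Fin n)} {x y : Fin n}, G ≤ T → ¬ G.Adj (e t) w →
      G.Reachable x y → (T.deleteEdges {s(e t, w)}).Reachable x y := by
    intro G x y hG hb h
    refine h.mono fun z z' hz => ?_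
    rw [deleteEdges_adj]
    refine ⟨hG hz, fun h1 => hb ?_⟩
    have : s(z, z') ∈ G.edgeSet := hz
    rwa [Set.mem_singleton_iff.1 h1] at this
  have hchord : ∀ {i x y}, Chord T m s e i x y →
      (T.deleteEdges {s(e t, w)}).Reachable x y := by
    intro i x y hc
    refine Adj.reachable ?_
    rw [deleteEdges_adj]
    refine ⟨hc.1, fun h1 => ?_⟩
    obtain ⟨-, g, hg, hg'⟩ := F.crossed_of_chord hc
    rw [Set.mem_singleton_iff.1 h1] at hg'
    exact hw.2.1.2 g hg hg'
  have heq : ∀ {x y z}, (T.deleteEdges {s(e t, w)}).Reachable x y →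
      ((T.deleteEdges {s(e t, w)}).Reachable x z ↔
        (T.deleteEdges {s(e t, w)}).Reachable y z) :=
    fun h => ⟨fun h1 => h.symm.trans h1, fun h1 => h.trans h1⟩
  -- `X` is one side of this bridge. Chords, connections inside blocks and paths through other gaps
  -- do not use the removed edge, so they do not change sides.
  refine ⟨fun i => (T.deleteEdges {s(e t, w)}).Reachable (s i) (e t), fun i => ?_, fun i hi => ?_,
    fun i hit hi => ?_, ?_, fun h => ?_⟩
  · change (T.deleteEdges {s(e t, w)}).Reachable (s (i + 2 * m)) (e t) ↔ _
    rw [F.per_s]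
  · refine heq (hmono (G := blockGraph T m s e i) (fun _ _ h => h.1) (fun hb => ?_) (F.blockGraph_reachable hi)).symm
    have h1 : w = s (t + 1) := by
      have h2 : w = e t ∨ w = s (t + 1) := by
        rcases hb.2.2 with h2 | h2 <;> exact F.eq_or_eq_of_inGap h2 hw.2.2.2
      exact h2.resolve_left hw.1.ne'
    have h3 := F.mod_eq_of_inBlock_or hb.2.1 (Or.inl (F.inBlock_e t))
    have h4 := F.mod_eq_of_inBlock_or hb.2.2 (Or.inl (h1 ▸ F.inBlock_s (t + 1)))
    rcases hm with rfl | rfl <;> omega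
  · have h1 : (T.deleteEdges {s(e t, w)}).Reachable (e i) (s (i + 1)) := by
      refine hmono (G := gapGraph T s e i) (fun _ _ h => h.1) (fun hb => ?_) hi
      exact hw.1.ne' (F.eq_of_onArc_gaps (Ne.symm hit) hw.2.2.2 hb.2.2.2 hb.2.2.1)
    exact heq ((hchord (F.chord_end i)).symm.trans h1)
  · exact (hchord (F.chord_end t)).symm
  · exact hbridge (h.symm.trans hwr.symm)

end Frame

end Spanning

end CircleTree

namespace CircleTree

open SimpleGraph

/-! ### Numerical codes for forms and reductions -/

section Codes

/-- The list `L` of pairs contains one of `(a, b)` and `(b, a)`. -/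
def joins (L : List (ℕ × ℕ)) (a b : ℕ) : Bool :=
  L.any fun p => (p.1 == a && p.2 == b) || (p.1 == b && p.2 == a)

theorem joins_iff {L : List (ℕ × ℕ)} {a b : ℕ} :
    joins L a b = true ↔ (a, b) ∈ L ∨ (b, a) ∈ L := by
  simp only [joins, List.any_eq_true, Bool.or_eq_true, Bool.and_eq_true, beq_iff_eq, Prod.exists]
  constructor
  · rintro ⟨x, y, h, ⟨rfl, rfl⟩ | ⟨rfl, rfl⟩⟩
    · exact Or.inl h
    · exact Or.inr h
  · rintro (h | h)
    · exact ⟨a, b, h, Or.inl ⟨rfl, rfl⟩⟩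
    · exact ⟨b, a, h, Or.inr ⟨rfl, rfl⟩⟩

theorem joins_comm {L : List (ℕ × ℕ)} {a b : ℕ} : joins L a b = true ↔ joins L b a = true := by
  rw [joins_iff, joins_iff, or_comm]

/-- The graph on `N` points with the edges listed in `L`. -/
def codeGraph (N : ℕ) (L : List (ℕ × ℕ)) : SimpleGraph (Fin N) where
  Adj x y := x ≠ y ∧ joins L x y = true
  symm := ⟨fun _ _ h => ⟨h.1.symm, joins_comm.1 h.2⟩⟩
  loopless := ⟨fun _ h => h.1 rfl⟩

/-- The rotation by `k` maps the edges in `L` to edges in `L'`. -/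
def turns (N k : ℕ) (L L' : List (ℕ × ℕ)) : Bool :=
  L.all fun p => joins L' ((p.1 + k) % N) ((p.2 + k) % N)

/-- The edges in `L` and those in `L'` differ by a rotation. -/
def sameCode (N : ℕ) (L L' : List (ℕ × ℕ)) : Bool :=
  (List.range N).any fun k => turns N k L L' && turns N (N - k) L' L

theorem joins_of_turns {N k : ℕ} {L L' : List (ℕ × ℕ)} (h : turns N k L L' = true) {a b : ℕ}
    (hab : joins L a b = true) : joins L' ((a + k) % N) ((b + k) % N) = true := by
  unfold turns at h
  rw [List.all_eq_true] at h
  rcases joins_iff.1 hab with h1 | h1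
  · exact h _ h1
  · exact joins_comm.1 (h _ h1)

theorem unlabel_eq_of_sameCode {N : ℕ} {L L' : List (ℕ × ℕ)} (h : sameCode N L L' = true) :
    unlabel (codeGraph N L) = unlabel (codeGraph N L') := by
  simp only [sameCode, List.any_eq_true, List.mem_range, Bool.and_eq_true] at h
  obtain ⟨k, hk, h1, h2⟩ := h
  obtain ⟨ρ, hρ⟩ := exists_isRotation k (n := N) (by omega)
  refine unlabel_eq_iff_exists_isRotation.2 ⟨k, ρ, hρ, fun x y => ?_⟩
  refine and_congr (not_congr ρ.injective.eq_iff) ⟨fun h => ?_, fun h => ?_⟩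
  · have := joins_of_turns h2 h
    have hs : ∀ z : Fin N, ((ρ z : ℕ) + (N - k)) % N = z := by
      intro z
      rw [hρ z, Nat.mod_add_mod, show (z : ℕ) + k + (N - k) = z + N by omega, Nat.add_mod_right,
        Nat.mod_eq_of_lt z.isLt]
    rwa [hs, hs] at this
  · have := joins_of_turns h1 h
    rwa [← hρ x, ← hρ y] at this

/-- The pairs in `L` are edges on `N` points. -/
def validCode (N : ℕ) (L : List (ℕ × ℕ)) : Bool := L.all fun p => p.1 < N && p.2 < N && p.1 != p.2

theorem turns_of_rotation {N k : ℕ} {L L' : List (ℕ × ℕ)} {ρ : Fin N ≃ Fin N}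
    (hρ : IsRotation k ρ) (hL : validCode N L = true)
    (h : ∀ x y, (codeGraph N L).Adj x y → (codeGraph N L').Adj (ρ x) (ρ y)) :
    turns N k L L' = true := by
  unfold turns
  rw [List.all_eq_true]
  rintro ⟨a, b⟩ hab
  have hv := List.all_eq_true.1 hL _ hab
  simp only [Bool.and_eq_true, decide_eq_true_eq, bne_iff_ne] at hv
  have := (h ⟨a, hv.1.1⟩ ⟨b, hv.1.2⟩
    ⟨fun h => hv.2 (Fin.ext_iff.1 h), joins_iff.2 (Or.inl hab)⟩).2
  rwa [hρ, hρ] at this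

/-- Together with `unlabel_eq_of_sameCode`, this decides by evaluation whether two coded circle
graphs differ by a rotation. -/
theorem sameCode_of_unlabel_eq {N : ℕ} (hN : 0 < N) {L L' : List (ℕ × ℕ)}
    (hL : validCode N L = true) (hL' : validCode N L' = true)
    (h : unlabel (codeGraph N L) = unlabel (codeGraph N L')) : sameCode N L L' = true := by
  obtain ⟨k, ρ, hρ, ha⟩ := unlabel_eq_iff_exists_isRotation.1 h
  simp only [sameCode, List.any_eq_true, List.mem_range, Bool.and_eq_true]
  refine ⟨k % N, Nat.mod_lt _ hN, turns_of_rotation hρ.mod hL fun x y => (ha x y).2,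
    turns_of_rotation hρ.symm hL' fun x y hxy => ?_⟩
  rw [← ha]
  simpa using hxy

/-- The set `S` of edges is listed by `L`. -/
def Codes {N : ℕ} (L : List (ℕ × ℕ)) (S : Set (Sym2 (Fin N))) : Prop :=
  ∀ x y : Fin N, s(x, y) ∈ S ↔ joins L x y = true

theorem Codes.singleton {N : ℕ} (a b : Fin N) :
    Codes [((a : ℕ), (b : ℕ))] ({s(a, b)} : Set (Sym2 (Fin N))) := by
  intro x y
  rw [Set.mem_singleton_iff, joins_iff, Sym2.eq_iff]
  simp [Fin.ext_iff]
  omega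

theorem Codes.union {N : ℕ} {L L' : List (ℕ × ℕ)} {S S' : Set (Sym2 (Fin N))} (h : Codes L S)
    (h' : Codes L' S') : Codes (L ++ L') (S ∪ S') := by
  intro x y
  rw [Set.mem_union, h x y, h' x y, joins, joins, joins, List.any_append, Bool.or_eq_true]

theorem Codes.insert {N : ℕ} {L : List (ℕ × ℕ)} {S : Set (Sym2 (Fin N))} (a b : Fin N)
    (h : Codes L S) : Codes (((a : ℕ), (b : ℕ)) :: L) (Insert.insert s(a, b) S) :=
  (Codes.singleton a b).union h

/-- The unlabeled circle graph with the edges listed in `L`. -/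
def codeForm (N : ℕ) (L : List (ℕ × ℕ)) : UCGraph := unlabel (codeGraph N L)

theorem Codes.form_eq {N : ℕ} {L : List (ℕ × ℕ)} {S : Set (Sym2 (Fin N))} (h : Codes L S) :
    form N S = codeForm N L := by
  have : fromEdgeSet S = codeGraph N L := by
    ext x y
    rw [fromEdgeSet_adj, h x y, and_comm]
    rfl
  unfold form codeForm
  rw [this]

/-- The number of points of a form, the edges of the pre-reduced form, and for each reduced form
the additional edges. -/
def formTable : List (ℕ × List (ℕ × ℕ) × List (List (ℕ × ℕ))) :=
  [(4, [(0, 2), (1, 3)], [[(0, 1)]]),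
    (6, [(0, 3), (1, 5), (2, 4)], [[(5, 0), (3, 4)], [(5, 0), (2, 3)], [(0, 1), (3, 4)]]),
    (8, [(0, 3), (7, 4), (1, 6), (2, 5)], [[(0, 1), (2, 3), (4, 5)]]),
    (6, [(0, 3), (1, 4), (2, 5)], [[(0, 1), (1, 2)], [(0, 1), (2, 3)]]),
    (8, [(0, 3), (7, 4), (1, 5), (2, 6)],
      [[(4, 5), (0, 1), (5, 6)], [(4, 5), (0, 1), (6, 7)], [(4, 5), (2, 3), (1, 2)],
        [(4, 5), (2, 3), (5, 6)], [(4, 5), (2, 3), (6, 7)], [(6, 7), (2, 3), (1, 2)]]),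
    (10, [(0, 5), (1, 7), (2, 6), (3, 9), (4, 8)],
      [[(0, 1), (2, 3), (4, 5), (5, 6)], [(2, 3), (4, 5), (5, 6), (7, 8)],
        [(0, 1), (2, 3), (4, 5), (9, 0)], [(0, 1), (2, 3), (5, 6), (7, 8)],
        [(0, 1), (4, 5), (5, 6), (9, 0)], [(2, 3), (4, 5), (7, 8), (9, 0)]])]

/-! The sets `μ` of classes with one e-graph and `ν` of joined gaps are given by binary digits. -/

/-- The number of selected points in the block `i`. -/
def width (m μ i : ℕ) : ℕ := if μ.testBit (i % m) then 1 else 2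

/-- The number of selected points before the block `i`. -/
def offset (m μ : ℕ) : ℕ → ℕ
  | 0 => 0
  | i + 1 => offset m μ i + width m μ i

/-- The first selected point in the block `i`. -/
def firstPt (m μ i : ℕ) : ℕ := offset m μ (i % (2 * m))

/-- The last selected point in the block `i`. -/
def lastPt (m μ i : ℕ) : ℕ := offset m μ (i % (2 * m)) + (width m μ (i % (2 * m)) - 1)

/-- The edges of the pre-reduced form. -/
def preEdges (m μ : ℕ) : List (ℕ × ℕ) :=
  (List.range (2 * m)).map fun i => (firstPt m μ i, lastPt m μ (i + m))

/-- The edges of the reduced form. -/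
def redEdges (m μ ν : ℕ) : List (ℕ × ℕ) :=
  preEdges m μ ++ ((List.range (2 * m)).filter fun i => ν.testBit i).map
    fun i => (lastPt m μ i, firstPt m μ (i + 1))

/-- The set `χ` of e-graphs is a union of components, for the gaps `J`. -/
def respects (m μ : ℕ) (J : ℕ → Bool) (χ : ℕ) : Bool :=
  -- Bit `i` of `χ` stands for the e-graph of the chord starting in the block `i`. A merged class
  -- identifies `i` and `i + m`; the gap `i` leads from the e-graph `i + m`, containing the end of
  -- the block `i`, to `i + 1`.
  ((List.range m).all fun i => !μ.testBit i || χ.testBit (i + m) == χ.testBit i) &&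
    (List.range (2 * m)).all fun i =>
      !J i || χ.testBit ((i + m) % (2 * m)) == χ.testBit ((i + 1) % (2 * m))

/-- The gaps `ν` form a spanning tree on the e-graphs. -/
def spanning (m μ ν : ℕ) : Bool :=
  -- Connectedness: only the empty and the full set are unions of components. Minimality: each gap
  -- in `ν` is separated by some set compatible with all other gaps.
  ((List.range (2 ^ (2 * m))).all fun χ =>
    !respects m μ ν.testBit χ || χ == 0 || χ == 2 ^ (2 * m) - 1) &&
  (List.range (2 * m)).all fun i => !ν.testBit i || (List.range (2 ^ (2 * m))).any fun χ =>
    respects m μ (fun j => ν.testBit j && j != i) χ &&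
      χ.testBit ((i + m) % (2 * m)) != χ.testBit ((i + 1) % (2 * m))

/-- The reduction given by `μ` and `ν` is in the table. -/
def classified (m μ ν : ℕ) : Bool :=
  formTable.any fun F => F.1 == offset m μ (2 * m) && sameCode F.1 (preEdges m μ) F.2.1 &&
    F.2.2.any fun X => sameCode F.1 (redEdges m μ ν) (F.2.1 ++ X)

end Codes

end CircleTree

namespace CircleTree

open SimpleGraph

/-! ### The integer model of a reduction -/

section Model

theorem exists_mask (k : ℕ) (P : ℕ → Prop) :
    ∃ μ < 2 ^ k, ∀ i < k, μ.testBit i = true ↔ P i := by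
  classical
  refine ⟨Nat.ofBits fun i : Fin k => decide (P i), Nat.ofBits_lt_two_pow _, fun i hi => ?_⟩
  rw [Nat.testBit_ofBits_lt _ _ hi]
  exact decide_eq_true_iff

theorem respects_iff {m μ χ : ℕ} {J : ℕ → Bool} : respects m μ J χ = true ↔
    (∀ i < m, μ.testBit i = true → χ.testBit (i + m) = χ.testBit i) ∧
    ∀ i < 2 * m, J i = true → χ.testBit ((i + m) % (2 * m)) = χ.testBit ((i + 1) % (2 * m)) := by
  simp only [respects, Bool.and_eq_true, List.all_eq_true, List.mem_range, Bool.or_eq_true,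
    Bool.not_eq_true', beq_iff_eq, ← Bool.not_eq_true, imp_iff_not_or]

theorem eq_zero_or_eq_of_testBit {k χ : ℕ} (hχ : χ < 2 ^ k)
    (h : ∀ i < k, ∀ j < k, χ.testBit i = true → χ.testBit j = true) : χ = 0 ∨ χ = 2 ^ k - 1 := by
  by_cases h0 : ∃ i < k, χ.testBit i = true
  · obtain ⟨i, hi, hit⟩ := h0
    right
    refine Nat.eq_of_testBit_eq fun j => ?_
    rw [Nat.testBit_two_pow_sub_one]
    by_cases hj : j < k
    · simp [hj, h i hi j hj hit]
    · rw [Nat.testBit_lt_two_pow (hχ.trans_le (Nat.pow_le_pow_right two_pos (not_lt.1 hj)))]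
      simp [hj]
  · left
    push Not at h0
    refine Nat.eq_of_testBit_eq fun j => ?_
    rw [Nat.zero_testBit]
    by_cases hj : j < k
    · simpa using h0 j hj
    · exact Nat.testBit_lt_two_pow (hχ.trans_le (Nat.pow_le_pow_right two_pos (not_lt.1 hj)))

variable {n m : ℕ} {T : SimpleGraph (Fin n)} {s e : ℕ → Fin n}

namespace Frame

theorem merged_mod (F : Frame T m s e) (t : ℕ) : Merged T m s e (t % m) ↔ Merged T m s e t := by
  have h : t % (2 * m) = (t % m) % (2 * m) ∨ t % (2 * m) = (t % m + m) % (2 * m) := by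
    rcases F.m_eq with rfl | rfl <;> omega
  rcases h with h | h
  · exact (F.merged_congr h).symm
  · exact ((F.merged_congr h).trans (F.merged_add _)).symm

/-- The first half of the test is `iff_of_connected`, applied to the set coded by `χ`; the second is
`exists_separation`, with its set turned into a mask. -/
theorem spanning (F : Frame T m s e) (hT : T.IsTree) {μ ν : ℕ}
    (hμ : ∀ i < m, μ.testBit i = true ↔ Merged T m s e i)
    (hν : ∀ i < 2 * m, ν.testBit i = true ↔ Joined T s e i) : spanning m μ ν = true := by
  have hm := F.m_eq
  have hpos : 0 < m := by omega
  have hpos' : 0 < 2 * m := by omega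
  simp only [CircleTree.spanning, Bool.and_eq_true, List.all_eq_true, List.mem_range,
    Bool.or_eq_true, Bool.not_eq_true', beq_iff_eq, ← Bool.not_eq_true, List.any_eq_true]
  constructor
  · intro χ hχ
    rw [or_assoc, ← imp_iff_not_or, respects_iff]
    rintro ⟨h1, h2⟩
    refine eq_zero_or_eq_of_testBit hχ fun i hi j hj hij => ?_
    have key := F.iff_of_connected (X := fun i => χ.testBit (i % (2 * m)) = true) hT.connected
      (fun i => by rw [F.add_two_mul]) (fun t ht => ?_) (fun t ht => ?_) (i := i) (j := j) (by
        simpa only [Nat.mod_eq_of_lt hi] using hij)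
    · simpa only [Nat.mod_eq_of_lt hj] using key
    · have := h1 _ (Nat.mod_lt t hpos) ((hμ _ (Nat.mod_lt t hpos)).2 ((F.merged_mod t).2 ht))
      have h3 : (t % (2 * m) = t % m ∧ (t + m) % (2 * m) = t % m + m) ∨
          (t % (2 * m) = t % m + m ∧ (t + m) % (2 * m) = t % m) := by
        rcases hm with rfl | rfl <;> omega
      rcases h3 with ⟨h3, h4⟩ | ⟨h3, h4⟩ <;> rw [h3, h4, this]
    · have hl := Nat.mod_lt t hpos'
      have := h2 _ hl ((hν _ hl).2 ((F.joined_congr (Nat.mod_mod _ _)).2 ht))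
      rw [Nat.mod_add_mod, Nat.mod_add_mod] at this
      rw [this]
  · intro i hi
    rw [← imp_iff_not_or]
    intro hνi
    obtain ⟨X, h1, h2, h3, h4, h5⟩ := F.exists_separation hT ((hν i hi).1 hνi)
    have hmod : ∀ j, X (j % (2 * m)) ↔ X j := by
      intro j
      conv_rhs => rw [← Nat.mod_add_div j (2 * m)]
      induction j / (2 * m) with
      | zero => simp
      | succ k ih => rw [Nat.mul_succ, ← add_assoc, h1, ih]
    obtain ⟨χ, hχ, hχX⟩ := exists_mask (2 * m) X
    refine ⟨χ, hχ, respects_iff.2 ⟨fun j hj hjμ => ?_, fun j hj hjν => ?_⟩, ?_⟩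
    · rw [Bool.eq_iff_iff, hχX _ (by omega), hχX _ (by omega)]
      exact h2 j ((hμ j hj).1 hjμ)
    · rw [Bool.and_eq_true, bne_iff_ne] at hjν
      rw [Bool.eq_iff_iff, hχX _ (Nat.mod_lt _ hpos'), hχX _ (Nat.mod_lt _ hpos'), hmod, hmod]
      refine h3 j ?_ ((hν j hj).1 hjν.1)
      rw [Nat.mod_eq_of_lt hj, Nat.mod_eq_of_lt hi]
      exact hjν.2
    · rw [bne_iff_ne, Ne, Bool.eq_iff_iff, hχX _ (Nat.mod_lt _ hpos'), hχX _ (Nat.mod_lt _ hpos'),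
        hmod, hmod]
      exact fun h => h5 (h.1 h4)

end Frame

/-- The first or the last point of a block. -/
def blockPt {α : Type*} (a b : ℕ → α) (x : ℕ × Bool) : α := if x.2 then b x.1 else a x.1

/-- The order of the first and the last points of successive blocks is determined by the set of
blocks with only one point. -/
theorem blockPt_lt_iff {α : Type*} [LinearOrder α] {a b : ℕ → α} {M : ℕ → Prop} {k : ℕ}
    (h₁ : ∀ t < k, M t → a t = b t) (h₂ : ∀ t < k, ¬ M t → a t < b t)
    (h₃ : ∀ i j, i < j → j < k → b i < a j) {x y : ℕ × Bool} (hx : x.1 < k) (hy : y.1 < k) :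
    blockPt a b x < blockPt a b y ↔
      x.1 < y.1 ∨ (x.1 = y.1 ∧ x.2 = false ∧ y.2 = true ∧ ¬ M x.1) := by
  have hle : ∀ t < k, a t ≤ b t := by
    intro t ht
    by_cases hM : M t
    · exact (h₁ t ht hM).le
    · exact (h₂ t ht hM).le
  have hpt : ∀ x : ℕ × Bool, x.1 < k → a x.1 ≤ blockPt a b x ∧ blockPt a b x ≤ b x.1 := by
    rintro ⟨i, c⟩ hx
    cases c
    · exact ⟨le_rfl, hle i hx⟩
    · exact ⟨hle i hx, le_rfl⟩
  rcases lt_trichotomy x.1 y.1 with h | h | h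
  · refine ⟨fun _ => Or.inl h, fun _ => ?_⟩
    exact (hpt x hx).2.trans_lt ((h₃ _ _ h hy).trans_le (hpt y hy).1)
  · obtain ⟨i, c⟩ := x
    obtain ⟨j, d⟩ := y
    dsimp only at h hx hy
    subst h
    have hirr : ¬ i < i := lt_irrefl i
    cases c <;> cases d <;> simp only [blockPt, hirr, lt_irrefl] <;> simp
    · refine ⟨fun h hM => h.ne (h₁ i hx hM), h₂ i hx⟩
    · exact hle i hx
  · refine ⟨fun h1 => ?_, fun h1 => ?_⟩
    · have := (hpt y hy).2.trans_lt ((h₃ _ _ h hx).trans_le (hpt x hx).1)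
      exact absurd (h1.trans this) (lt_irrefl _)
    · omega

/-- The order of the points depends only on which blocks have a single point. The selected points
and their integer model are therefore order isomorphic. -/
theorem exists_strictMono_blockPt {α : Type*} [LinearOrder α] {a b : ℕ → α} {a' b' : ℕ → ℕ}
    {M : ℕ → Prop} {k N : ℕ} (h₁ : ∀ t < k, M t → a t = b t) (h₂ : ∀ t < k, ¬ M t → a t < b t)
    (h₃ : ∀ i j, i < j → j < k → b i < a j) (h₁' : ∀ t < k, M t → a' t = b' t)
    (h₂' : ∀ t < k, ¬ M t → a' t < b' t) (h₃' : ∀ i j, i < j → j < k → b' i < a' j)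
    (hsurj : ∀ p < N, ∃ t < k, p = a' t ∨ p = b' t) :
    ∃ f : Fin N → α, StrictMono f ∧ ∀ x : Fin N, ∀ t < k,
      ((x : ℕ) = a' t → f x = a t) ∧ ((x : ℕ) = b' t → f x = b t) := by
  have hex : ∀ p : Fin N, ∃ x : ℕ × Bool, x.1 < k ∧ (p : ℕ) = blockPt a' b' x := by
    intro p
    obtain ⟨t, ht, h | h⟩ := hsurj p p.isLt
    · exact ⟨(t, false), ht, h⟩
    · exact ⟨(t, true), ht, h⟩
  choose g hg hg' using hex
  have htrans : ∀ x y : ℕ × Bool, x.1 < k → y.1 < k →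
      (blockPt a' b' x < blockPt a' b' y ↔ blockPt a b x < blockPt a b y) := fun x y hx hy => by
    rw [blockPt_lt_iff h₁ h₂ h₃ hx hy, blockPt_lt_iff h₁' h₂' h₃' hx hy]
  have heq : ∀ (p : Fin N) (x : ℕ × Bool), x.1 < k → (p : ℕ) = blockPt a' b' x →
      blockPt a b (g p) = blockPt a b x := by
    intro p x hx hpx
    have h := hg' p
    rcases lt_trichotomy (blockPt a b (g p)) (blockPt a b x) with h4 | h4 | h4
    · rw [← htrans _ _ (hg p) hx] at h4
      omega
    · exact h4
    · rw [← htrans _ _ hx (hg p)] at h4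
      omega
  refine ⟨fun p => blockPt a b (g p), fun p q hpq => ?_, fun x t ht => ⟨fun h => ?_, fun h => ?_⟩⟩
  · rw [Fin.lt_def, hg' p, hg' q, htrans _ _ (hg p) (hg q)] at hpq
    exact hpq
  · exact heq x (t, false) ht h
  · exact heq x (t, true) ht h

theorem width_eq (m μ i : ℕ) : width m μ i = 1 ∧ μ.testBit (i % m) = true ∨
    width m μ i = 2 ∧ ¬ μ.testBit (i % m) = true := by
  unfold width
  split_ifs with h
  · exact Or.inl ⟨rfl, h⟩
  · exact Or.inr ⟨rfl, h⟩

theorem offset_lt (m μ : ℕ) {i j : ℕ} (h : i < j) : offset m μ i + width m μ i ≤ offset m μ j := by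
  obtain ⟨k, rfl⟩ := Nat.exists_eq_add_of_lt h
  clear h
  induction k with
  | zero => exact le_rfl
  | succ k ih => exact ih.trans (Nat.le_add_right _ _)

theorem firstPt_le_lastPt (m μ i : ℕ) : firstPt m μ i ≤ lastPt m μ i := Nat.le_add_right _ _

theorem lastPt_lt_firstPt {m μ i j : ℕ} (h : i < j) (hj : j < 2 * m) :
    lastPt m μ i < firstPt m μ j := by
  unfold lastPt firstPt
  rw [Nat.mod_eq_of_lt hj, Nat.mod_eq_of_lt (h.trans hj)]
  have := offset_lt m μ h
  rcases width_eq m μ i with ⟨h1, -⟩ | ⟨h1, -⟩ <;> omega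

theorem lastPt_lt {m : ℕ} (μ i : ℕ) (hm : 0 < m) : lastPt m μ i < offset m μ (2 * m) := by
  unfold lastPt
  have := offset_lt m μ (Nat.mod_lt i (show 0 < 2 * m by omega))
  rcases width_eq m μ (i % (2 * m)) with ⟨h1, -⟩ | ⟨h1, -⟩ <;> omega

theorem firstPt_lt {m : ℕ} (μ i : ℕ) (hm : 0 < m) : firstPt m μ i < offset m μ (2 * m) :=
  (firstPt_le_lastPt m μ i).trans_lt (lastPt_lt μ i hm)

theorem firstPt_congr {m μ i j : ℕ} (h : i % (2 * m) = j % (2 * m)) :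
    firstPt m μ i = firstPt m μ j := by
  unfold firstPt
  rw [h]

theorem lastPt_congr {m μ i j : ℕ} (h : i % (2 * m) = j % (2 * m)) :
    lastPt m μ i = lastPt m μ j := by
  unfold lastPt
  rw [h]

theorem exists_eq_firstPt_or_lastPt {m μ p : ℕ} (h : p < offset m μ (2 * m)) :
    ∃ t < 2 * m, p = firstPt m μ t ∨ p = lastPt m μ t := by
  have key : ∀ k, p < offset m μ k → ∃ t < k, offset m μ t ≤ p ∧ p < offset m μ t + width m μ t := by
    intro k
    induction k with
    | zero => exact fun h => absurd h (Nat.not_lt_zero _)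
    | succ k ih =>
      intro h
      by_cases h1 : p < offset m μ k
      · obtain ⟨t, ht, h2⟩ := ih h1
        exact ⟨t, by omega, h2⟩
      · exact ⟨k, by omega, not_lt.1 h1, h⟩
  obtain ⟨t, ht, h1, h2⟩ := key _ h
  refine ⟨t, ht, ?_⟩
  unfold firstPt lastPt
  rw [Nat.mod_eq_of_lt ht]
  rcases width_eq m μ t with ⟨h3, -⟩ | ⟨h3, -⟩ <;> omega

theorem joins_preEdges_iff {m μ p q : ℕ} (hm : 0 < m) : joins (preEdges m μ) p q = true ↔
    ∃ t, (p = firstPt m μ t ∧ q = lastPt m μ (t + m)) ∨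
      (q = firstPt m μ t ∧ p = lastPt m μ (t + m)) := by
  simp only [joins_iff, preEdges, List.mem_map, List.mem_range, Prod.mk.injEq]
  constructor
  · rintro (⟨t, -, h1, h2⟩ | ⟨t, -, h1, h2⟩)
    · exact ⟨t, Or.inl ⟨h1.symm, h2.symm⟩⟩
    · exact ⟨t, Or.inr ⟨h1.symm, h2.symm⟩⟩
  · have h1 : ∀ t, firstPt m μ (t % (2 * m)) = firstPt m μ t := fun t =>
      firstPt_congr (Nat.mod_mod _ _)
    have h2 : ∀ t, lastPt m μ (t % (2 * m) + m) = lastPt m μ (t + m) := fun t =>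
      lastPt_congr (by rw [Nat.mod_add_mod])
    rintro ⟨t, ⟨rfl, rfl⟩ | ⟨rfl, rfl⟩⟩
    · exact Or.inl ⟨t % (2 * m), Nat.mod_lt _ (by omega), h1 t, h2 t⟩
    · exact Or.inr ⟨t % (2 * m), Nat.mod_lt _ (by omega), h1 t, h2 t⟩

theorem joins_redEdges_iff {m μ ν p q : ℕ} (hm : 0 < m) : joins (redEdges m μ ν) p q = true ↔
    joins (preEdges m μ) p q = true ∨ ∃ t, ν.testBit (t % (2 * m)) = true ∧
      ((p = lastPt m μ t ∧ q = firstPt m μ (t + 1)) ∨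
        (q = lastPt m μ t ∧ p = firstPt m μ (t + 1))) := by
  unfold redEdges
  rw [joins, List.any_append, Bool.or_eq_true]
  refine or_congr Iff.rfl ?_
  change joins _ p q = true ↔ _
  simp only [joins_iff, List.mem_map, List.mem_filter, List.mem_range, Prod.mk.injEq]
  constructor
  · rintro (⟨t, ⟨ht, hν⟩, h1, h2⟩ | ⟨t, ⟨ht, hν⟩, h1, h2⟩)
    · exact ⟨t, by rwa [Nat.mod_eq_of_lt ht], Or.inl ⟨h1.symm, h2.symm⟩⟩
    · exact ⟨t, by rwa [Nat.mod_eq_of_lt ht], Or.inr ⟨h1.symm, h2.symm⟩⟩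
  · have h1 : ∀ t, lastPt m μ (t % (2 * m)) = lastPt m μ t := fun t =>
      lastPt_congr (Nat.mod_mod _ _)
    have h2 : ∀ t, firstPt m μ (t % (2 * m) + 1) = firstPt m μ (t + 1) := fun t =>
      firstPt_congr (by rw [Nat.mod_add_mod])
    rintro ⟨t, hν, ⟨rfl, rfl⟩ | ⟨rfl, rfl⟩⟩
    · exact Or.inl ⟨t % (2 * m), ⟨Nat.mod_lt _ (by omega), hν⟩, h1 t, h2 t⟩
    · exact Or.inr ⟨t % (2 * m), ⟨Nat.mod_lt _ (by omega), hν⟩, h1 t, h2 t⟩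

/-- The last hypothesis says that every point of the model has an edge, so that the image of `f` is
the whole support. -/
theorem trimmed_eq_codeForm {N : ℕ} {L : List (ℕ × ℕ)} {G : SimpleGraph (Fin n)} {f : Fin N → Fin n}
    (hf : StrictMono f)
    (hG : ∀ p q, G.Adj p q ↔ ∃ x y : Fin N, joins L x y = true ∧ s(p, q) = s(f x, f y))
    (hL : ∀ x : Fin N, ∃ y : Fin N, joins L x y = true) : trimmed G = codeForm N L := by
  refine trimmed_eq_unlabel G (codeGraph N L) f hf (Set.ext fun p => ⟨?_, ?_⟩) fun x y => ?_
  · rintro ⟨x, rfl⟩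
    obtain ⟨y, hy⟩ := hL x
    exact ⟨f y, (hG _ _).2 ⟨x, y, hy, rfl⟩⟩
  · rintro ⟨q, hq⟩
    obtain ⟨x, y, -, h⟩ := (hG _ _).1 hq
    rcases Sym2.eq_iff.1 h with ⟨rfl, -⟩ | ⟨rfl, -⟩
    · exact ⟨x, rfl⟩
    · exact ⟨y, rfl⟩
  · constructor
    · rintro ⟨-, h⟩
      exact (hG _ _).2 ⟨x, y, h, rfl⟩
    · intro h
      refine ⟨fun hxy => h.ne (congrArg f hxy), ?_⟩
      obtain ⟨x', y', h1, h2⟩ := (hG _ _).1 h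
      rcases Sym2.eq_iff.1 h2 with ⟨h3, h4⟩ | ⟨h3, h4⟩
      · rw [hf.injective h3, hf.injective h4]
        exact h1
      · rw [hf.injective h3, hf.injective h4]
        exact joins_comm.1 h1

theorem apply_mod {α : Type*} {a : ℕ → α} {k : ℕ} (h : ∀ t, a (t + k) = a t) (t : ℕ) :
    a (t % k) = a t := by
  conv_rhs => rw [← Nat.mod_add_div t k]
  induction t / k with
  | zero => simp
  | succ j ih => rw [Nat.mul_succ, ← add_assoc, h, ih]

/-- The results of an e-reduction of a framed tree. -/
theorem Frame.trimmed_eq (F : Frame T m s e) (hT : T.Connected) {μ ν : ℕ}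
    (hμ : ∀ i < m, μ.testBit i = true ↔ Merged T m s e i)
    (hν : ∀ i < 2 * m, ν.testBit i = true ↔ Joined T s e i) {R : Set (Sym2 (Fin n))}
    (hR : IsSelection T R) :
    trimmed (stepTwo T R) = codeForm (offset m μ (2 * m)) (preEdges m μ) ∧
      trimmed (stepThree T R) = codeForm (offset m μ (2 * m)) (redEdges m μ ν) := by
  have hm : 0 < m := by have := F.two_le; omega
  obtain ⟨a, b, hper, h1, h2, h3, h4, h5⟩ := F.exists_points hT hR
  have hperb : ∀ t, b (t + m + m) = b t := fun t => by
    rw [show t + m + m = t + 2 * m by ring, (hper t).2]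
  have hM : ∀ t, Merged T m s e t ↔ μ.testBit (t % m) = true := fun t => by
    rw [hμ _ (Nat.mod_lt t hm), F.merged_mod]
  have hJ : ∀ t, Joined T s e t ↔ ν.testBit (t % (2 * m)) = true := fun t => by
    rw [hν _ (Nat.mod_lt t (by omega)), F.joined_congr (Nat.mod_mod _ _)]
  -- The monotone map from the consecutive integers of the model to the selected points.
  obtain ⟨f, hf, hfab⟩ := exists_strictMono_blockPt (a := a) (b := b) (a' := firstPt m μ)
    (b' := lastPt m μ) (M := Merged T m s e) (k := 2 * m) (N := offset m μ (2 * m))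
    (fun t _ => h1 t) (fun t _ => h2 t) h3 (fun t ht hMt => by
      unfold firstPt lastPt
      rw [hM] at hMt
      rw [Nat.mod_eq_of_lt ht]
      rcases width_eq m μ t with ⟨h6, -⟩ | ⟨-, h6⟩
      · omega
      · exact absurd hMt h6) (fun t ht hMt => by
      unfold firstPt lastPt
      rw [hM] at hMt
      rw [Nat.mod_eq_of_lt ht]
      rcases width_eq m μ t with ⟨-, h6⟩ | ⟨h6, -⟩
      · exact absurd h6 hMt
      · omega) (fun i j => lastPt_lt_firstPt) fun p hp => exists_eq_firstPt_or_lastPt hp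
  have hfa : ∀ t, f ⟨firstPt m μ t, firstPt_lt μ t hm⟩ = a t := by
    intro t
    rw [← apply_mod (fun t => (hper t).1) t]
    exact (hfab _ _ (Nat.mod_lt t (by omega))).1 (firstPt_congr (Nat.mod_mod _ _).symm)
  have hfb : ∀ t, f ⟨lastPt m μ t, lastPt_lt μ t hm⟩ = b t := by
    intro t
    rw [← apply_mod (fun t => (hper t).2) t]
    exact (hfab _ _ (Nat.mod_lt t (by omega))).2 (lastPt_congr (Nat.mod_mod _ _).symm)
  have hfa' : ∀ (x : Fin (offset m μ (2 * m))) t, (x : ℕ) = firstPt m μ t → f x = a t := by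
    intro x t hx
    rw [← hfa t]
    exact congrArg f (Fin.ext hx)
  have hfb' : ∀ (x : Fin (offset m μ (2 * m))) t, (x : ℕ) = lastPt m μ t → f x = b t := by
    intro x t hx
    rw [← hfb t]
    exact congrArg f (Fin.ext hx)
  have hpre : ∀ p q, (∃ t, s(p, q) = s(a t, b (t + m))) ↔
      ∃ x y : Fin (offset m μ (2 * m)), joins (preEdges m μ) x y = true ∧
        s(p, q) = s(f x, f y) := by
    intro p q
    constructor
    · rintro ⟨t, ht⟩
      refine ⟨⟨_, firstPt_lt μ t hm⟩, ⟨_, lastPt_lt μ (t + m) hm⟩,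
        (joins_preEdges_iff hm).2 ⟨t, Or.inl ⟨rfl, rfl⟩⟩, ?_⟩
      rw [ht, hfa, hfb]
    · rintro ⟨x, y, hxy, h⟩
      obtain ⟨t, ⟨hx, hy⟩ | ⟨hx, hy⟩⟩ := (joins_preEdges_iff hm).1 hxy
      · exact ⟨t, by rw [h, hfa' _ _ hx, hfb' _ _ hy]⟩
      · exact ⟨t, by rw [h, hfa' _ _ hx, hfb' _ _ hy, Sym2.eq_swap]⟩
  have hcov : ∀ x : Fin (offset m μ (2 * m)), ∃ y : Fin (offset m μ (2 * m)),
      joins (preEdges m μ) x y = true := by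
    intro x
    obtain ⟨t, -, hx | hx⟩ := exists_eq_firstPt_or_lastPt x.isLt
    · exact ⟨⟨_, lastPt_lt μ (t + m) hm⟩, (joins_preEdges_iff hm).2 ⟨t, Or.inl ⟨hx, rfl⟩⟩⟩
    · refine ⟨⟨_, firstPt_lt μ (t + m) hm⟩, (joins_preEdges_iff hm).2 ⟨t + m, Or.inr ⟨rfl, ?_⟩⟩⟩
      rw [hx]
      exact lastPt_congr (by rw [show t + m + m = t + 2 * m by ring, Nat.add_mod_right])
  refine ⟨trimmed_eq_codeForm hf (fun p q => (h4 p q).trans (hpre p q)) hcov,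
    trimmed_eq_codeForm hf (fun p q => ?_) fun x => ?_⟩
  · rw [h5, hpre]
    constructor
    · rintro (⟨x, y, hxy, h⟩ | ⟨t, ht, h⟩)
      · exact ⟨x, y, (joins_redEdges_iff hm).2 (Or.inl hxy), h⟩
      · refine ⟨⟨_, lastPt_lt μ t hm⟩, ⟨_, firstPt_lt μ (t + 1) hm⟩, (joins_redEdges_iff hm).2
          (Or.inr ⟨t, (hJ t).1 ht, Or.inl ⟨rfl, rfl⟩⟩), ?_⟩
        rw [h, hfa, hfb]
    · rintro ⟨x, y, hxy, h⟩
      rcases (joins_redEdges_iff hm).1 hxy with h6 | ⟨t, ht, ⟨hx, hy⟩ | ⟨hx, hy⟩⟩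
      · exact Or.inl ⟨x, y, h6, h⟩
      · exact Or.inr ⟨t, (hJ t).2 ht, by rw [h, hfb' _ _ hx, hfa' _ _ hy]⟩
      · exact Or.inr ⟨t, (hJ t).2 ht, by rw [h, hfb' _ _ hx, hfa' _ _ hy, Sym2.eq_swap]⟩
  · obtain ⟨y, hy⟩ := hcov x
    exact ⟨y, (joins_redEdges_iff hm).2 (Or.inl hy)⟩

end Model

end CircleTree

namespace CircleTree

open SimpleGraph

/-! ### Existence of trees with prescribed forms -/

section Realization

/-- One step of a search: the points joined by an edge in `L` to a point already found. -/
def growStep (S : List ℕ) (p : ℕ × ℕ) : List ℕ :=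
  if S.contains p.1 then p.2 :: S else if S.contains p.2 then p.1 :: S else S

/-- The points found from `0` in `k` rounds along the edges in `L`. -/
def growRounds (L : List (ℕ × ℕ)) : ℕ → List ℕ
  | 0 => [0]
  | k + 1 => L.foldl growStep (growRounds L k)

/-- The edges in `L` form a tree on `N` points. -/
def treeCode (N : ℕ) (L : List (ℕ × ℕ)) : Bool :=
  validCode N L && ((List.range N).all fun i => (growRounds L N).contains i) &&
    decide ((L.map fun p => (min p.1 p.2, max p.1 p.2)).dedup.length < N)

theorem reachable_of_mem_growRounds {N : ℕ} {L : List (ℕ × ℕ)} (hN : 0 < N)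
    (hL : validCode N L = true) (k : ℕ) :
    ∀ v ∈ growRounds L k, ∃ h : v < N, (codeGraph N L).Reachable ⟨0, hN⟩ ⟨v, h⟩ := by
  have hfold : ∀ (L' : List (ℕ × ℕ)) (S : List ℕ), (∀ p ∈ L', p ∈ L) →
      (∀ v ∈ S, ∃ h : v < N, (codeGraph N L).Reachable ⟨0, hN⟩ ⟨v, h⟩) →
      ∀ v ∈ L'.foldl growStep S, ∃ h : v < N, (codeGraph N L).Reachable ⟨0, hN⟩ ⟨v, h⟩ := by
    intro L'
    induction L' with
    | nil => exact fun S _ hS => hS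
    | cons p L' ih =>
      intro S hp hS
      refine ih _ (fun q hq => hp q (List.mem_cons_of_mem _ hq)) ?_
      have hpL := hp p List.mem_cons_self
      have hv := List.all_eq_true.1 hL _ hpL
      simp only [Bool.and_eq_true, decide_eq_true_eq, bne_iff_ne] at hv
      have hadj : (codeGraph N L).Adj ⟨p.1, hv.1.1⟩ ⟨p.2, hv.1.2⟩ :=
        ⟨fun h => hv.2 (Fin.ext_iff.1 h), joins_iff.2 (Or.inl hpL)⟩
      intro v hvS
      unfold growStep at hvS
      split_ifs at hvS with h1 h2
      · rcases List.mem_cons.1 hvS with rfl | h3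
        · obtain ⟨_, h4⟩ := hS _ (List.contains_iff_mem.1 h1)
          exact ⟨hv.1.2, h4.trans hadj.reachable⟩
        · exact hS v h3
      · rcases List.mem_cons.1 hvS with rfl | h3
        · obtain ⟨_, h4⟩ := hS _ (List.contains_iff_mem.1 h2)
          exact ⟨hv.1.1, h4.trans hadj.symm.reachable⟩
        · exact hS v h3
      · exact hS v hvS
  induction k with
  | zero =>
    intro v hv
    rw [growRounds, List.mem_singleton] at hv
    subst hv
    exact ⟨hN, Reachable.refl _⟩
  | succ k ih => exact hfold L _ (fun _ h => h) ih

/-- The search shows connectedness, and a connected graph with fewer edges than points is a tree.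
Sorting the pairs and removing duplicates keeps edges listed twice, as in merged classes, from being
counted twice. -/
theorem isTree_of_treeCode {N : ℕ} {L : List (ℕ × ℕ)} (hN : 0 < N) (h : treeCode N L = true) :
    (codeGraph N L).IsTree := by
  simp only [treeCode, Bool.and_eq_true, List.all_eq_true, List.mem_range,
    decide_eq_true_eq] at h
  obtain ⟨⟨hL, hreach⟩, hcard⟩ := h
  have hr : ∀ v : Fin N, (codeGraph N L).Reachable ⟨0, hN⟩ v := fun v =>
    (reachable_of_mem_growRounds hN hL N v (List.contains_iff_mem.1 (hreach v v.isLt))).2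
  have hconn : (codeGraph N L).Connected := by
    have : Nonempty (Fin N) := ⟨⟨0, hN⟩⟩
    exact ⟨fun u v => (hr u).symm.trans (hr v)⟩
  refine isTree_iff_connected_and_card.2 ⟨hconn,
    le_antisymm ?_ hconn.card_vert_le_card_edgeSet_add_one⟩
  rw [Nat.card_fin]
  refine Nat.succ_le_of_lt (lt_of_le_of_lt ?_ hcard)
  set D := (L.map fun p => (min p.1 p.2, max p.1 p.2)).dedup
  have hmem : ∀ e ∈ (codeGraph N L).edgeSet, ((e.inf : ℕ), (e.sup : ℕ)) ∈ D := by
    intro e he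
    induction e with
    | _ x y =>
    rw [List.mem_dedup, List.mem_map]
    rcases joins_iff.1 (show joins L x y = true from he.2) with h1 | h1
    · refine ⟨_, h1, ?_⟩
      simp [Fin.coe_min, Fin.coe_max]
    · refine ⟨_, h1, ?_⟩
      simp [Fin.coe_min, Fin.coe_max, min_comm, max_comm]
  have hinj : Function.Injective fun e : (codeGraph N L).edgeSet =>
      (⟨((e.1.inf : ℕ), (e.1.sup : ℕ)), List.mem_toFinset.2 (hmem e.1 e.2)⟩ : D.toFinset) := by
    intro e f hef
    simp only [Subtype.mk.injEq, Prod.mk.injEq] at hef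
    exact Subtype.ext (Sym2.inf_eq_inf_and_sup_eq_sup.1 ⟨Fin.ext hef.1, Fin.ext hef.2⟩)
  have := Nat.card_le_card_of_injective _ hinj
  rw [Nat.card_eq_fintype_card (α := D.toFinset), Fintype.card_coe,
    List.toFinset_card_of_nodup (List.nodup_dedup _)] at this
  exact this

variable {n m : ℕ} {T : SimpleGraph (Fin n)} {s e : ℕ → Fin n}

namespace Frame

theorem eGraph_eq_of_mem (F : Frame T m s e) (hT : T.Connected) {f g : Sym2 (Fin n)}
    (hf : Crossed T f) (hg : Crossed T g) (h : g ∈ eGraph T f) : eGraph T g = eGraph T f := by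
  induction f with
  | _ x y =>
  induction g with
  | _ z w =>
  obtain ⟨t, hc⟩ := F.cov' hf
  obtain ⟨t', hc'⟩ := F.cov' hg
  exact F.eGraph_eq_of_common_point hT hc' hc
    ⟨_, F.self_mem_eGraph hT hc', Sym2.mem_mk_left z w⟩ ⟨_, h, Sym2.mem_mk_left z w⟩

/-- The e-graphs partition the crossed edges, so one representative of each may be chosen. -/
theorem exists_isSelection (F : Frame T m s e) (hT : T.Connected) : ∃ R, IsSelection T R := by
  classical
  have hself : ∀ f, Crossed T f → f ∈ eGraph T f := by
    intro f hf
    induction f with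
    | _ x y =>
    obtain ⟨t, hc⟩ := F.cov' hf
    exact F.self_mem_eGraph hT hc
  -- The choice is made per set of edges, so that equal e-graphs receive the same representative.
  have hex : ∀ S : Set (Sym2 (Fin n)), ∃ r, (∃ f, Crossed T f ∧ f ∈ S) → Crossed T r ∧ r ∈ S := by
    intro S
    by_cases h : ∃ f, Crossed T f ∧ f ∈ S
    · obtain ⟨f, hf⟩ := h
      exact ⟨f, fun _ => hf⟩
    · obtain ⟨f, -⟩ := F.isMultipartite.1
      exact ⟨f, fun h' => absurd h' h⟩
  choose c hc using hex
  have hc' : ∀ f, Crossed T f → Crossed T (c (eGraph T f)) ∧ c (eGraph T f) ∈ eGraph T f :=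
    fun f hf => hc _ ⟨f, hf, hself f hf⟩
  refine ⟨{r | ∃ f, Crossed T f ∧ r = c (eGraph T f)}, ?_, fun f hf => ?_⟩
  · rintro r ⟨f, hf, rfl⟩
    exact (hc' f hf).1
  · refine ⟨c (eGraph T f), ⟨⟨f, hf, rfl⟩, (hc' f hf).2⟩, ?_⟩
    rintro r ⟨⟨g, hg, rfl⟩, h⟩
    have h1 := F.eGraph_eq_of_mem hT hf (hc' g hg).1 h
    have h2 := F.eGraph_eq_of_mem hT hg (hc' g hg).1 (hc' g hg).2
    rw [← h2.symm.trans h1]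

end Frame

theorem Rotates.unlabel_eq {ρ : Fin n ≃ Fin n} {T T' : SimpleGraph (Fin n)} (h : Rotates ρ T T') :
    unlabel T = unlabel T' := by
  obtain ⟨⟨k, hk⟩, ha⟩ := h
  exact unlabel_eq_iff_exists_isRotation.2 ⟨k, ρ, hk, ha⟩

/-- The e-reductions of a framed tree have unique results. -/
theorem Frame.eReduction_iff (F : Frame T m s e) (hT : T.Connected) {μ ν : ℕ}
    (hμ : ∀ i < m, μ.testBit i = true ↔ Merged T m s e i)
    (hν : ∀ i < 2 * m, ν.testBit i = true ↔ Joined T s e i) (U V : UCGraph) :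
    (unlabel T).EReduction U V ↔ U = codeForm (offset m μ (2 * m)) (preEdges m μ) ∧
      V = codeForm (offset m μ (2 * m)) (redEdges m μ ν) := by
  constructor
  · rintro ⟨n', T', R, hTT', hR, rfl, rfl⟩
    obtain ⟨hn, ρ, hρ⟩ := exists_rotates_of_unlabel_eq hTT'.symm
    subst hn
    obtain ⟨h1, h2⟩ := F.trimmed_eq hT hμ hν (hρ.isSelection hR)
    rw [← h1, ← h2]
    exact ⟨((hρ.stepTwo R).trimmed_eq).symm, ((hρ.stepThree R).trimmed_eq).symm⟩
  · rintro ⟨rfl, rfl⟩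
    obtain ⟨R, hR⟩ := F.exists_isSelection hT
    obtain ⟨h1, h2⟩ := F.trimmed_eq hT hμ hν hR
    exact ⟨n, T, R, rfl, hR, h1.symm, h2.symm⟩

/-- The reduction of an arbitrary genus one tree is captured by finitely many data; what remains is
a finite check. -/
theorem UCGraph.IsGenusOneTree.exists_spanning {C : UCGraph} (hC : C.IsGenusOneTree) :
    ∃ m μ ν, (m = 2 ∨ m = 3) ∧ μ < 2 ^ m ∧ ν < 2 ^ (2 * m) ∧ spanning m μ ν = true ∧
      ∀ U V, C.EReduction U V ↔ U = codeForm (offset m μ (2 * m)) (preEdges m μ) ∧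
        V = codeForm (offset m μ (2 * m)) (redEdges m μ ν) := by
  obtain ⟨n, T, rfl, hT, hg⟩ := hC
  obtain ⟨ρ, T', hρ, m, s, e, F⟩ := exists_frame (genus_eq_one_iff.1 hg)
  have hT' := hρ.isTree hT
  obtain ⟨μ, hμl, hμ⟩ := exists_mask m (Merged T' m s e)
  obtain ⟨ν, hνl, hν⟩ := exists_mask (2 * m) (Joined T' s e)
  refine ⟨m, μ, ν, F.m_eq, hμl, hνl, F.spanning hT' hμ hν, fun U V => ?_⟩
  rw [hρ.unlabel_eq]
  exact F.eReduction_iff hT'.connected hμ hν U V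

/-- The point `firstPt m μ t` on the circle. -/
def firstFin {m : ℕ} (μ : ℕ) (hm : 0 < m) (t : ℕ) : Fin (offset m μ (2 * m)) :=
  ⟨firstPt m μ t, firstPt_lt μ t hm⟩

/-- The point `lastPt m μ t` on the circle. -/
def lastFin {m : ℕ} (μ : ℕ) (hm : 0 < m) (t : ℕ) : Fin (offset m μ (2 * m)) :=
  ⟨lastPt m μ t, lastPt_lt μ t hm⟩

theorem mod_eq_of_between {m μ i j p : ℕ} (hm : 0 < m) (hi : firstPt m μ i ≤ p ∧ p ≤ lastPt m μ i)
    (hj : firstPt m μ j ≤ p ∧ p ≤ lastPt m μ j) : i % (2 * m) = j % (2 * m) := by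
  have hpos : 0 < 2 * m := by omega
  rw [← firstPt_congr (Nat.mod_mod i _), ← lastPt_congr (Nat.mod_mod i _)] at hi
  rw [← firstPt_congr (Nat.mod_mod j _), ← lastPt_congr (Nat.mod_mod j _)] at hj
  rcases lt_trichotomy (i % (2 * m)) (j % (2 * m)) with h | h | h
  · have := lastPt_lt_firstPt (μ := μ) h (Nat.mod_lt j hpos)
    omega
  · exact h
  · have := lastPt_lt_firstPt (μ := μ) h (Nat.mod_lt i hpos)
    omega

theorem firstPt_succ (m μ t : ℕ) (hm : 0 < m) : firstPt m μ (t + 1) = lastPt m μ t + 1 ∨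
    (firstPt m μ (t + 1) = 0 ∧ lastPt m μ t + 1 = offset m μ (2 * m)) := by
  have hl := Nat.mod_lt t (show 0 < 2 * m by omega)
  have hw := width_eq m μ (t % (2 * m))
  unfold firstPt lastPt
  by_cases h : t % (2 * m) + 1 < 2 * m
  · left
    have h1 : (t + 1) % (2 * m) = t % (2 * m) + 1 := by
      rw [← Nat.mod_add_mod, Nat.mod_eq_of_lt h]
    rw [h1, offset]
    omega
  · right
    have h1 : (t + 1) % (2 * m) = 0 := by
      rw [← Nat.mod_add_mod, show t % (2 * m) + 1 = 2 * m by omega, Nat.mod_self]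
    have h2 : offset m μ (2 * m) = offset m μ (t % (2 * m)) + width m μ (t % (2 * m)) := by
      rw [show 2 * m = t % (2 * m) + 1 by omega, offset]
      rw [show t % (t % (2 * m) + 1) = t % (2 * m) by
        rw [show t % (2 * m) + 1 = 2 * m by omega]]
    rw [h1, h2]
    exact ⟨rfl, by omega⟩

/-- Chords between neighbouring points are not crossed. -/
theorem not_cross_of_succ {N : ℕ} {x y : Fin N}
    (h : (y : ℕ) = x + 1 ∨ ((y : ℕ) = 0 ∧ (x : ℕ) + 1 = N)) (f : Sym2 (Fin N)) :
    ¬ Cross s(x, y) f := by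
  rintro ⟨p, q, r, t, h1, h2, h3, ⟨h4, -⟩ | ⟨h4, -⟩⟩ <;>
    rcases Sym2.eq_iff.1 h4 with ⟨rfl, rfl⟩ | ⟨rfl, rfl⟩ <;>
    simp only [Fin.lt_def] at h1 h2 h3 <;> omega

section ModelTree

variable {μ ν : ℕ}

/-- Edges in gaps join neighbouring blocks, and neighbouring blocks are not opposite. Only the two
bounding chords remain. -/
theorem eq_of_joins_redEdges (hm : m = 2 ∨ m = 3) {t p q : ℕ}
    (h : joins (redEdges m μ ν) p q = true) (hp : firstPt m μ t ≤ p ∧ p ≤ lastPt m μ t)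
    (hq : firstPt m μ (t + m) ≤ q ∧ q ≤ lastPt m μ (t + m)) :
    (p = firstPt m μ t ∧ q = lastPt m μ (t + m)) ∨ (p = lastPt m μ t ∧ q = firstPt m μ (t + m)) := by
  have hpos : 0 < m := by omega
  have hself : ∀ i, (firstPt m μ i ≤ firstPt m μ i ∧ firstPt m μ i ≤ lastPt m μ i) ∧
      (firstPt m μ i ≤ lastPt m μ i ∧ lastPt m μ i ≤ lastPt m μ i) := fun i =>
    ⟨⟨le_rfl, firstPt_le_lastPt m μ i⟩, firstPt_le_lastPt m μ i, le_rfl⟩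
  rcases (joins_redEdges_iff hpos).1 h with h | ⟨i, -, ⟨rfl, rfl⟩ | ⟨rfl, rfl⟩⟩
  · obtain ⟨i, ⟨rfl, rfl⟩ | ⟨rfl, rfl⟩⟩ := (joins_preEdges_iff hpos).1 h
    · have h1 := mod_eq_of_between hpos (hself i).1 hp
      exact Or.inl ⟨firstPt_congr h1, lastPt_congr (Nat.ModEq.add_right m h1)⟩
    · have h1 := mod_eq_of_between hpos (hself i).1 hq
      refine Or.inr ⟨lastPt_congr ?_, firstPt_congr h1⟩
      rcases hm with rfl | rfl <;> omega
  · have h1 := mod_eq_of_between hpos (hself i).2 hp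
    have h2 := mod_eq_of_between hpos (hself (i + 1)).1 hq
    rcases hm with rfl | rfl <;> omega
  · have h1 := mod_eq_of_between hpos (hself i).2 hq
    have h2 := mod_eq_of_between hpos (hself (i + 1)).1 hp
    rcases hm with rfl | rfl <;> omega

theorem firstPt_ne_lastPt (hm : 0 < m) {i j : ℕ} (h : i % (2 * m) ≠ j % (2 * m)) :
    firstPt m μ i ≠ lastPt m μ j := fun h1 =>
  h (mod_eq_of_between hm ⟨le_rfl, firstPt_le_lastPt m μ i⟩
    ⟨h1 ▸ firstPt_le_lastPt m μ j, h1.le⟩)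

/-- The blocks have one or two points. The additional edges join neighbouring points of the circle
and cannot be crossed, so the crossed edges are chords between opposite blocks. -/
theorem codeGraph_frame (hm : m = 2 ∨ m = 3) (hpos : 0 < m) :
    Frame (codeGraph (offset m μ (2 * m)) (redEdges m μ ν)) m
      (fun t => firstFin μ hpos (t % (2 * m))) (fun t => lastFin μ hpos (t % (2 * m))) := by
  have hchord : ∀ t, (codeGraph (offset m μ (2 * m)) (redEdges m μ ν)).Adj
      (firstFin μ hpos t) (lastFin μ hpos (t + m)) := fun t =>
    ⟨fun h => firstPt_ne_lastPt hpos (by rcases hm with rfl | rfl <;> omega) (Fin.ext_iff.1 h),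
      (joins_redEdges_iff hpos).2 (Or.inl ((joins_preEdges_iff hpos).2 ⟨t, Or.inl ⟨rfl, rfl⟩⟩))⟩
  have hback : ∀ t, lastFin μ hpos (t + m + m) = lastFin μ hpos t := fun t =>
    Fin.ext (lastPt_congr (by rw [show t + m + m = t + 2 * m by ring, Nat.add_mod_right]))
  refine Frame.ofMod hm _ _ (fun t _ => firstPt_le_lastPt m μ t)
    (fun t ht => lastPt_lt_firstPt (Nat.lt_succ_self t) ht) (fun t _ => ⟨hchord t, ?_⟩) ?_ ?_
  · have := hchord (t + m)
    rwa [hback] at this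
  · intro x y hxy hcr
    have hxy' : (x : ℕ) < y := hxy
    have hadj : joins (redEdges m μ ν) x y = true := hcr.1.2
    rcases (joins_redEdges_iff hpos).1 hadj with h | ⟨i, -, ⟨h1, h2⟩ | ⟨h1, h2⟩⟩
    · have key : ∀ i, i < 2 * m → ∃ t < m, (i = t ∧ firstPt m μ i = firstPt m μ t ∧
          lastPt m μ (i + m) = lastPt m μ (t + m)) ∨ (i = t + m ∧
          firstPt m μ i = firstPt m μ (t + m) ∧ lastPt m μ (i + m) = lastPt m μ t) := by
        intro i hi
        rcases lt_or_ge i m with h1 | h1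
        · exact ⟨i, h1, Or.inl ⟨rfl, rfl, rfl⟩⟩
        · obtain ⟨t, rfl⟩ := Nat.exists_eq_add_of_le' h1
          exact ⟨t, by omega, Or.inr ⟨rfl, rfl, Fin.ext_iff.1 (hback t)⟩⟩
      obtain ⟨i, hi⟩ := (joins_preEdges_iff hpos).1 h
      rw [← firstPt_congr (Nat.mod_mod i _),
        ← lastPt_congr (show (i % (2 * m) + m) % (2 * m) = (i + m) % (2 * m) by
          rw [Nat.mod_add_mod])] at hi
      obtain ⟨t, ht, h3⟩ := key _ (Nat.mod_lt i (by omega))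
      have o1 := firstPt_le_lastPt m μ t
      have o2 := firstPt_le_lastPt m μ (t + m)
      have o3 := lastPt_lt_firstPt (μ := μ) (show t < t + m by omega) (show t + m < 2 * m by omega)
      refine ⟨t, ht, ?_⟩
      simp only [Fin.le_def, firstFin, lastFin]
      omega
    · obtain ⟨-, f, -, hf⟩ := hcr
      refine absurd hf (not_cross_of_succ ?_ f)
      rw [h1, h2]
      exact firstPt_succ m μ i hpos
    · obtain ⟨-, f, -, hf⟩ := hcr
      rw [Sym2.eq_swap] at hf
      refine absurd hf (not_cross_of_succ ?_ f)
      rw [h1, h2]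
      exact firstPt_succ m μ i hpos
  · intro t ht x y x' y' hxy hxy' hx hy hx' hy'
    have o1 := firstPt_le_lastPt m μ t
    have o2 := firstPt_le_lastPt m μ (t + m)
    have o3 := lastPt_lt_firstPt (μ := μ) (show t < t + m by omega) (show t + m < 2 * m by omega)
    have h1 := eq_of_joins_redEdges hm hxy.2 hx hy
    have h2 := eq_of_joins_redEdges hm hxy'.2 hx' hy'
    rw [not_cross_iff_of_lt (Fin.lt_def.2 (by omega))]
    omega

/-- The graph given by `μ` and `ν` is its own reduced form, if it is a tree and `μ`, `ν` cannot be
enlarged. -/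
theorem eReduction_codeGraph (hm : m = 2 ∨ m = 3) (hμ : μ < 2 ^ m) (hν : ν < 2 ^ (2 * m))
    (htree : treeCode (offset m μ (2 * m)) (redEdges m μ ν) = true)
    (hrigid : ∀ μ' < 2 ^ m, ∀ ν' < 2 ^ (2 * m), spanning m μ' ν' = true →
      (∀ i < m, μ.testBit i = true → μ'.testBit i = true) →
      (∀ i < 2 * m, ν.testBit i = true → ν'.testBit i = true) → μ' = μ ∧ ν' = ν) :
    ∃ C : UCGraph, C.IsGenusOneTree ∧ C.EReduction (codeForm (offset m μ (2 * m)) (preEdges m μ))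
      (codeForm (offset m μ (2 * m)) (redEdges m μ ν)) := by
  have hpos : 0 < m := by omega
  have F := codeGraph_frame (μ := μ) (ν := ν) hm hpos
  have hT := isTree_of_treeCode ((Nat.zero_le _).trans_lt (firstPt_lt μ 0 hpos)) htree
  obtain ⟨μ', hμl, hμ'⟩ := exists_mask m (Merged (codeGraph (offset m μ (2 * m)) (redEdges m μ ν))
    m (fun t => firstFin μ hpos (t % (2 * m))) (fun t => lastFin μ hpos (t % (2 * m))))
  obtain ⟨ν', hνl, hν'⟩ := exists_mask (2 * m) (Joined (codeGraph (offset m μ (2 * m))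
    (redEdges m μ ν)) (fun t => firstFin μ hpos (t % (2 * m)))
    (fun t => lastFin μ hpos (t % (2 * m))))
  -- The actual merged classes and joined gaps of the model contain the prescribed ones and pass the
  -- spanning test. Rigidity forces equality, and no absence of connections has to be checked in the
  -- graph.
  obtain ⟨rfl, rfl⟩ := hrigid μ' hμl ν' hνl (F.spanning hT hμ' hν') (by
    intro i hi h
    refine (hμ' i hi).2 ?_
    have : firstFin μ hpos (i % (2 * m)) = lastFin μ hpos (i % (2 * m)) := by
      refine Fin.ext ?_
      change firstPt m μ _ = lastPt m μ _
      unfold firstPt lastPt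
      rw [Nat.mod_mod, Nat.mod_eq_of_lt (show i < 2 * m by omega)]
      rcases width_eq m μ i with ⟨h1, -⟩ | ⟨-, h1⟩
      · omega
      · rw [Nat.mod_eq_of_lt hi] at h1
        exact absurd h h1
    unfold Merged
    beta_reduce
    rw [this]) (by
    intro i hi h
    refine (hν' i hi).2 (Adj.reachable ?_)
    have e1 : lastFin μ hpos (i % (2 * m)) = lastFin μ hpos i :=
      Fin.ext (lastPt_congr (Nat.mod_mod _ _))
    have e2 : firstFin μ hpos ((i + 1) % (2 * m)) = firstFin μ hpos (i + 1) :=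
      Fin.ext (firstPt_congr (Nat.mod_mod _ _))
    have hadj : (codeGraph (offset m μ (2 * m)) (redEdges m μ ν)).Adj
        (lastFin μ hpos (i % (2 * m))) (firstFin μ hpos ((i + 1) % (2 * m))) := by
      rw [e1, e2]
      refine ⟨fun h1 => ?_, (joins_redEdges_iff hpos).2 (Or.inr ⟨i, ?_, Or.inl ⟨rfl, rfl⟩⟩)⟩
      · exact firstPt_ne_lastPt hpos (by rcases hm with rfl | rfl <;> omega)
          (Fin.ext_iff.1 h1).symm
      · rwa [Nat.mod_eq_of_lt hi]
    refine ⟨hadj, ⟨hadj, fun f _ => not_cross_of_succ ?_ f⟩, onArc_left _ _, onArc_right _ _⟩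
    beta_reduce
    rw [e1, e2]
    exact firstPt_succ m μ i hpos)
  exact ⟨_, ⟨_, _, rfl, hT, genus_eq_one_iff.2 F.isMultipartite⟩,
    (F.eReduction_iff hT.connected hμ' hν' _ _).2 ⟨rfl, rfl⟩⟩

end ModelTree

end Realization

end CircleTree

namespace CircleTree

/-! ### Evaluation of the finite classification -/

section Table

/-- All 4 · 16 pairs of masks for two classes are evaluated; the next theorem evaluates the 8 · 64
pairs for three. -/
theorem classified_of_spanning_two :
    ((List.range (2 ^ 2)).all fun μ => (List.range (2 ^ (2 * 2))).all fun ν =>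
      !spanning 2 μ ν || classified 2 μ ν) = true := by decide +kernel

theorem classified_of_spanning_three :
    ((List.range (2 ^ 3)).all fun μ => (List.range (2 ^ (2 * 3))).all fun ν =>
      !spanning 3 μ ν || classified 3 μ ν) = true := by decide +kernel

theorem classified_of_spanning {m μ ν : ℕ} (hm : m = 2 ∨ m = 3) (hμ : μ < 2 ^ m)
    (hν : ν < 2 ^ (2 * m)) (h : spanning m μ ν = true) : classified m μ ν = true := by
  rcases hm with rfl | rfl
  · have := List.all_eq_true.1 (List.all_eq_true.1 classified_of_spanning_two μ
      (List.mem_range.2 hμ)) ν (List.mem_range.2 hν)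
    simpa [h] using this
  · have := List.all_eq_true.1 (List.all_eq_true.1 classified_of_spanning_three μ
      (List.mem_range.2 hμ)) ν (List.mem_range.2 hν)
    simpa [h] using this

/-- The sets `μ` and `ν` cannot be enlarged. -/
def rigid (m μ ν : ℕ) : Bool :=
  (List.range (2 ^ m)).all fun μ' => (List.range (2 ^ (2 * m))).all fun ν' =>
    !(((List.range m).all fun i => !μ.testBit i || μ'.testBit i) &&
      ((List.range (2 * m)).all fun i => !ν.testBit i || ν'.testBit i) && spanning m μ' ν') ||
    (μ' == μ && ν' == ν)

/-- Trees with the reduced forms in the table. -/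
def treeTable : List (ℕ × ℕ × ℕ) :=
  -- Entries are `m`, `μ`, `ν`. The groups have 1, 3, 1, 2, 6, 6 members, in the order of the
  -- pre-reduced forms.
  [(2, 3, 1), (2, 1, 3), (2, 1, 10), (2, 1, 5), (2, 0, 7), (3, 7, 3), (3, 7, 5), (3, 3, 37),
    (3, 3, 38), (3, 3, 7), (3, 3, 14), (3, 3, 22), (3, 3, 19), (3, 1, 15), (3, 1, 30), (3, 1, 39),
    (3, 1, 27), (3, 1, 45), (3, 1, 54)]

theorem treeTable_valid : (treeTable.all fun w => (w.1 == 2 || w.1 == 3) &&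
    decide (w.2.1 < 2 ^ w.1) && decide (w.2.2 < 2 ^ (2 * w.1)) &&
    treeCode (offset w.1 w.2.1 (2 * w.1)) (redEdges w.1 w.2.1 w.2.2) &&
    rigid w.1 w.2.1 w.2.2) = true := by decide +kernel

theorem formTable_realized : (formTable.all fun F => F.2.2.all fun X => treeTable.any fun w =>
    F.1 == offset w.1 w.2.1 (2 * w.1) && sameCode F.1 (preEdges w.1 w.2.1) F.2.1 &&
    sameCode F.1 (redEdges w.1 w.2.1 w.2.2) (F.2.1 ++ X)) = true := by decide +kernel

/-- The pairs of a pre-reduced form and a reduced form in the table. -/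
def InTable (U V : UCGraph) : Prop :=
  ∃ F ∈ formTable, ∃ X ∈ F.2.2, U = codeForm F.1 F.2.1 ∧ V = codeForm F.1 (F.2.1 ++ X)

theorem UCGraph.IsGenusOneTree.exists_inTable {C : UCGraph} (hC : C.IsGenusOneTree) :
    ∃ U V, InTable U V ∧ ∀ U' V', C.EReduction U' V' ↔ U' = U ∧ V' = V := by
  obtain ⟨m, μ, ν, hm, hμ, hν, hs, h⟩ := hC.exists_spanning
  refine ⟨_, _, ?_, h⟩
  have hc := classified_of_spanning hm hμ hν hs
  simp only [classified, List.any_eq_true, Bool.and_eq_true, beq_iff_eq] at hc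
  obtain ⟨F, hF, ⟨h1, h2⟩, X, hX, h3⟩ := hc
  rw [h1] at h2 h3
  exact ⟨F, hF, X, hX, by rw [h1]; exact unlabel_eq_of_sameCode h2,
    by rw [h1]; exact unlabel_eq_of_sameCode h3⟩

/-- The witness is the model tree of a matching entry of `treeTable`, which has the required forms
after a rotation. -/
theorem InTable.exists_eReduction {U V : UCGraph} (h : InTable U V) :
    ∃ C : UCGraph, C.IsGenusOneTree ∧ C.EReduction U V := by
  obtain ⟨F, hF, X, hX, rfl, rfl⟩ := h
  have h1 := List.all_eq_true.1 (List.all_eq_true.1 formTable_realized F hF) X hX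
  simp only [List.any_eq_true, Bool.and_eq_true, beq_iff_eq] at h1
  obtain ⟨⟨m, μ, ν⟩, hw, ⟨h1, h2⟩, h3⟩ := h1
  have h4 := List.all_eq_true.1 treeTable_valid _ hw
  simp only [Bool.and_eq_true, Bool.or_eq_true, beq_iff_eq, decide_eq_true_eq] at h4 h1 h2 h3
  obtain ⟨⟨⟨⟨hm, hμ⟩, hν⟩, ht⟩, hr⟩ := h4
  rw [h1] at h2 h3 ⊢
  rw [codeForm, codeForm, ← unlabel_eq_of_sameCode h2, ← unlabel_eq_of_sameCode h3]
  refine eReduction_codeGraph hm hμ hν ht fun μ' hμ' ν' hν' hs hμμ hνν => ?_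
  have h5 := List.all_eq_true.1 (List.all_eq_true.1 hr μ' (List.mem_range.2 hμ')) ν'
    (List.mem_range.2 hν')
  simp only [Bool.or_eq_true, Bool.not_eq_true', Bool.and_eq_true, beq_iff_eq] at h5
  refine h5.resolve_left ?_
  rw [Bool.not_eq_false, Bool.and_eq_true, Bool.and_eq_true, List.all_eq_true, List.all_eq_true]
  refine ⟨⟨fun i hi => ?_, fun i hi => ?_⟩, hs⟩
  · have := hμμ i (List.mem_range.1 hi)
    revert this
    cases μ.testBit i <;> simp
  · have := hνν i (List.mem_range.1 hi)
    revert this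
    cases ν.testBit i <;> simp

/-- The codes of the pre-reduced forms. -/
def preCodes : List (ℕ × List (ℕ × ℕ)) := formTable.map fun F => (F.1, F.2.1)

/-- The codes of the reduced forms. -/
def redCodes : List (ℕ × List (ℕ × ℕ)) := formTable.flatMap fun F => F.2.2.map fun X =>
  (F.1, F.2.1 ++ X)

/-- Forms with different numbers of points are distinct; for equal numbers the rotation test
decides. -/
theorem pairwise_codeForm_ne {l : List (ℕ × List (ℕ × ℕ))}
    (h : (l.all fun c => decide (0 < c.1) && validCode c.1 c.2) = true)
    (h' : l.Pairwise fun c d => (c.1 == d.1 && sameCode c.1 c.2 d.2) = false) :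
    (l.map fun c => codeForm c.1 c.2).Nodup := by
  rw [List.Nodup, List.pairwise_map]
  refine h'.imp_of_mem fun {c d} hc hd hcd heq => ?_
  have h1 := List.all_eq_true.1 h _ hc
  have h2 := List.all_eq_true.1 h _ hd
  rw [Bool.and_eq_true, decide_eq_true_eq] at h1 h2
  obtain ⟨N, L⟩ := c
  obtain ⟨N', L'⟩ := d
  have hN : N = N' := SameUnlabeled.card_eq (unlabel_eq_iff.1 heq)
  subst hN
  rw [sameCode_of_unlabel_eq h1.1 h1.2 h2.2 heq] at hcd
  simp at hcd

theorem ncard_setOf_mem {α : Type*} {l : List α} (h : l.Nodup) : {x | x ∈ l}.ncard = l.length := by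
  classical
  rw [← List.toFinset_card_of_nodup h, ← Set.ncard_coe_finset]
  congr 1
  ext x
  simp

theorem preCodes_nodup : (preCodes.map fun c => codeForm c.1 c.2).Nodup :=
  pairwise_codeForm_ne (by decide +kernel) (by decide +kernel)

theorem redCodes_nodup : (redCodes.map fun c => codeForm c.1 c.2).Nodup :=
  pairwise_codeForm_ne (by decide +kernel) (by decide +kernel)

theorem codes_edges1 : Codes [(0, 2), (1, 3)] edges1 := (Codes.singleton 1 3).insert 0 2

theorem codes_edges2 : Codes [(0, 3), (1, 5), (2, 4)] edges2 :=
  ((Codes.singleton 2 4).insert 1 5).insert 0 3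

theorem codes_edges3 : Codes [(0, 3), (7, 4), (1, 6), (2, 5)] edges3 :=
  (((Codes.singleton 2 5).insert 1 6).insert 7 4).insert 0 3

theorem codes_edges4 : Codes [(0, 3), (1, 4), (2, 5)] edges4 :=
  ((Codes.singleton 2 5).insert 1 4).insert 0 3

theorem codes_edges5 : Codes [(0, 3), (7, 4), (1, 5), (2, 6)] edges5 :=
  (((Codes.singleton 2 6).insert 1 5).insert 7 4).insert 0 3

theorem codes_edges6 : Codes [(0, 5), (1, 7), (2, 6), (3, 9), (4, 8)] edges6 :=
  ((((Codes.singleton 4 8).insert 3 9).insert 2 6).insert 1 7).insert 0 5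

theorem codeForms_one : codeForm 4 [(0, 2), (1, 3)] = preForm1 ∧
    codeForm 4 ([(0, 2), (1, 3)] ++ [(0, 1)]) = redForm1_1 :=
  ⟨codes_edges1.form_eq.symm, (codes_edges1.union (Codes.singleton 0 1)).form_eq.symm⟩

theorem codeForms_two : codeForm 6 [(0, 3), (1, 5), (2, 4)] = preForm2 ∧
    codeForm 6 ([(0, 3), (1, 5), (2, 4)] ++ [(5, 0), (3, 4)]) = redForm2_1 ∧
    codeForm 6 ([(0, 3), (1, 5), (2, 4)] ++ [(5, 0), (2, 3)]) = redForm2_2 ∧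
    codeForm 6 ([(0, 3), (1, 5), (2, 4)] ++ [(0, 1), (3, 4)]) = redForm2_3 :=
  have h := codes_edges2
  ⟨h.form_eq.symm, (h.union ((Codes.singleton 3 4).insert 5 0)).form_eq.symm,
    (h.union ((Codes.singleton 2 3).insert 5 0)).form_eq.symm,
    (h.union ((Codes.singleton 3 4).insert 0 1)).form_eq.symm⟩

theorem codeForms_three : codeForm 8 [(0, 3), (7, 4), (1, 6), (2, 5)] = preForm3 ∧
    codeForm 8 ([(0, 3), (7, 4), (1, 6), (2, 5)] ++ [(0, 1), (2, 3), (4, 5)]) = redForm3_1 :=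
  ⟨codes_edges3.form_eq.symm,
    (codes_edges3.union (((Codes.singleton 4 5).insert 2 3).insert 0 1)).form_eq.symm⟩

theorem codeForms_four : codeForm 6 [(0, 3), (1, 4), (2, 5)] = preForm4 ∧
    codeForm 6 ([(0, 3), (1, 4), (2, 5)] ++ [(0, 1), (1, 2)]) = redForm4_1 ∧
    codeForm 6 ([(0, 3), (1, 4), (2, 5)] ++ [(0, 1), (2, 3)]) = redForm4_2 :=
  have h := codes_edges4
  ⟨h.form_eq.symm, (h.union ((Codes.singleton 1 2).insert 0 1)).form_eq.symm,
    (h.union ((Codes.singleton 2 3).insert 0 1)).form_eq.symm⟩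

theorem codeForms_five : codeForm 8 [(0, 3), (7, 4), (1, 5), (2, 6)] = preForm5 ∧
    codeForm 8 ([(0, 3), (7, 4), (1, 5), (2, 6)] ++ [(4, 5), (0, 1), (5, 6)]) = redForm5_1 ∧
    codeForm 8 ([(0, 3), (7, 4), (1, 5), (2, 6)] ++ [(4, 5), (0, 1), (6, 7)]) = redForm5_2 ∧
    codeForm 8 ([(0, 3), (7, 4), (1, 5), (2, 6)] ++ [(4, 5), (2, 3), (1, 2)]) = redForm5_3 ∧
    codeForm 8 ([(0, 3), (7, 4), (1, 5), (2, 6)] ++ [(4, 5), (2, 3), (5, 6)]) = redForm5_4 ∧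
    codeForm 8 ([(0, 3), (7, 4), (1, 5), (2, 6)] ++ [(4, 5), (2, 3), (6, 7)]) = redForm5_5 ∧
    codeForm 8 ([(0, 3), (7, 4), (1, 5), (2, 6)] ++ [(6, 7), (2, 3), (1, 2)]) = redForm5_6 :=
  have h := codes_edges5
  ⟨h.form_eq.symm, (h.union (((Codes.singleton 5 6).insert 0 1).insert 4 5)).form_eq.symm,
    (h.union (((Codes.singleton 6 7).insert 0 1).insert 4 5)).form_eq.symm,
    (h.union (((Codes.singleton 1 2).insert 2 3).insert 4 5)).form_eq.symm,
    (h.union (((Codes.singleton 5 6).insert 2 3).insert 4 5)).form_eq.symm,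
    (h.union (((Codes.singleton 6 7).insert 2 3).insert 4 5)).form_eq.symm,
    (h.union (((Codes.singleton 1 2).insert 2 3).insert 6 7)).form_eq.symm⟩

theorem codeForms_six : codeForm 10 [(0, 5), (1, 7), (2, 6), (3, 9), (4, 8)] = preForm6 ∧
    codeForm 10 ([(0, 5), (1, 7), (2, 6), (3, 9), (4, 8)] ++
      [(0, 1), (2, 3), (4, 5), (5, 6)]) = redForm6_1 ∧
    codeForm 10 ([(0, 5), (1, 7), (2, 6), (3, 9), (4, 8)] ++
      [(2, 3), (4, 5), (5, 6), (7, 8)]) = redForm6_2 ∧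
    codeForm 10 ([(0, 5), (1, 7), (2, 6), (3, 9), (4, 8)] ++
      [(0, 1), (2, 3), (4, 5), (9, 0)]) = redForm6_3 ∧
    codeForm 10 ([(0, 5), (1, 7), (2, 6), (3, 9), (4, 8)] ++
      [(0, 1), (2, 3), (5, 6), (7, 8)]) = redForm6_4 ∧
    codeForm 10 ([(0, 5), (1, 7), (2, 6), (3, 9), (4, 8)] ++
      [(0, 1), (4, 5), (5, 6), (9, 0)]) = redForm6_5 ∧
    codeForm 10 ([(0, 5), (1, 7), (2, 6), (3, 9), (4, 8)] ++
      [(2, 3), (4, 5), (7, 8), (9, 0)]) = redForm6_6 :=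
  have h := codes_edges6
  ⟨h.form_eq.symm,
    (h.union ((((Codes.singleton 5 6).insert 4 5).insert 2 3).insert 0 1)).form_eq.symm,
    (h.union ((((Codes.singleton 7 8).insert 5 6).insert 4 5).insert 2 3)).form_eq.symm,
    (h.union ((((Codes.singleton 9 0).insert 4 5).insert 2 3).insert 0 1)).form_eq.symm,
    (h.union ((((Codes.singleton 7 8).insert 5 6).insert 2 3).insert 0 1)).form_eq.symm,
    (h.union ((((Codes.singleton 9 0).insert 5 6).insert 4 5).insert 0 1)).form_eq.symm,
    (h.union ((((Codes.singleton 9 0).insert 7 8).insert 4 5).insert 2 3)).form_eq.symm⟩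

theorem inTable_iff (U V : UCGraph) : InTable U V ↔
    (U = preForm1 ∧ V = redForm1_1) ∨
    (U = preForm2 ∧ (V = redForm2_1 ∨ V = redForm2_2 ∨ V = redForm2_3)) ∨
    (U = preForm3 ∧ V = redForm3_1) ∨
    (U = preForm4 ∧ (V = redForm4_1 ∨ V = redForm4_2)) ∨
    (U = preForm5 ∧ (V = redForm5_1 ∨ V = redForm5_2 ∨ V = redForm5_3 ∨ V = redForm5_4 ∨
      V = redForm5_5 ∨ V = redForm5_6)) ∨
    (U = preForm6 ∧ (V = redForm6_1 ∨ V = redForm6_2 ∨ V = redForm6_3 ∨ V = redForm6_4 ∨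
      V = redForm6_5 ∨ V = redForm6_6)) := by
  obtain ⟨p1, r11⟩ := codeForms_one
  obtain ⟨p2, r21, r22, r23⟩ := codeForms_two
  obtain ⟨p3, r31⟩ := codeForms_three
  obtain ⟨p4, r41, r42⟩ := codeForms_four
  obtain ⟨p5, r51, r52, r53, r54, r55, r56⟩ := codeForms_five
  obtain ⟨p6, r61, r62, r63, r64, r65, r66⟩ := codeForms_six
  simp only [InTable, formTable, List.mem_cons, exists_eq_or_imp, exists_eq_left, List.not_mem_nil,
    or_false, p1, r11, p2, r21, r22, r23, p3, r31, p4, r41, r42, p5, r51, r52, r53, r54, r55, r56,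
    p6, r61, r62, r63, r64, r65, r66, ← and_or_left]

theorem preForms_nodup :
    [preForm1, preForm2, preForm3, preForm4, preForm5, preForm6].Nodup := by
  rw [← codeForms_one.1, ← codeForms_two.1, ← codeForms_three.1, ← codeForms_four.1,
    ← codeForms_five.1, ← codeForms_six.1]
  exact preCodes_nodup

theorem redForms_nodup : [redForm1_1, redForm2_1, redForm2_2, redForm2_3, redForm3_1, redForm4_1,
    redForm4_2, redForm5_1, redForm5_2, redForm5_3, redForm5_4, redForm5_5, redForm5_6, redForm6_1,
    redForm6_2, redForm6_3, redForm6_4, redForm6_5, redForm6_6].Nodup := by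
  obtain ⟨-, r11⟩ := codeForms_one
  obtain ⟨-, r21, r22, r23⟩ := codeForms_two
  obtain ⟨-, r31⟩ := codeForms_three
  obtain ⟨-, r41, r42⟩ := codeForms_four
  obtain ⟨-, r51, r52, r53, r54, r55, r56⟩ := codeForms_five
  obtain ⟨-, r61, r62, r63, r64, r65, r66⟩ := codeForms_six
  rw [← r11, ← r21, ← r22, ← r23, ← r31, ← r41, ← r42, ← r51, ← r52, ← r53, ← r54, ← r55, ← r56,
    ← r61, ← r62, ← r63, ← r64, ← r65, ← r66]
  exact redCodes_nodup

/-- The number of points suffices, as none of the six pre-reduced forms has twelve. -/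
theorem form_ne_preForm7 {N : ℕ} (S : Set (Sym2 (Fin N))) (h : N ≠ 12) : form N S ≠ preForm7 :=
  fun heq => h (SameUnlabeled.card_eq (unlabel_eq_iff.1 heq))

theorem eReduction_iff_inTable (U V : UCGraph) :
    (∃ C : UCGraph, C.IsGenusOneTree ∧ C.EReduction U V) ↔ InTable U V := by
  refine ⟨?_, InTable.exists_eReduction⟩
  rintro ⟨C, hC, h⟩
  obtain ⟨U', V', h1, h2⟩ := hC.exists_inTable
  obtain ⟨rfl, rfl⟩ := (h2 U V).1 h
  exact h1

theorem mem_preReducedForms_iff (U : UCGraph) : U ∈ preReducedForms ↔ ∃ V, InTable U V := by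
  simp only [← eReduction_iff_inTable, preReducedForms, Set.mem_ofPred_eq]
  exact ⟨fun ⟨C, h1, V, h2⟩ => ⟨V, C, h1, h2⟩, fun ⟨V, C, h1, h2⟩ => ⟨C, h1, V, h2⟩⟩

theorem mem_reducedForms_iff (V : UCGraph) : V ∈ reducedForms ↔ ∃ U, InTable U V := by
  simp only [← eReduction_iff_inTable, reducedForms, Set.mem_ofPred_eq]
  exact ⟨fun ⟨C, h1, U, h2⟩ => ⟨U, C, h1, h2⟩, fun ⟨U, C, h1, h2⟩ => ⟨C, h1, U, h2⟩⟩

theorem mem_reducedFormsOver_iff (U V : UCGraph) : V ∈ reducedFormsOver U ↔ InTable U V :=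
  eReduction_iff_inTable U V

theorem preReducedForms_eq :
    preReducedForms = {preForm1, preForm2, preForm3, preForm4, preForm5, preForm6} := by
  ext U
  rw [mem_preReducedForms_iff]
  simp only [inTable_iff, exists_or, exists_and_left, exists_eq, or_true, and_true,
    Set.mem_insert_iff, Set.mem_singleton_iff]

theorem reducedForms_eq : reducedForms = nineteenForms := by
  ext V
  rw [mem_reducedForms_iff]
  simp only [inTable_iff, exists_or, exists_and_right, exists_eq, true_and, nineteenForms,
    Set.mem_insert_iff, Set.mem_singleton_iff, or_assoc]

end Table

end CircleTree

/-! ### The classification theorem -/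

theorem theorem2 :
    -- the six pre-reduced forms, which are pairwise different; the seventh candidate fails
    CircleTree.preReducedForms =
      {CircleTree.preForm1, CircleTree.preForm2, CircleTree.preForm3, CircleTree.preForm4,
        CircleTree.preForm5, CircleTree.preForm6} ∧
    CircleTree.preReducedForms.ncard = 6 ∧
    CircleTree.preForm7 ∉ CircleTree.preReducedForms ∧
    -- the nineteen reduced forms, which are pairwise different
    CircleTree.reducedForms = CircleTree.nineteenForms ∧
    CircleTree.reducedForms.ncard = 19 ∧
    -- which reduced forms arise from which pre-reduced form
    CircleTree.reducedFormsOver CircleTree.preForm1 = {CircleTree.redForm1_1} ∧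
    CircleTree.reducedFormsOver CircleTree.preForm2 =
      {CircleTree.redForm2_1, CircleTree.redForm2_2, CircleTree.redForm2_3} ∧
    CircleTree.reducedFormsOver CircleTree.preForm3 = {CircleTree.redForm3_1} ∧
    CircleTree.reducedFormsOver CircleTree.preForm4 =
      {CircleTree.redForm4_1, CircleTree.redForm4_2} ∧
    CircleTree.reducedFormsOver CircleTree.preForm5 =
      {CircleTree.redForm5_1, CircleTree.redForm5_2, CircleTree.redForm5_3,
        CircleTree.redForm5_4, CircleTree.redForm5_5, CircleTree.redForm5_6} ∧
    CircleTree.reducedFormsOver CircleTree.preForm6 =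
      {CircleTree.redForm6_1, CircleTree.redForm6_2, CircleTree.redForm6_3,
        CircleTree.redForm6_4, CircleTree.redForm6_5, CircleTree.redForm6_6} ∧
    -- every genus one circle tree reduces to exactly one of the nineteen forms
    ∀ C : CircleTree.UCGraph, C.IsGenusOneTree →
      ∃ V ∈ CircleTree.nineteenForms, ∀ W, C.ReducesTo W ↔ W = V := by
  have hpre := CircleTree.preReducedForms_eq
  have hred := CircleTree.reducedForms_eq
  have hover : ∀ U V, V ∈ CircleTree.reducedFormsOver U ↔ CircleTree.InTable U V :=
    CircleTree.mem_reducedFormsOver_iff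
  have hnd := CircleTree.preForms_nodup
  simp only [List.nodup_cons, List.mem_cons, List.not_mem_nil, or_false, not_or, List.nodup_nil,
    and_true, not_false_eq_true] at hnd
  obtain ⟨⟨h12, h13, h14, h15, h16⟩, ⟨h23, h24, h25, h26⟩, ⟨h34, h35, h36⟩, ⟨h45, h46⟩, h56⟩ := hnd
  refine ⟨hpre, ?_, ?_, hred, ?_, ?_, ?_, ?_, ?_, ?_, ?_, ?_⟩
  · rw [hpre]
    refine (congrArg Set.ncard (Set.ext fun U => ?_)).trans
      (CircleTree.ncard_setOf_mem CircleTree.preForms_nodup)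
    simp only [Set.mem_insert_iff, Set.mem_singleton_iff, Set.mem_ofPred_eq, List.mem_cons,
      List.not_mem_nil, or_false]
  · rw [hpre]
    rintro (h | h | h | h | h | h) <;>
      exact CircleTree.form_ne_preForm7 _ (by decide) h.symm
  · rw [hred]
    refine (congrArg Set.ncard (Set.ext fun V => ?_)).trans
      (CircleTree.ncard_setOf_mem CircleTree.redForms_nodup)
    simp only [CircleTree.nineteenForms, Set.mem_insert_iff, Set.mem_singleton_iff,
      Set.mem_ofPred_eq, List.mem_cons, List.not_mem_nil, or_false]
  · ext V
    simp only [hover, CircleTree.inTable_iff, h12, h13, h14, h15, h16, false_and, or_false,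
      true_and, Set.mem_singleton_iff]
  · ext V
    simp only [hover, CircleTree.inTable_iff, Ne.symm h12, h23, h24, h25, h26, false_and, or_false,
      false_or, true_and, Set.mem_insert_iff, Set.mem_singleton_iff]
  · ext V
    simp only [hover, CircleTree.inTable_iff, Ne.symm h13, Ne.symm h23, h34, h35, h36, false_and,
      or_false, false_or, true_and, Set.mem_singleton_iff]
  · ext V
    simp only [hover, CircleTree.inTable_iff, Ne.symm h14, Ne.symm h24, Ne.symm h34, h45, h46,
      false_and, or_false, false_or, true_and, Set.mem_insert_iff, Set.mem_singleton_iff]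
  · ext V
    simp only [hover, CircleTree.inTable_iff, Ne.symm h15, Ne.symm h25, Ne.symm h35, Ne.symm h45,
      h56, false_and, or_false, false_or, true_and, Set.mem_insert_iff, Set.mem_singleton_iff]
  · ext V
    simp only [hover, CircleTree.inTable_iff, Ne.symm h16, Ne.symm h26, Ne.symm h36, Ne.symm h46,
      Ne.symm h56, false_and, false_or, true_and, Set.mem_insert_iff, Set.mem_singleton_iff]
  -- The equivalence for `EReduction` covers every labelling and every selection of edges, so
  -- uniqueness does not depend on the edges kept.
  · intro C hC
    obtain ⟨U, V, hUV, h⟩ := hC.exists_inTable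
    refine ⟨V, hred ▸ (CircleTree.mem_reducedForms_iff V).2 ⟨U, hUV⟩, fun W => ⟨?_, ?_⟩⟩
    · rintro ⟨U', hU'⟩
      exact ((h U' W).1 hU').2
    · rintro rfl
      exact ⟨U, (h U W).2 ⟨rfl, rfl⟩⟩
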